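/- Let $\Lambda$ be the algebra of symmetric functions in infinitely many variables $x=(x_1,x_2,\dots)$, with monomial symmetric functions $m_\mu$, power sums $p_\mu$ and Schur functions $s_\mu$ indexed by partitions. For partitions of the same integer write $\mu<\lambda$ if $\mu\neq\lambda$ and $\mu_1+\cdots+\mu_i\le\lambda_1+\cdots+\lambda_i$ for all $i\ge1$ (dominance order). Let $\langle\cdot,\cdot\rangle_{q,t}$ be the bilinear form on $\Lambda\otimes\mathbb{Q}(q,t)$ with $\langle p_\lambda,p_\mu\rangle_{q,t}=\delta_{\lambda,\mu}\,z_\lambda\prod_{i}\frac{1-q^{\lambda_i}}{1-t^{\lambda_i}}$, where $z_\lambda=\prod_{j\ge1}j^{m_j}\,m_j!$ and $m_j$ is the number of parts of $\lambda$ equal to $j$. Let $M_\lambda(x;q,t)$ be the monic Macdonald functions, that is, the unique family with $M_\lambda=m_\lambda+\sum_{\mu<\lambda}v_{\lambda,\mu}(q,t)\,m_\mu$, $v_{\lambda,\mu}\in\mathbb{Q}(q,t)$, and $\langle M_\lambda,M_\mu\rangle_{q,t}=0$ for $\lambda\ne\mu$. Let $k\ge1$ be an integer, $\omega=e^{2\pi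 \mathrm{i}/k}$, and let $\lambda$ be a partition. Then for generic $\beta\in\mathbb{C}$, namely for all $\beta$ outside a finite set that may depend on $k$ and $\lambda$, the limit defining the rank $k$ Uglov function, $$U_\lambda(x;\beta,k):=\lim_{p\to1}M_\lambda\big(x;\omega p,\omega p^\beta\big),$$ exists (coefficientwise, as $p\to1$ in $\mathbb{C}\setminus\{1\}$, with the principal branch of $p^\beta$), and there are $u_{\lambda,\mu}(\beta,k)\in\mathbb{C}$ such that $$U_\lambda(x;\beta,k)=s_\lambda(x)+\sum_{\mu<\lambda}u_{\lambda,\mu}(\beta,k)\,s_\mu(x).$$ In particular this holds for all $k$ and $\lambda$ simultaneously when $\beta$ lies outside a countable set. -/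

import Mathlib

namespace SymFn

open MvPowerSeries

/-- The multiset of nonzero exponents of the monomial `x ^ α`. -/
def exponents (α : ℕ →₀ ℕ) : Multiset ℕ := α.support.val.map α

theorem finite_fiber (α : ℕ →₀ ℕ) {v : ℕ} (hv : v ≠ 0) : {i | α i = v}.Finite :=
  α.support.finite_toSet.subset fun i (hi : α i = v) => by simp [hi, hv]

theorem count_exponents (α : ℕ →₀ ℕ) {v : ℕ} (hv : v ≠ 0) :
    (exponents α).count v = Nat.card {i // α i = v} := by
  have h2 : {i | α i = v}.ncard = (α.support.filter fun i => v = α i).card := by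
    rw [← Set.ncard_coe_finset]
    congr 1
    ext i
    simp only [Finset.coe_filter, Finsupp.mem_support_iff, Set.mem_ofPred_eq]
    constructor
    · intro h; exact ⟨by rw [h]; exact hv, h.symm⟩
    · rintro ⟨_, h⟩; exact h.symm
  rw [exponents, Multiset.count_map, ← Finset.filter_val, Finset.card_val, ← h2]
  rfl

theorem exists_perm_of_exponents_eq {α β : ℕ →₀ ℕ} (h : exponents α = exponents β) :
    ∃ σ : Equiv.Perm ℕ, ∀ i, β (σ i) = α i := by
  have key : ∀ v, Nonempty ({i // α i = v} ≃ {i // β i = v}) := by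
    intro v
    rcases eq_or_ne v 0 with rfl | hv
    · have inf : ∀ γ : ℕ →₀ ℕ, Infinite {i // γ i = 0} := by
        intro γ
        have : ({i | γ i = 0} : Set ℕ).Infinite := by
          have := γ.support.finite_toSet.infinite_compl
          convert this using 1
          ext i; simp
        exact this.to_subtype
      have := inf α
      have := inf β
      exact nonempty_equiv_of_countable
    · have : Finite {i // α i = v} := (finite_fiber α hv).to_subtype
      have : Finite {i // β i = v} := (finite_fiber β hv).to_subtype
      have e : Nat.card {i // α i = v} = Nat.card {i // β i = v} := by
        rw [← count_exponents α hv, ← count_exponents β hv, h]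
      exact (Finite.card_eq (α := {i // α i = v}) (β := {i // β i = v})).1 e
  let e := fun v => (key v).some
  refine ⟨((Equiv.sigmaFiberEquiv α).symm.trans (Equiv.sigmaCongrRight fun v => e v)).trans
    (Equiv.sigmaFiberEquiv β), fun i => ?_⟩
  exact (e (α i) ⟨i, rfl⟩).2

theorem exponents_embDomain (σ : Equiv.Perm ℕ) (α : ℕ →₀ ℕ) :
    exponents (α.embDomain σ.toEmbedding) = exponents α := by
  unfold exponents
  rw [Finsupp.support_embDomain, Finset.map_val, Multiset.map_map]
  refine Multiset.map_congr rfl fun i _ => ?_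
  exact Finsupp.embDomain_apply_self ..

theorem exists_embDomain_eq (σ : Equiv.Perm ℕ) (α : ℕ →₀ ℕ) :
    ∃ β : ℕ →₀ ℕ, β.embDomain σ.toEmbedding = α := by
  refine ⟨α.embDomain σ.symm.toEmbedding, ?_⟩
  ext i
  obtain ⟨j, rfl⟩ := σ.surjective i
  rw [show σ j = σ.toEmbedding j from rfl, Finsupp.embDomain_apply_self]
  conv_lhs => rw [show j = σ.symm.toEmbedding (σ j) by simp]
  rw [Finsupp.embDomain_apply_self]; rfl

theorem sum_exponents (α : ℕ →₀ ℕ) : (exponents α).sum = α.degree := rfl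

theorem renameEquiv_eq_self_iff {R : Type*} [CommRing R] (σ : Equiv.Perm ℕ)
    (f : MvPowerSeries ℕ R) : renameEquiv R σ f = f ↔
      ∀ α : ℕ →₀ ℕ, coeff (α.embDomain σ.toEmbedding) f = coeff α f := by
  have h : ∀ α : ℕ →₀ ℕ,
      coeff (α.embDomain σ.toEmbedding) (renameEquiv R σ f) = coeff α f :=
    fun α => coeff_embDomain_rename σ.toEmbedding f α
  constructor
  · intro hf α
    rw [← h α, hf]
  · intro hf
    ext α
    obtain ⟨β, rfl⟩ := exists_embDomain_eq σ α
    rw [h, hf]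

theorem isHomogeneous_iff {R : Type*} [CommRing R] {n : ℕ} {f : MvPowerSeries ℕ R} :
    f.IsHomogeneous n ↔ ∀ α : ℕ →₀ ℕ, α.degree ≠ n → coeff α f = 0 := by
  constructor
  · intro h α hα
    exact IsHomogeneous.coeff_eq_zero h hα
  · intro h α hα
    have h1 : α.degree = n := by
      by_contra hne
      exact hα (h α hne)
    rwa [Finsupp.degree_eq_weight_one] at h1

/-- The space of symmetric functions in the variables `x₀, x₁, …`, homogeneous of degree `n`,
with coefficients in `R`: formal power series, homogeneous of degree `n`, that are invariant under
every permutation of the variables. -/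
noncomputable def SymFun (R : Type*) [CommRing R] (n : ℕ) : Submodule R (MvPowerSeries ℕ R) where
  carrier := {f | (∀ σ : Equiv.Perm ℕ, renameEquiv R σ f = f) ∧ f.IsHomogeneous n}
  add_mem' := fun hf hg =>
    ⟨fun σ => by rw [map_add, hf.1 σ, hg.1 σ], IsHomogeneous.add hf.2 hg.2⟩
  zero_mem' := ⟨fun σ => map_zero _, isHomogeneous_iff.2 fun _ _ => map_zero _⟩
  smul_mem' := fun c f hf =>
    ⟨fun σ => by rw [map_smul, hf.1 σ], isHomogeneous_iff.2 fun α hα => by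
      rw [map_smul, isHomogeneous_iff.1 hf.2 α hα, smul_zero]⟩

theorem mem_SymFun_iff {R : Type*} [CommRing R] {n : ℕ} {f : MvPowerSeries ℕ R} :
    f ∈ SymFun R n ↔
      (∀ σ : Equiv.Perm ℕ, ∀ α : ℕ →₀ ℕ, coeff (α.embDomain σ.toEmbedding) f = coeff α f) ∧
        ∀ α : ℕ →₀ ℕ, α.degree ≠ n → coeff α f = 0 := by
  rw [← isHomogeneous_iff]
  simp_rw [← renameEquiv_eq_self_iff]
  rfl

/-- The monomial symmetric function `m_μ`, the sum of all distinct monomials `x ^ α` whose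
multiset of nonzero exponents is `μ`. -/
noncomputable def msymm (R : Type*) [CommRing R] {n : ℕ} (μ : n.Partition) : SymFun R n :=
  ⟨fun α => if exponents α = μ.parts then 1 else 0, by
    refine mem_SymFun_iff.2 ⟨fun σ α => ?_, fun α hα => ?_⟩
    · change (if _ then (1 : R) else 0) = if _ then (1 : R) else 0
      rw [exponents_embDomain]
    · refine if_neg fun h => hα ?_
      rw [← sum_exponents, h, μ.parts_sum]⟩

/-- The power sum `p_r = ∑ i, x_i ^ r` (for `r ≥ 1`). -/
noncomputable def psum (R : Type*) [CommSemiring R] (r : ℕ) : MvPowerSeries ℕ R :=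
  fun α => open Classical in if ∃ i, α = Finsupp.single i r then 1 else 0

theorem coeff_psum (R : Type*) [CommSemiring R] (r : ℕ) (α : ℕ →₀ ℕ)
    [Decidable (∃ i, α = Finsupp.single i r)] :
    coeff α (psum R r) = if ∃ i, α = Finsupp.single i r then 1 else 0 := by
  rw [coeff_apply, psum]
  congr

theorem psum_mem (R : Type*) [CommRing R] (r : ℕ) : psum R r ∈ SymFun R r := by
  classical
  refine mem_SymFun_iff.2 ⟨fun σ α => ?_, fun α hα => ?_⟩
  · rw [coeff_psum, coeff_psum]
    refine if_congr ⟨?_, ?_⟩ rfl rfl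
    · rintro ⟨i, hi⟩
      refine ⟨σ.symm i, ?_⟩
      apply Finsupp.embDomain_injective σ.toEmbedding
      rw [hi, Finsupp.embDomain_single]
      simp
    · rintro ⟨i, rfl⟩
      exact ⟨σ i, by rw [Finsupp.embDomain_single]; rfl⟩
  · rw [coeff_psum]
    refine if_neg ?_
    rintro ⟨i, rfl⟩
    exact hα (by simp)

theorem psum_prod_mem (R : Type*) [CommRing R] (s : Multiset ℕ) :
    (s.map (psum R)).prod ∈ SymFun R s.sum := by
  induction s using Multiset.induction_on with
  | empty =>
    refine ⟨fun σ => by simp, isHomogeneous_iff.2 fun α hα => ?_⟩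
    classical
    rw [Multiset.map_zero, Multiset.prod_zero, coeff_one, if_neg]
    rintro rfl
    exact hα (by simp)
  | cons a s ih =>
    rw [Multiset.map_cons, Multiset.prod_cons, Multiset.sum_cons]
    exact ⟨fun σ => by rw [map_mul, (psum_mem R a).1 σ, ih.1 σ],
      IsHomogeneous.mul (psum_mem R a).2 ih.2⟩

/-- The power sum symmetric function `p_μ = p_{μ_1} p_{μ_2} ⋯`. -/
noncomputable def psumPart (R : Type*) [CommRing R] {n : ℕ} (μ : n.Partition) : SymFun R n :=
  ⟨(μ.parts.map (psum R)).prod, by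
    have h := psum_prod_mem R μ.parts
    rwa [μ.parts_sum] at h⟩

theorem exponents_add_single_card (β : ℕ →₀ ℕ) (i a : ℕ) :
    (exponents (β + Finsupp.single i a)).card ≤ (exponents β).card + 1 := by
  classical
  simp only [exponents, Multiset.card_map, Finset.card_val]
  refine (Finset.card_le_card Finsupp.support_add).trans ((Finset.card_union_le _ _).trans ?_)
  gcongr
  exact (Finset.card_le_card Finsupp.support_single_subset).trans (by simp)

theorem exponents_add_single (β : ℕ →₀ ℕ) (i a : ℕ) (ha : a ≠ 0) (hi : β i = 0) :
    exponents (β + Finsupp.single i a) = a ::ₘ exponents β := by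
  classical
  have hd : Disjoint β.support (Finsupp.single i a).support := by
    rw [Finsupp.support_single i ha]
    simpa using hi
  have h1 : (β + Finsupp.single i a).support = insert i β.support := by
    rw [Finsupp.support_add_eq hd, Finsupp.support_single i ha, Finset.union_comm]
    rfl
  have h2 : i ∉ β.support := by simpa using hi
  unfold exponents
  rw [h1, Finset.insert_val_of_notMem h2, Multiset.map_cons]
  congr 1
  · simp [hi]
  · refine Multiset.map_congr rfl fun j hj => ?_
    have : i ≠ j := fun h => h2 (by rw [h]; exact hj)
    simp [this]

theorem exists_exponents {s : Multiset ℕ} (hs : ∀ a ∈ s, 0 < a) : ∃ α, exponents α = s := by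
  induction s using Multiset.induction_on with
  | empty => exact ⟨0, by simp [exponents]⟩
  | cons a s ih =>
    obtain ⟨β, hβ⟩ := ih fun b hb => hs b (Multiset.mem_cons_of_mem hb)
    obtain ⟨i, hi⟩ := Infinite.exists_notMem_finset β.support
    refine ⟨β + Finsupp.single i a, ?_⟩
    rw [exponents_add_single β i a (hs a (Multiset.mem_cons_self a s)).ne' (by simpa using hi), hβ]

/-- If `x ^ α` occurs in `p_s` then `α` has at most as many nonzero exponents as `s` has parts,
with equality only if `s` is the multiset of exponents of `α`. -/
theorem coeff_psum_prod_eq_zero {s : Multiset ℕ} (hs : ∀ a ∈ s, 0 < a) {α : ℕ →₀ ℕ}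
    (h : coeff α ((s.map (psum ℕ)).prod) ≠ 0) :
    (exponents α).card < s.card ∨ exponents α = s := by
  classical
  induction s using Multiset.induction_on generalizing α with
  | empty =>
    rw [Multiset.map_zero, Multiset.prod_zero, coeff_one] at h
    have : α = 0 := by by_contra hne; exact h (if_neg hne)
    right
    simp [this, exponents]
  | cons a s ih =>
    rw [Multiset.map_cons, Multiset.prod_cons, coeff_mul] at h
    obtain ⟨⟨γ, β⟩, hmem, hne⟩ := Finset.exists_ne_zero_of_sum_ne_zero h
    have h1 : coeff γ (psum ℕ a) ≠ 0 := left_ne_zero_of_mul hne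
    have h2 : coeff β ((s.map (psum ℕ)).prod) ≠ 0 := right_ne_zero_of_mul hne
    rw [coeff_psum] at h1
    have h3 : ∃ i, γ = Finsupp.single i a := by by_contra hn; exact h1 (if_neg hn)
    obtain ⟨i, rfl⟩ := h3
    rw [Finset.HasAntidiagonal.mem_antidiagonal] at hmem
    obtain rfl : β + Finsupp.single i a = α := by rw [add_comm]; exact hmem
    have ha : a ≠ 0 := (hs a (Multiset.mem_cons_self a s)).ne'
    rw [Multiset.card_cons]
    have hcard := exponents_add_single_card β i a
    rcases ih (fun b hb => hs b (Multiset.mem_cons_of_mem hb)) h2 with hlt | heq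
    · left; omega
    · by_cases hi : β i = 0
      · right; rw [exponents_add_single β i a ha hi, heq]
      · left
        have hsupp : (β + Finsupp.single i a).support ⊆ β.support := by
          intro j hj
          rw [Finsupp.mem_support_iff] at hj ⊢
          intro h0
          by_cases hij : i = j
          · exact hi (by rw [hij]; exact h0)
          · exact hj (by simp [h0, hij])
        have := Finset.card_le_card hsupp
        rw [← heq]
        simp only [exponents, Multiset.card_map, Finset.card_val]
        omega

theorem coeff_psum_prod_ne_zero {s : Multiset ℕ} (hs : ∀ a ∈ s, 0 < a) :
    ∃ α, exponents α = s ∧ coeff α ((s.map (psum ℕ)).prod) ≠ 0 := by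
  classical
  induction s using Multiset.induction_on with
  | empty => exact ⟨0, by simp [exponents], by simp⟩
  | cons a s ih =>
    obtain ⟨β, hβ, hc⟩ := ih fun b hb => hs b (Multiset.mem_cons_of_mem hb)
    obtain ⟨i, hi⟩ := Infinite.exists_notMem_finset β.support
    refine ⟨β + Finsupp.single i a, ?_, ?_⟩
    · rw [exponents_add_single β i a (hs a (Multiset.mem_cons_self a s)).ne' (by simpa using hi),
        hβ]
    · rw [Multiset.map_cons, Multiset.prod_cons, coeff_mul]
      intro h0
      have h1 := (Finset.sum_eq_zero_iff.1 h0) (Finsupp.single i a, β)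
        (by rw [Finset.HasAntidiagonal.mem_antidiagonal, add_comm])
      rw [coeff_psum, if_pos ⟨i, rfl⟩, one_mul] at h1
      exact hc h1

theorem coeff_psum_prod_cast (R : Type*) [CommRing R] (s : Multiset ℕ) (α : ℕ →₀ ℕ) :
    coeff α ((s.map (psum R)).prod) = ((coeff α ((s.map (psum ℕ)).prod) : ℕ) : R) := by
  classical
  have h : (s.map (psum R)).prod
      = MvPowerSeries.map (Nat.castRingHom R) ((s.map (psum ℕ)).prod) := by
    rw [map_multiset_prod, Multiset.map_map]
    congr 1
    refine Multiset.map_congr rfl fun r _ => ?_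
    ext β
    rw [Function.comp_apply, coeff_map, coeff_psum, coeff_psum]
    split_ifs <;> simp
  rw [h, coeff_map]
  rfl

theorem coeff_eq_of_exponents_eq {R : Type*} [CommRing R] {n : ℕ} {f : MvPowerSeries ℕ R}
    (hf : f ∈ SymFun R n) {α β : ℕ →₀ ℕ} (h : exponents α = exponents β) :
    coeff α f = coeff β f := by
  obtain ⟨σ, hσ⟩ := exists_perm_of_exponents_eq h
  have : α.embDomain σ.toEmbedding = β := by
    ext i
    obtain ⟨j, rfl⟩ := σ.surjective i
    rw [hσ, show σ j = σ.toEmbedding j from rfl, Finsupp.embDomain_apply_self]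
  rw [← this, (mem_SymFun_iff.1 hf).1]

/-- An exponent vector whose multiset of nonzero exponents is `μ`. -/
noncomputable def expVec {n : ℕ} (μ : n.Partition) : ℕ →₀ ℕ :=
  (exists_exponents (s := μ.parts) fun _ ha => μ.parts_pos ha).choose

theorem exponents_expVec {n : ℕ} (μ : n.Partition) : exponents (expVec μ) = μ.parts :=
  (exists_exponents (s := μ.parts) fun _ ha => μ.parts_pos ha).choose_spec

/-- The coordinates of a symmetric function with respect to the `m_μ`. -/
noncomputable def mcoord (R : Type*) [CommRing R] (n : ℕ) : SymFun R n →ₗ[R] (n.Partition → R) :=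
  LinearMap.pi fun μ => (coeff (expVec μ)).comp (SymFun R n).subtype

theorem mcoord_apply {R : Type*} [CommRing R] {n : ℕ} (f : SymFun R n) (μ : n.Partition) :
    mcoord R n f μ = coeff (expVec μ) (f : MvPowerSeries ℕ R) := rfl

theorem mcoord_injective (R : Type*) [CommRing R] (n : ℕ) :
    Function.Injective (mcoord R n) := by
  rw [← LinearMap.ker_eq_bot, LinearMap.ker_eq_bot']
  intro f hf
  ext α
  by_cases hα : α.degree = n
  · let μ : n.Partition := ⟨exponents α, by
      intro i hi
      simp only [exponents, Multiset.mem_map, Finset.mem_val, Finsupp.mem_support_iff] at hi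
      obtain ⟨j, hj, rfl⟩ := hi
      exact Nat.pos_of_ne_zero hj, by rw [sum_exponents, hα]⟩
    have h1 : coeff (expVec μ) (f : MvPowerSeries ℕ R) = 0 := congrFun hf μ
    rw [← coeff_eq_of_exponents_eq f.2 (exponents_expVec μ), h1]
    rfl
  · exact (mem_SymFun_iff.1 f.2).2 α hα

theorem linearIndependent_psumPart (K : Type*) [Field K] [CharZero K] (n : ℕ) :
    LinearIndependent K (psumPart K (n := n)) := by
  classical
  rw [Fintype.linearIndependent_iff]
  intro c hc
  -- strong induction, from partitions with many parts to partitions with few parts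
  have key : ∀ N : ℕ, ∀ μ : n.Partition, n ≤ μ.parts.card + N → c μ = 0 := by
    intro N
    induction N using Nat.strong_induction_on with
    | _ N ih =>
    intro μ hμ
    obtain ⟨α, hα, hne⟩ := coeff_psum_prod_ne_zero (s := μ.parts) fun _ ha => μ.parts_pos ha
    have h0 := congrArg (fun f : SymFun K n => coeff α (f : MvPowerSeries ℕ K)) hc
    simp only [Submodule.coe_sum, Submodule.coe_smul, map_sum, map_smul, smul_eq_mul,
      Submodule.coe_zero, map_zero] at h0
    rw [Finset.sum_eq_single μ] at h0
    · have h1 : coeff α (psumPart K μ : MvPowerSeries ℕ K) ≠ 0 := by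
        change coeff α ((μ.parts.map (psum K)).prod) ≠ 0
        rw [coeff_psum_prod_cast]
        exact_mod_cast hne
      exact (mul_eq_zero.1 h0).resolve_right h1
    · intro ν _ hν
      by_cases hz : coeff α ((ν.parts.map (psum ℕ)).prod) = 0
      · have : coeff α (psumPart K ν : MvPowerSeries ℕ K) = 0 := by
          change coeff α ((ν.parts.map (psum K)).prod) = 0
          rw [coeff_psum_prod_cast, hz, Nat.cast_zero]
        rw [this, mul_zero]
      · rcases coeff_psum_prod_eq_zero (fun _ ha => ν.parts_pos ha) hz with hlt | heq
        · rw [hα] at hlt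
          have hN : N ≠ 0 := by
            rintro rfl
            have hle : ν.parts.card ≤ ν.parts.sum := by
              have := Multiset.card_nsmul_le_sum (s := ν.parts) (a := 1)
                fun _ ha => ν.parts_pos ha
              simpa using this
            rw [ν.parts_sum] at hle
            omega
          rw [ih (N - 1) (by omega) ν (by omega), zero_mul]
        · exact absurd (Nat.Partition.ext (by rw [← heq, hα])) hν
    · intro h
      exact absurd (Finset.mem_univ μ) h
  exact fun μ => key n μ (Nat.le_add_left n _)

instance finite_SymFun (K : Type*) [Field K] (n : ℕ) : FiniteDimensional K (SymFun K n) :=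
  FiniteDimensional.of_injective (mcoord K n) (mcoord_injective K n)

/-- The power sums `p_μ`, `μ ⊢ n`, as a basis of the symmetric functions of degree `n`. -/
noncomputable def psumBasis (K : Type*) [Field K] [CharZero K] (n : ℕ) :
    Module.Basis n.Partition K (SymFun K n) :=
  basisOfLinearIndependentOfCardEqFinrank' (psumPart K) (linearIndependent_psumPart K n) <| by
    apply le_antisymm
    · exact (linearIndependent_psumPart K n).fintype_card_le_finrank
    · have h := LinearMap.finrank_le_finrank_of_injective (mcoord_injective K n)
      rwa [Module.finrank_fintype_fun_eq_card] at h

theorem psumBasis_apply (K : Type*) [Field K] [CharZero K] {n : ℕ} (μ : n.Partition) :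
    psumBasis K n μ = psumPart K μ := by
  simp [psumBasis]

/-- Dominance order on partitions of `n`: `μ ≤ lam` if every partial sum
`μ_1 + ⋯ + μ_i` of the parts in decreasing order is at most `lam_1 + ⋯ + lam_i`. -/
def DomLE {n : ℕ} (μ lam : n.Partition) : Prop :=
  ∀ i : ℕ, ((μ.parts.sort (· ≥ ·)).take i).sum ≤ ((lam.parts.sort (· ≥ ·)).take i).sum

/-- Strict dominance order. -/
def DomLT {n : ℕ} (μ lam : n.Partition) : Prop := DomLE μ lam ∧ μ ≠ lam

noncomputable instance decidableDomLT {n : ℕ} (μ lam : n.Partition) : Decidable (DomLT μ lam) :=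
  Classical.dec _

/-- The Young diagram whose row lengths are the parts of `lam` in decreasing order. -/
def diagram {n : ℕ} (lam : n.Partition) : YoungDiagram :=
  YoungDiagram.ofRowLens (lam.parts.sort (· ≥ ·)) (Multiset.pairwise_sort _ _).sortedGE

/-- The Schur function `s_lam`: the coefficient of `x ^ α` is the number of semistandard Young
tableaux of shape `lam` in which each `i` occurs exactly `α i` times. -/
noncomputable def schur (R : Type*) [CommRing R] {n : ℕ} (lam : n.Partition) :
    MvPowerSeries ℕ R :=
  fun α => (({T : SemistandardYoungTableau (diagram lam) |
    ∀ i, ((diagram lam).cells.filter fun c => T c.1 c.2 = i).card = α i}.ncard : ℕ) : R)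

/-- The field `ℚ(q, t)`. -/
abbrev QT : Type := FractionRing (MvPolynomial (Fin 2) ℚ)

/-- The indeterminate `q` of `ℚ(q, t)`. -/
noncomputable def qvar : QT := algebraMap (MvPolynomial (Fin 2) ℚ) QT (MvPolynomial.X 0)

/-- The indeterminate `t` of `ℚ(q, t)`. -/
noncomputable def tvar : QT := algebraMap (MvPolynomial (Fin 2) ℚ) QT (MvPolynomial.X 1)

/-- `z_μ = ∏ j, j ^ m_j * m_j !`, where `m_j` is the multiplicity of the part `j` in `μ`. -/
def zPart {n : ℕ} (μ : n.Partition) : ℕ :=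
  ∏ j ∈ μ.parts.toFinset, j ^ μ.parts.count j * (μ.parts.count j).factorial

/-- The norm `z_μ ∏ i, (1 - q ^ μ_i) / (1 - t ^ μ_i)` of the power sum `p_μ`. -/
noncomputable def psumNorm {n : ℕ} (μ : n.Partition) : QT :=
  (zPart μ : QT) * (μ.parts.map fun r => (1 - qvar ^ r) / (1 - tvar ^ r)).prod

/-- The Macdonald inner product: the bilinear form over `ℚ(q, t)` for which the power sums `p_μ`
are orthogonal with norms `psumNorm μ`. -/
noncomputable def macdonaldForm (n : ℕ) : LinearMap.BilinForm QT (SymFun QT n) :=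
  Matrix.toBilin (psumBasis QT n) (Matrix.diagonal psumNorm)

theorem macdonaldForm_psumPart {n : ℕ} (lam μ : n.Partition) :
    macdonaldForm n (psumPart QT lam) (psumPart QT μ) = if lam = μ then psumNorm lam else 0 := by
  rw [← psumBasis_apply, ← psumBasis_apply, macdonaldForm, ← LinearMap.BilinForm.toMatrix_apply,
    LinearMap.BilinForm.toMatrix_toBilin, Matrix.diagonal_apply]

/-- The defining conditions of the family of monic Macdonald functions of degree `n`:
unitriangularity, for the dominance order, in the basis of monomial symmetric functions, and
orthogonality for the Macdonald inner product. -/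
structure IsMacdonaldFamily (n : ℕ) (M : n.Partition → SymFun QT n) : Prop where
  triangular : ∀ lam : n.Partition, ∃ v : n.Partition → QT,
    M lam = msymm QT lam + ∑ μ with DomLT μ lam, v μ • msymm QT μ
  orthogonal : ∀ lam μ : n.Partition, lam ≠ μ → macdonaldForm n (M lam) (M μ) = 0

/-- The monic Macdonald function `M_lam(x; q, t)`: the member with index `lam` of the unique
family with the defining properties. -/
noncomputable def macdonald {n : ℕ} (lam : n.Partition) : SymFun QT n :=
  Classical.epsilon (IsMacdonaldFamily n) lam

/-- The value at the complex point `(q, t)` of a rational function in two variables, written as a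
reduced fraction. -/
noncomputable def evalAt (q t : ℂ) (r : QT) : ℂ :=
  MvPolynomial.aeval ![q, t] (IsFractionRing.num (MvPolynomial (Fin 2) ℚ) r) /
    MvPolynomial.aeval ![q, t] (IsFractionRing.den (MvPolynomial (Fin 2) ℚ) r).1

/-- The Macdonald function at complex values of the parameters. -/
noncomputable def macdonaldAt {n : ℕ} (lam : n.Partition) (q t : ℂ) : MvPowerSeries ℕ ℂ :=
  fun α => evalAt q t (coeff α (macdonald lam : MvPowerSeries ℕ QT))

/-- The function `M_lam(x; ω p, ω p ^ β)` of which the Uglov function is the limit as `p → 1`,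
where `ω = exp (2 π i / k)` and `p ^ β` is the principal branch. -/
noncomputable def preUglov {n : ℕ} (lam : n.Partition) (β : ℂ) (k : ℕ) (p : ℂ) :
    MvPowerSeries ℕ ℂ :=
  macdonaldAt lam (Complex.exp (2 * Real.pi * Complex.I / k) * p)
    (Complex.exp (2 * Real.pi * Complex.I / k) * p ^ β)

/-- The Uglov function `U_lam(x; β, k)` of rank `k`: the coefficientwise limit of
`M_lam(x; ω p, ω p ^ β)` as `p → 1`, `p ≠ 1`. -/
noncomputable def uglov {n : ℕ} (lam : n.Partition) (β : ℂ) (k : ℕ) : MvPowerSeries ℕ ℂ :=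
  fun α => Filter.limUnder (nhdsWithin (1 : ℂ) {1}ᶜ) fun p => coeff α (preUglov lam β k p)

end SymFn

/-! `M_λ` is orthogonal to every `m_μ` with `μ < λ`, so its lower coefficients solve a linear system
whose matrix is the Gram matrix of these `m_μ`, and Cramer's rule expresses them in the norms of the
power sums (`det_gramBelow_mul_eq`, `coeff_macdonaldAt`). At `q = ωp`, `t = ωp^β` the factor `(1 -
q^r)/(1 - t^r)` tends to `1/β` if `k ∣ r` and to `1` otherwise (`tendsto_norm_factor`). The Gram
determinant therefore tends to a polynomial over `ℚ` evaluated at `x = 1/β`. At `x = 1` the norms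
become `z_ν > 0` and the form is positive definite, so this polynomial is not zero and only finitely
many `β` are lost (`eventually_det_limNorm_ne_zero`). For every other `β` the coefficients converge
and the limit is `m_λ` plus lower monomial functions. Since the Kostka matrix is unitriangular
(`schur_sub_msymm_mem`), it is also `s_λ` plus lower Schur functions.

Two inputs need real work. The first is the existence of a Macdonald family: `macdonald` is an
arbitrary choice, about which nothing is known until some family is exhibited. The family consists
of eigenvectors of Macdonald's operator, realised on polynomials in the `p_r` as the constant term
in `z` of a vertex operator, a translation of the `p_r` followed by multiplication by an exponential
series in `1/z`. The operator is self-adjoint (`macOp_selfAdjoint`) because translation and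
multiplication are adjoint up to powers of `t`. It is triangular on products of the `g_r`
(`macOp_sub_mem_strictDomSpan`). These products are dual to the monomials (`coeff_eq_pform`), so it
is triangular on the `m_μ` as well (`symOp_msymm`), and its eigenvalues are distinct
(`eigval_injective`).

The second is the symmetry of Schur functions, which are defined here by tableaux; it comes from the
Bender–Knuth involution (`kostka_swap`). -/

namespace SymFn

open Finset

/-! ### Exponentials through Newton's recursion -/

section Newton

variable {R : Type*} [CommRing R] [Algebra ℚ R]

/-- The coefficients of `exp (∑ r ≥ 1, a r * y ^ r / r)`, computed by Newton's recursion. -/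
noncomputable def newton (a : ℕ → R) : ℕ → R
  | 0 => 1
  | m + 1 => (1 / (m + 1 : ℚ)) • ∑ i : Fin (m + 1), a (i + 1) * newton a (m - i)

theorem newton_zero (a : ℕ → R) : newton a 0 = 1 := by rw [newton]

theorem newton_succ (a : ℕ → R) (m : ℕ) :
    ((m + 1 : ℕ) : R) * newton a (m + 1) =
      ∑ x ∈ antidiagonal m, a (x.1 + 1) * newton a x.2 := by
  rw [newton, Finset.Nat.sum_antidiagonal_eq_sum_range_succ (fun i j => a (i + 1) * newton a j),
    Finset.sum_range, ← nsmul_eq_mul, ← Nat.cast_smul_eq_nsmul ℚ, smul_smul]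
  have : (((m + 1 : ℕ) : ℚ) * (1 / (m + 1))) = 1 := by
    push_cast
    field_simp
  rw [this, one_smul]

theorem natCast_mul_cancel {m : ℕ} {x y : R} (h : ((m + 1 : ℕ) : R) * x = ((m + 1 : ℕ) : R) * y) :
    x = y := by
  have h2 : (m + 1) • x = (m + 1) • y := by simpa only [nsmul_eq_mul] using h
  rw [← Nat.cast_smul_eq_nsmul ℚ, ← Nat.cast_smul_eq_nsmul ℚ (m + 1) y] at h2
  have hne : ((m + 1 : ℕ) : ℚ) ≠ 0 := by positivity
  have h3 := congrArg (fun z => ((m + 1 : ℕ) : ℚ)⁻¹ • z) h2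
  simpa only [smul_smul, inv_mul_cancel₀ hne, one_smul] using h3

/-- Newton's recursion determines its solution because `m + 1` is invertible in a `ℚ`-algebra.
Identities between exponentials are then proved by checking that the other side satisfies the same
recursion. -/
theorem eq_newton {a F : ℕ → R} (h0 : F 0 = 1)
    (h : ∀ m, ((m + 1 : ℕ) : R) * F (m + 1) = ∑ x ∈ antidiagonal m, a (x.1 + 1) * F x.2)
    (m : ℕ) : F m = newton a m := by
  induction m using Nat.strong_induction_on with
  | _ m ih =>
  cases m with
  | zero => rw [h0, newton_zero]
  | succ m =>
    refine natCast_mul_cancel (m := m) ?_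
    rw [h, newton_succ]
    refine Finset.sum_congr rfl fun x hx => ?_
    rw [ih]
    have := HasAntidiagonal.mem_antidiagonal.1 hx
    omega

theorem newton_congr {a b : ℕ → R} (h : ∀ r, r ≠ 0 → a r = b r) (m : ℕ) :
    newton a m = newton b m := by
  refine eq_newton (newton_zero _) (fun m => ?_) m
  rw [newton_succ]
  exact Finset.sum_congr rfl fun x _ => by rw [h _ (Nat.succ_ne_zero _)]

theorem derivative_mk_newton (a : ℕ → R) :
    PowerSeries.derivative R (PowerSeries.mk (newton a)) =
      PowerSeries.mk (fun i => a (i + 1)) * PowerSeries.mk (newton a) := by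
  ext m
  rw [PowerSeries.coeff_derivative, PowerSeries.coeff_mul, PowerSeries.coeff_mk, mul_comm]
  simp only [PowerSeries.coeff_mk]
  rw [← newton_succ]
  push_cast
  rfl

/-- This is `exp (A + B) = exp A * exp B`: by Leibniz the logarithmic derivative of the product is
the sum of the two, which is the recursion. -/
theorem newton_add (a b : ℕ → R) (m : ℕ) :
    newton (fun r => a r + b r) m = ∑ x ∈ antidiagonal m, newton a x.1 * newton b x.2 := by
  have key : ∀ m, PowerSeries.coeff m (PowerSeries.mk (newton a) * PowerSeries.mk (newton b)) =
      newton (fun r => a r + b r) m := by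
    refine eq_newton ?_ fun m => ?_
    · simp [PowerSeries.coeff_mul, newton_zero]
    · have h := PowerSeries.coeff_derivative
        (PowerSeries.mk (newton a) * PowerSeries.mk (newton b)) m
      rw [Derivation.leibniz, derivative_mk_newton, derivative_mk_newton] at h
      rw [Nat.cast_add, Nat.cast_one, mul_comm, ← h]
      have : PowerSeries.mk (newton a) • (PowerSeries.mk (fun i => b (i + 1)) *
          PowerSeries.mk (newton b)) + PowerSeries.mk (newton b) •
          (PowerSeries.mk (fun i => a (i + 1)) * PowerSeries.mk (newton a)) =
          PowerSeries.mk (fun i => a (i + 1) + b (i + 1)) *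
          (PowerSeries.mk (newton a) * PowerSeries.mk (newton b)) := by
        have h2 : PowerSeries.mk (fun i => a (i + 1) + b (i + 1)) =
            PowerSeries.mk (fun i => a (i + 1)) + PowerSeries.mk (fun i => b (i + 1)) := by
          ext; simp
        rw [h2, smul_eq_mul, smul_eq_mul]
        ring
      rw [this, PowerSeries.coeff_mul]
      simp only [PowerSeries.coeff_mk]
  rw [← key, PowerSeries.coeff_mul]
  simp only [PowerSeries.coeff_mk]

theorem map_newton {S : Type*} [CommRing S] [Algebra ℚ S] (f : R →+* S) (a : ℕ → R) (m : ℕ) :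
    f (newton a m) = newton (fun r => f (a r)) m := by
  refine eq_newton (F := fun m => f (newton a m)) ?_ (fun m => ?_) m
  · rw [newton_zero, map_one]
  · rw [← map_natCast f, ← map_mul, newton_succ, map_sum]
    simp only [map_mul]

theorem newton_scale (c : R) (a : ℕ → R) (m : ℕ) :
    newton (fun r => c ^ r * a r) m = c ^ m * newton a m := by
  symm
  refine eq_newton (F := fun m => c ^ m * newton a m) ?_ (fun m => ?_) m
  · rw [newton_zero, pow_zero, one_mul]
  · rw [mul_left_comm, newton_succ, Finset.mul_sum]
    refine Finset.sum_congr rfl fun x hx => ?_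
    rw [← HasAntidiagonal.mem_antidiagonal.1 hx]
    ring

theorem newton_const_one (m : ℕ) : newton (fun _ => (1 : R)) m = 1 := by
  symm
  refine eq_newton (F := fun _ => 1) rfl (fun m => ?_) m
  simp

theorem newton_const_zero (m : ℕ) : newton (fun _ => (0 : R)) m = if m = 0 then 1 else 0 := by
  symm
  refine eq_newton (F := fun m => if m = 0 then 1 else 0) rfl (fun m => ?_) m
  simp

/-- The generating series is `(1 - u y) / (1 - y)`, all of whose coefficients past the constant term
equal `1 - u`. -/
theorem newton_one_sub_pow (u : R) (m : ℕ) :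
    newton (fun r => 1 - u ^ r) (m + 1) = 1 - u := by
  have h1 : ∀ m, newton (fun _ => (-1 : R)) m = if m = 0 then 1 else if m = 1 then -1 else 0 := by
    intro m
    symm
    refine eq_newton (F := fun m => if m = 0 then 1 else if m = 1 then -1 else 0) rfl
      (fun m => ?_) m
    rw [Finset.Nat.sum_antidiagonal_eq_sum_range_succ_mk]
    rcases m with _ | m
    · simp
    · rw [Finset.sum_range_succ, Finset.sum_range_succ, Finset.sum_eq_zero]
      · simp
      · intro i hi
        have := Finset.mem_range.1 hi
        rw [if_neg (by omega), if_neg (by omega), mul_zero]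
  have h2 : (fun r => 1 - u ^ r) = fun r => (fun _ => (1 : R)) r + (fun r => u ^ r * (-1)) r := by
    funext r
    ring
  rw [h2, newton_add]
  simp only [newton_const_one, newton_scale, h1]
  rw [Finset.Nat.sum_antidiagonal_eq_sum_range_succ_mk, Finset.sum_range_succ,
    Finset.sum_range_succ, Finset.sum_eq_zero]
  · simp
    ring
  · intro i hi
    have := Finset.mem_range.1 hi
    simp only [one_mul]
    rw [if_neg (by omega), if_neg (by omega), mul_zero]

/-- A derivation sending `a r` to the scalar `c` and killing the other `a s` acts on
`newton a` as a shift by `r`. -/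
theorem derivation_newton {S : Type*} [CommRing S] [Algebra S R] (d : Derivation S R R) {a : ℕ → R}
    {r : ℕ} (hr : r ≠ 0) {c : R} (h : ∀ s, s ≠ 0 → d (a s) = if s = r then c else 0) (m : ℕ) :
    (r : R) * d (newton a m) = if r ≤ m then c * newton a (m - r) else 0 := by
  induction m using Nat.strong_induction_on with
  | _ m ih =>
  cases m with
  | zero => rw [newton_zero, Derivation.map_one_eq_zero, mul_zero, if_neg (by omega)]
  | succ m =>
    refine natCast_mul_cancel (m := m) ?_
    have h0 := congrArg d (newton_succ a m)
    rw [Derivation.leibniz, Derivation.map_natCast, smul_zero, add_zero, smul_eq_mul, map_sum] at h0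
    rw [mul_left_comm, h0, Finset.mul_sum]
    simp only [Derivation.leibniz, smul_eq_mul, mul_add, Finset.sum_add_distrib]
    -- By Leibniz there are two sums. Here `d` hits `a`, only `a r` survives, and the multiplicity
    -- is `r`. In `h2` it hits `newton a`, and the induction hypothesis with the recursion gives
    -- multiplicity `m + 1 - r`. Together they make `m + 1`.
    have h1 : ∑ x ∈ antidiagonal m, (r : R) * (newton a x.2 * d (a (x.1 + 1))) =
        if r ≤ m + 1 then (r : R) * (c * newton a (m + 1 - r)) else 0 := by
      split_ifs with hrm
      · rw [Finset.sum_eq_single (r - 1, m + 1 - r)]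
        · rw [h _ (by omega), if_pos (by simp; omega)]
          ring
        · rintro ⟨i, j⟩ hx hne
          rw [h _ (by omega), if_neg, mul_zero, mul_zero]
          rintro rfl
          apply hne
          have := HasAntidiagonal.mem_antidiagonal.1 hx
          ext <;> simp at this ⊢
          omega
        · intro hn
          exact absurd (HasAntidiagonal.mem_antidiagonal.2 (by simp; omega)) hn
      · refine Finset.sum_eq_zero fun x hx => ?_
        have := HasAntidiagonal.mem_antidiagonal.1 hx
        rw [h _ (by omega), if_neg (by omega), mul_zero, mul_zero]
    have h2 : ∑ x ∈ antidiagonal m, (r : R) * (a (x.1 + 1) * d (newton a x.2)) =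
        if r ≤ m then ((m + 1 - r : ℕ) : R) * (c * newton a (m + 1 - r)) else 0 := by
      have h3 : ∀ x ∈ antidiagonal m, (r : R) * (a (x.1 + 1) * d (newton a x.2)) =
          if r ≤ x.2 then a (x.1 + 1) * (c * newton a (x.2 - r)) else 0 := by
        intro x hx
        have := HasAntidiagonal.mem_antidiagonal.1 hx
        rw [mul_left_comm, ih x.2 (by omega)]
        split_ifs <;> simp
      rw [Finset.sum_congr rfl h3, ← Finset.sum_filter]
      split_ifs with hrm
      · obtain ⟨k, rfl⟩ := Nat.exists_eq_add_of_le' hrm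
        rw [show k + r + 1 - r = k + 1 by omega, mul_left_comm, newton_succ, Finset.mul_sum]
        symm
        refine Finset.sum_bij (fun x _ => (x.1, x.2 + r)) ?_ ?_ ?_ ?_
        · intro x hx
          have := HasAntidiagonal.mem_antidiagonal.1 hx
          simp
          omega
        · rintro ⟨a, b⟩ _ ⟨a', b'⟩ _ hxy
          simpa using hxy
        · rintro ⟨i, j⟩ hx
          simp only [Finset.mem_filter, HasAntidiagonal.mem_antidiagonal] at hx
          exact ⟨(i, j - r), by simp; omega, by
            rw [Nat.sub_add_cancel hx.2]⟩
        · intro x hx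
          simp
          ring
      · refine Finset.sum_eq_zero fun x hx => ?_
        simp only [Finset.mem_filter, HasAntidiagonal.mem_antidiagonal] at hx
        omega
    rw [h1, h2]
    by_cases hrm : r ≤ m
    · rw [if_pos hrm, if_pos (by omega), if_pos (by omega), Nat.cast_sub (by omega)]
      ring
    · by_cases hrm1 : r = m + 1
      · rw [if_neg hrm, if_pos (by omega), if_pos (by omega), hrm1]
        ring
      · rw [if_neg hrm, if_neg (by omega), if_neg (by omega)]
        ring

end Newton

/-! ### Vertex operators on the polynomial ring in the power sums -/

section Vertex

variable {K : Type*} [Field K]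

/-- The scalar `κ r` for which `κ r * ∂ / ∂ p_r` is adjoint to multiplication by `p_r`. -/
noncomputable def kap (q t : K) (r : ℕ) : K := r * ((1 - q ^ r) / (1 - t ^ r))

/-- The norm of the monomial with exponents `α` in the power sums. -/
noncomputable def wt (q t : K) (α : ℕ →₀ ℕ) : K :=
  α.prod fun r a => (a.factorial : K) * kap q t r ^ a

theorem wt_add_single (q t : K) (α : ℕ →₀ ℕ) (r : ℕ) :
    wt q t (α + Finsupp.single r 1) = wt q t α * ((α r + 1) * kap q t r) := by
  classical
  have h : ∀ γ : ℕ →₀ ℕ, γ.support ⊆ α.support ∪ {r} → wt q t γ =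
      ∏ s ∈ α.support ∪ {r}, ((γ s).factorial : K) * kap q t s ^ γ s := fun γ hγ =>
    Finsupp.prod_of_support_subset _ hγ _ (by simp)
  rw [h α Finset.subset_union_left, h (α + Finsupp.single r 1)
    (Finsupp.support_add.trans (Finset.union_subset_union_right Finsupp.support_single_subset)),
    ← Finset.mul_prod_erase _ _ (a := r) (by simp), ← Finset.mul_prod_erase _ (fun s =>
      ((α s).factorial : K) * kap q t s ^ α s) (a := r) (by simp)]
  have h2 : ∏ s ∈ (α.support ∪ {r}).erase r, (((α + Finsupp.single r 1 : ℕ →₀ ℕ) s).factorial : K) *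
      kap q t s ^ (α + Finsupp.single r 1 : ℕ →₀ ℕ) s = ∏ s ∈ (α.support ∪ {r}).erase r,
        ((α s).factorial : K) * kap q t s ^ α s := by
    refine Finset.prod_congr rfl fun s hs => ?_
    have : r ≠ s := (Finset.ne_of_mem_erase hs).symm
    simp [this]
  rw [h2]
  simp only [Finsupp.add_apply, Finsupp.single_eq_same, Nat.factorial_succ]
  push_cast
  ring

/-- The Macdonald inner product on the polynomial ring in the power sums. -/
noncomputable def pform (q t : K) : MvPolynomial ℕ K →ₗ[K] MvPolynomial ℕ K →ₗ[K] K :=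
  (MvPolynomial.basisMonomials ℕ K).constr K fun α => wt q t α • MvPolynomial.lcoeff K α

theorem pform_monomial (q t : K) (α : ℕ →₀ ℕ) (h : MvPolynomial ℕ K) :
    pform q t (MvPolynomial.monomial α 1) h = wt q t α * MvPolynomial.coeff α h := by
  have : pform q t (MvPolynomial.basisMonomials ℕ K α) = wt q t α • MvPolynomial.lcoeff K α :=
    Module.Basis.constr_basis ..
  rw [MvPolynomial.coe_basisMonomials] at this
  rw [this]
  rfl

theorem pform_ext {f : MvPolynomial ℕ K →ₗ[K] K} {g : MvPolynomial ℕ K →ₗ[K] K}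
    (h : ∀ α, f (MvPolynomial.monomial α 1) = g (MvPolynomial.monomial α 1))
    (x : MvPolynomial ℕ K) : f x = g x := by
  refine LinearMap.congr_fun ((MvPolynomial.basisMonomials ℕ K).ext fun α => ?_) x
  simpa using h α

theorem pform_comm (q t : K) (f h : MvPolynomial ℕ K) : pform q t f h = pform q t h f := by
  classical
  refine pform_ext (f := (pform q t).flip h) (g := pform q t h) (fun α => ?_) f
  refine pform_ext (f := pform q t (MvPolynomial.monomial α 1))
    (g := (pform q t).flip (MvPolynomial.monomial α 1)) (fun β => ?_) h
  rw [LinearMap.flip_apply, pform_monomial, pform_monomial, MvPolynomial.coeff_monomial,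
    MvPolynomial.coeff_monomial]
  by_cases hab : α = β
  · rw [hab]
  · rw [if_neg (Ne.symm hab), if_neg hab, mul_zero, mul_zero]

/-- On monomials this is the recursion `wt_add_single`, whose factor `α r + 1` is the one produced
by differentiation. It includes `r = 0`: that variable represents no power sum and pairs to zero
with everything, since `kap q t 0 = 0`. -/
theorem pform_X_mul (q t : K) (r : ℕ) (f h : MvPolynomial ℕ K) :
    pform q t (MvPolynomial.X r * f) h = kap q t r * pform q t f (MvPolynomial.pderiv r h) := by
  refine pform_ext (f := (pform q t).flip h ∘ₗ LinearMap.mulLeft K (MvPolynomial.X r))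
    (g := kap q t r • (pform q t).flip (MvPolynomial.pderiv r h)) (fun α => ?_) f
  simp only [LinearMap.comp_apply, LinearMap.flip_apply, LinearMap.mulLeft_apply,
    LinearMap.smul_apply, smul_eq_mul]
  rw [mul_comm (MvPolynomial.X r), MvPolynomial.X, MvPolynomial.monomial_mul, one_mul,
    pform_monomial, pform_monomial, wt_add_single, MvPolynomial.coeff_pderiv]
  ring

theorem pform_X_mul' (q t : K) (r : ℕ) (f h : MvPolynomial ℕ K) :
    pform q t f (MvPolynomial.X r * h) = kap q t r * pform q t (MvPolynomial.pderiv r f) h := by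
  rw [pform_comm, pform_X_mul, pform_comm]

theorem pform_one (q t : K) (h : MvPolynomial ℕ K) :
    pform q t 1 h = MvPolynomial.constantCoeff h := by
  rw [← MvPolynomial.C_1, ← MvPolynomial.monomial_zero', pform_monomial]
  simp [wt, MvPolynomial.constantCoeff_eq]

variable [CharZero K]

/-- The functions `g_r`, the coefficients of `exp (∑ r, (1 - t ^ r) / (1 - q ^ r) p_r y ^ r / r)`. -/
noncomputable def gfun (q t : K) : ℕ → MvPolynomial ℕ K :=
  newton fun r => MvPolynomial.C ((1 - t ^ r) / (1 - q ^ r)) * MvPolynomial.X r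

/-- The coefficients of `exp (∑ r, (t ^ r - 1) p_r y ^ r / r)`. -/
noncomputable def Gfun (t : K) : ℕ → MvPolynomial ℕ K :=
  newton fun r => MvPolynomial.C (t ^ r - 1) * MvPolynomial.X r

/-- `gfun`, extended by zero to negative indices. -/
noncomputable def gz (q t : K) (N : ℤ) : MvPolynomial ℕ K := if 0 ≤ N then gfun q t N.toNat else 0

/-- `Gfun`, extended by zero to negative indices. -/
noncomputable def Gz (t : K) (N : ℤ) : MvPolynomial ℕ K := if 0 ≤ N then Gfun t N.toNat else 0

theorem gz_natCast (q t : K) (r : ℕ) : gz q t r = gfun q t r := by simp [gz]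

theorem Gz_natCast (t : K) (r : ℕ) : Gz t r = Gfun t r := by simp [Gz]

theorem gfun_zero (q t : K) : gfun q t 0 = 1 := newton_zero _

/-- The translation `p_r ↦ p_r - (1 - q ^ r) t ^ (-r) z ^ r`. -/
noncomputable def shift (q t : K) : MvPolynomial ℕ K →ₐ[K] Polynomial (MvPolynomial ℕ K) :=
  MvPolynomial.aeval fun r => Polynomial.C (MvPolynomial.X r) +
    Polynomial.C (MvPolynomial.C (-(1 - q ^ r) * (t⁻¹) ^ r)) * Polynomial.X ^ r

/-- Extraction of the coefficient of `z ^ j` in `F(z) ∑ m, Gfun m z ^ (-m)`. -/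
noncomputable def ctG (t : K) (j : ℕ) :
    Polynomial (MvPolynomial ℕ K) →ₗ[MvPolynomial ℕ K] MvPolynomial ℕ K :=
  Polynomial.lsum fun i => LinearMap.mulRight _ (Gz t ((i : ℤ) - j))

theorem ctG_monomial (t : K) (j i : ℕ) (a : MvPolynomial ℕ K) :
    ctG t j (Polynomial.monomial i a) = a * Gz t ((i : ℤ) - j) := by
  rw [ctG, Polynomial.lsum_apply, Polynomial.sum_monomial_index]
  · rfl
  · exact map_zero _

variable {q t : K}

/-- For the generating series, `g(y) G(y) = g(q y)`, because `(1 - t^r)/(1 - q^r) + (t^r - 1) = q^r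
(1 - t^r)/(1 - q^r)`. Any `T` beyond `N` will do, as `Gz` vanishes at negative indices. -/
theorem sum_gfun_mul_Gz (hq : ∀ r, r ≠ 0 → q ^ r ≠ 1) (N : ℤ) {T : ℕ} (hT : N < T) :
    ∑ a ∈ range T, gfun q t a * Gz t (N - a) = MvPolynomial.C (q ^ N.toNat) * gz q t N := by
  rcases lt_or_ge N 0 with hN | hN
  · rw [gz, if_neg (by omega), mul_zero]
    refine Finset.sum_eq_zero fun a _ => ?_
    rw [Gz, if_neg (by omega), mul_zero]
  obtain ⟨n, rfl⟩ := Int.eq_ofNat_of_zero_le hN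
  rw [Int.toNat_natCast, gz_natCast]
  have h1 : range (n + 1) ⊆ range T := Finset.range_subset_range.2 (by omega)
  rw [← Finset.sum_subset h1]
  · have h2 : ∀ a ∈ range (n + 1), gfun q t a * Gz t ((n : ℤ) - a) =
        gfun q t a * Gfun t (n - a) := by
      intro a ha
      have := Finset.mem_range.1 ha
      rw [← Gz_natCast, Nat.cast_sub (by omega)]
    rw [Finset.sum_congr rfl h2,
      ← Finset.Nat.sum_antidiagonal_eq_sum_range_succ (fun a b => gfun q t a * Gfun t b), gfun,
      Gfun, ← newton_add, map_pow, ← newton_scale]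
    refine newton_congr (fun r hr => ?_) n
    rw [← map_pow, ← mul_assoc, ← map_mul, ← add_mul, ← map_add]
    congr 2
    have : 1 - q ^ r ≠ 0 := sub_ne_zero.2 (hq r hr).symm
    field_simp
    ring
  · intro a _ ha
    have : n < a := by simpa using ha
    rw [Gz, if_neg (by omega), mul_zero]

omit [CharZero K] in
theorem shift_C (a : K) :
    shift q t (MvPolynomial.C a) = Polynomial.C (MvPolynomial.C a) := by
  rw [shift, MvPolynomial.aeval_C]
  rfl

omit [CharZero K] in
theorem shift_X (r : ℕ) : shift q t (MvPolynomial.X r) = Polynomial.C (MvPolynomial.X r) +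
    Polynomial.C (MvPolynomial.C (-(1 - q ^ r) * (t⁻¹) ^ r)) * Polynomial.X ^ r := by
  rw [shift, MvPolynomial.aeval_X]

/-- The translation multiplies `g(y)` by `exp (∑ (1 - t^(-r)) (z y)^r / r) = (1 - z y / t) / (1 - z
y)`, because the factors `1 - q^r` cancel. -/
theorem shift_gfun (hq : ∀ r, r ≠ 0 → q ^ r ≠ 1) (ht0 : t ≠ 0) (r : ℕ) :
    shift q t (gfun q t r) = Polynomial.C (gfun q t r) + ∑ i ∈ range r,
      Polynomial.monomial (i + 1) (MvPolynomial.C (1 - t⁻¹) * gfun q t (r - (i + 1))) := by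
  have h1 : shift q t (gfun q t r) = newton (fun s =>
      Polynomial.X ^ s * (1 - Polynomial.C (MvPolynomial.C t⁻¹) ^ s) +
      Polynomial.C (MvPolynomial.C ((1 - t ^ s) / (1 - q ^ s)) * MvPolynomial.X s)) r := by
    rw [gfun, ← AlgHom.coe_toRingHom, map_newton]
    refine newton_congr (fun s hs => ?_) r
    have hq' : 1 - q ^ s ≠ 0 := sub_ne_zero.2 (hq s hs).symm
    rw [AlgHom.coe_toRingHom, map_mul, shift_C, shift_X, Polynomial.C_mul]
    have h : (1 - t ^ s) / (1 - q ^ s) * (-(1 - q ^ s) * (t⁻¹) ^ s) = 1 - (t⁻¹) ^ s := by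
      rw [inv_pow]
      field_simp
      ring
    have h' := congrArg (fun a => (Polynomial.C (MvPolynomial.C a : MvPolynomial ℕ K))) h
    simp only [map_mul, map_sub, map_one, map_pow] at h' ⊢
    linear_combination Polynomial.X ^ s * h'
  have h2 : ∀ s, newton (fun s => Polynomial.C (MvPolynomial.C ((1 - t ^ s) / (1 - q ^ s)) *
      MvPolynomial.X s)) s = Polynomial.C (gfun q t s) := fun s => (map_newton Polynomial.C _ s).symm
  rw [h1, newton_add, Finset.Nat.sum_antidiagonal_eq_sum_range_succ_mk, Finset.sum_range_succ']
  simp only [newton_scale, h2, newton_one_sub_pow, newton_zero, one_mul, Nat.sub_zero]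
  rw [add_comm]
  congr 1
  refine Finset.sum_congr rfl fun i _ => ?_
  rw [← Polynomial.C_mul_X_pow_eq_monomial, map_mul, map_sub, map_one, map_sub, map_one]
  ring

/-- Expanding the shifted `g_r` leaves the terms `a < r` of the convolution `∑ g_a G_(N - a)`, with
`N = r + m - j`. The whole convolution is `q^N g_N`, so these terms equal that minus the term `a =
r` and the tail `a > r`. The term `a = r` combines with the unshifted `g_r` to the coefficient `1 -
(1 - t⁻¹) = t⁻¹`. The condition `m ≤ M` makes the tail complete. -/
theorem ctG_shift_gfun_mul_monomial (hq : ∀ r, r ≠ 0 → q ^ r ≠ 1) (ht0 : t ≠ 0) (j r m M : ℕ)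
    (hM : m ≤ M) (a : MvPolynomial ℕ K) :
    ctG t j (shift q t (gfun q t r) * Polynomial.monomial m a) =
      MvPolynomial.C t⁻¹ * (gfun q t r * (a * Gz t ((m : ℤ) - j))) +
      MvPolynomial.C (1 - t⁻¹) * (MvPolynomial.C (q ^ ((r : ℤ) + m - j).toNat) *
        (gz q t ((r : ℤ) + m - j) * a) -
        ∑ i ∈ range M, gz q t ((r : ℤ) + (i + 1)) * (a * Gz t ((m : ℤ) - (j + (i + 1) : ℕ)))) := by
  have h := sum_gfun_mul_Gz (q := q) (t := t) hq ((r : ℤ) + m - j) (T := r + 1 + M)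
    (by push_cast; omega)
  rw [Finset.sum_range_add, Finset.sum_range_succ, ← Finset.sum_range_reflect] at h
  rw [← mul_assoc (MvPolynomial.C _) (gz q t _) a, ← h, shift_gfun hq ht0, add_mul, map_add,
    Polynomial.C_mul_monomial, ctG_monomial, Finset.sum_mul, map_sum]
  have h1 : ∀ i ∈ range r, ctG t j (Polynomial.monomial (i + 1) (MvPolynomial.C (1 - t⁻¹) *
      gfun q t (r - (i + 1))) * Polynomial.monomial m a) = MvPolynomial.C (1 - t⁻¹) *
      (gfun q t (r - 1 - i) * Gz t ((r : ℤ) + m - j - ((r - 1 - i : ℕ) : ℤ)) * a) := by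
    intro i hi
    have := Finset.mem_range.1 hi
    rw [Polynomial.monomial_mul_monomial, ctG_monomial, show r - (i + 1) = r - 1 - i by omega,
      show ((i + 1 + m : ℕ) : ℤ) - j = (r : ℤ) + m - j - ((r - 1 - i : ℕ) : ℤ) by omega]
    ring
  have h2 : ∀ i ∈ range M, gz q t ((r : ℤ) + (i + 1)) *
      (a * Gz t ((m : ℤ) - (j + (i + 1) : ℕ))) =
      gfun q t (r + 1 + i) * Gz t ((r : ℤ) + m - j - ((r + 1 + i : ℕ) : ℤ)) * a := by
    intro i _
    rw [← gz_natCast, show ((r + 1 + i : ℕ) : ℤ) = (r : ℤ) + (i + 1) by push_cast; ring,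
      show (r : ℤ) + m - j - ((r : ℤ) + (i + 1)) = (m : ℤ) - (j + (i + 1) : ℕ) by push_cast; ring]
    ring
  rw [Finset.sum_congr rfl h1, Finset.sum_congr rfl h2, ← Finset.mul_sum, ← Finset.sum_mul,
    ← Finset.sum_mul, show (r : ℤ) + m - j - (r : ℤ) = (m : ℤ) - j by ring, map_sub, map_one]
  ring

/-- This recurrence peels one factor `g_r` off a product and drives the triangularity proof. For `j
= 0` no term carries an index below `r` in front. -/
theorem ctG_shift_gfun_mul (hq : ∀ r, r ≠ 0 → q ^ r ≠ 1) (ht0 : t ≠ 0) (j r : ℕ)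
    (F : Polynomial (MvPolynomial ℕ K)) :
    ctG t j (shift q t (gfun q t r) * F) =
      MvPolynomial.C t⁻¹ * (gfun q t r * ctG t j F) +
      MvPolynomial.C (1 - t⁻¹) * (∑ m ∈ range (F.natDegree + 1),
        MvPolynomial.C (q ^ ((r : ℤ) + m - j).toNat) *
        (gz q t ((r : ℤ) + m - j) * F.coeff m) -
        ∑ i ∈ range (F.natDegree + 1), gz q t ((r : ℤ) + (i + 1)) * ctG t (j + (i + 1)) F) := by
  have hF : ∀ k, ctG t k F = ∑ m ∈ range (F.natDegree + 1), F.coeff m * Gz t ((m : ℤ) - k) := by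
    intro k
    conv_lhs => rw [F.as_sum_range, map_sum]
    simp only [ctG_monomial]
  conv_lhs => rw [F.as_sum_range, Finset.mul_sum, map_sum]
  rw [Finset.sum_congr rfl fun m hm => ctG_shift_gfun_mul_monomial hq ht0 j r m (F.natDegree + 1)
    (by have := Finset.mem_range.1 hm; omega) (F.coeff m)]
  simp only [hF, Finset.sum_add_distrib, ← Finset.mul_sum, Finset.sum_sub_distrib]
  rw [Finset.sum_comm (s := range (F.natDegree + 1))]
  simp only [Finset.mul_sum]

/-! Adjointness of translations and multiplications. -/

omit [CharZero K] in
theorem coeff_shift_mul_X (f : MvPolynomial ℕ K) (r m : ℕ) :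
    (shift q t (f * MvPolynomial.X r)).coeff m = (shift q t f).coeff m * MvPolynomial.X r +
      if r ≤ m then MvPolynomial.C (-(1 - q ^ r) * (t⁻¹) ^ r) * (shift q t f).coeff (m - r)
      else 0 := by
  rw [map_mul, shift_X, mul_add, Polynomial.coeff_add, Polynomial.coeff_mul_C, ← mul_assoc,
    Polynomial.coeff_mul_X_pow']
  congr 1
  split_ifs
  · rw [Polynomial.coeff_mul_C, mul_comm]
  · rfl

omit [CharZero K] in
theorem coeff_shift_C (a : K) (m : ℕ) :
    (shift q t (MvPolynomial.C a)).coeff m = if m = 0 then MvPolynomial.C a else 0 := by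
  rw [shift_C, Polynomial.coeff_C]

omit [CharZero K] in
-- A translation by constants commutes with partial derivatives.
theorem pderiv_coeff_shift (f : MvPolynomial ℕ K) (r m : ℕ) :
    MvPolynomial.pderiv r ((shift q t f).coeff m) =
      (shift q t (MvPolynomial.pderiv r f)).coeff m := by
  classical
  induction f using MvPolynomial.induction_on generalizing m with
  | C a =>
    rw [coeff_shift_C, MvPolynomial.pderiv_C, map_zero, Polynomial.coeff_zero]
    split_ifs <;> simp
  | add f g hf hg => simp only [map_add, Polynomial.coeff_add, hf, hg]
  | mul_X f s ih =>
    rw [coeff_shift_mul_X, map_add, Derivation.leibniz, Derivation.leibniz, map_add,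
      Polynomial.coeff_add, smul_eq_mul, smul_eq_mul, smul_eq_mul, smul_eq_mul,
      mul_comm (MvPolynomial.X s) (MvPolynomial.pderiv r f), coeff_shift_mul_X, ih,
      mul_comm (MvPolynomial.X s), MvPolynomial.pderiv_X]
    have h : (shift q t (f * Pi.single (M := fun _ => MvPolynomial ℕ K) r 1 s)).coeff m =
        (shift q t f).coeff m * Pi.single (M := fun _ => MvPolynomial ℕ K) r 1 s := by
      by_cases hrs : s = r
      · subst hrs; simp
      · simp [Pi.single_eq_of_ne hrs]
    rw [h, add_assoc]
    congr 2
    split_ifs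
    · rw [Derivation.leibniz, MvPolynomial.pderiv_C, smul_zero, add_zero, ih, smul_eq_mul]
    · exact map_zero _

omit [CharZero K] in
theorem pderiv_C_mul_X (b : ℕ → K) (r s : ℕ) :
    MvPolynomial.pderiv r (MvPolynomial.C (b s) * MvPolynomial.X s) =
      if s = r then MvPolynomial.C (b r) else 0 := by
  classical
  rw [MvPolynomial.pderiv_C_mul, MvPolynomial.pderiv_X]
  by_cases h : s = r
  · subst h; simp
  · simp [h]

theorem constantCoeff_newton (b : ℕ → K) (m : ℕ) :
    MvPolynomial.constantCoeff (newton (fun r => MvPolynomial.C (b r) * MvPolynomial.X r) m) =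
      if m = 0 then 1 else 0 := by
  rw [map_newton]
  simp only [map_mul, MvPolynomial.constantCoeff_X, mul_zero]
  exact newton_const_zero m

/-- The case `h = 1` of the adjointness `pform_coeff_shift`, since the constant coefficient is the
pairing with `1`. -/
theorem constantCoeff_coeff_shift (ht : ∀ r, r ≠ 0 → t ^ r ≠ 1) (f : MvPolynomial ℕ K) (m : ℕ) :
    MvPolynomial.constantCoeff ((shift q t f).coeff m) =
      (t⁻¹) ^ m * pform q t f (Gfun t m) := by
  induction f using MvPolynomial.induction_on generalizing m with
  | C a =>
    rw [coeff_shift_C, ← mul_one (MvPolynomial.C a), ← MvPolynomial.smul_eq_C_mul, map_smul,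
      LinearMap.smul_apply, pform_one, Gfun, constantCoeff_newton]
    split_ifs with h
    · simp [h]
    · simp
  | add f g hf hg => simp only [map_add, Polynomial.coeff_add, hf, hg, LinearMap.add_apply, mul_add]
  | mul_X f r ih =>
    rw [coeff_shift_mul_X, map_add, map_mul, MvPolynomial.constantCoeff_X, mul_zero, zero_add,
      mul_comm f, pform_X_mul]
    -- The variable of index `0` is not moved by the translation and is killed by the form, so both
    -- sides are zero.
    rcases eq_or_ne r 0 with rfl | hr
    · simp [kap]
    have hd := derivation_newton (MvPolynomial.pderiv (R := K) r)
      (a := fun r => MvPolynomial.C (t ^ r - 1) * MvPolynomial.X r) hr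
      (fun s _ => pderiv_C_mul_X (fun r => t ^ r - 1) r s) m
    have h1 : (r : K) * pform q t f (MvPolynomial.pderiv r (Gfun t m)) =
        if r ≤ m then (t ^ r - 1) * pform q t f (Gfun t (m - r)) else 0 := by
      have := congrArg (pform q t f) hd
      rw [← nsmul_eq_mul, map_nsmul, nsmul_eq_mul] at this
      rw [Gfun, this]
      split_ifs
      · rw [← MvPolynomial.smul_eq_C_mul, map_smul, smul_eq_mul]
      · exact map_zero _
    have h2 : (1 - t ^ r) ≠ 0 := sub_ne_zero.2 (ht r hr).symm
    -- `κ_r ∂_r` sends `G_m` to `-(1 - q^r) G_(m - r)`, which is, up to `t^(-r)`, the amount by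
    -- which `p_r` is translated.
    have h3 : kap q t r * pform q t f (MvPolynomial.pderiv r (Gfun t m)) =
        if r ≤ m then -(1 - q ^ r) * pform q t f (Gfun t (m - r)) else 0 := by
      rw [kap, mul_right_comm, h1]
      split_ifs
      · field_simp
        ring
      · exact zero_mul _
    rw [h3]
    split_ifs with hrm
    · rw [map_mul, MvPolynomial.constantCoeff_C, ih]
      obtain ⟨k, rfl⟩ := Nat.exists_eq_add_of_le' hrm
      rw [Nat.add_sub_cancel]
      ring
    · simp

/-- Formally, translating `p_r` by `b_r` is `exp (∑ b_r ∂_r)`, whose adjoint is multiplication by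
`exp (∑ b_r p_r / κ_r)`. For `b_r = -(1 - q^r) t^(-r) z^r` the quotient `b_r / κ_r` is `(t^r - 1)
(z/t)^r / r`, which gives the series of `Gfun` in `z/t`. The induction on `h` moves one `p_r` at a
time and avoids dividing by `κ_r`. -/
theorem pform_coeff_shift (ht : ∀ r, r ≠ 0 → t ^ r ≠ 1) (f h : MvPolynomial ℕ K) (m : ℕ) :
    pform q t ((shift q t f).coeff m) h = (t⁻¹) ^ m * pform q t f (Gfun t m * h) := by
  induction h using MvPolynomial.induction_on generalizing f with
  | C a =>
    rw [← mul_one (MvPolynomial.C a), ← MvPolynomial.smul_eq_C_mul, map_smul, pform_comm,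
      pform_one, mul_smul_comm, map_smul, mul_one, constantCoeff_coeff_shift ht]
    simp only [smul_eq_mul]
    ring
  | add h k hh hk => rw [map_add, hh, hk, mul_add, map_add, mul_add]
  | mul_X h r ih =>
    rw [mul_comm h, pform_X_mul', pderiv_coeff_shift, ih, mul_left_comm (Gfun t m), pform_X_mul']
    ring

/-- The Macdonald operator on the polynomial ring in the power sums. -/
noncomputable def macOp (q t : K) : MvPolynomial ℕ K →ₗ[K] MvPolynomial ℕ K :=
  (ctG t 0).restrictScalars K ∘ₗ (shift q t).toLinearMap

theorem macOp_apply (f : MvPolynomial ℕ K) : macOp q t f = ctG t 0 (shift q t f) := rfl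

theorem macOp_eq_sum (f : MvPolynomial ℕ K) {M : ℕ} (hM : (shift q t f).natDegree < M) :
    macOp q t f = ∑ m ∈ range M, Gfun t m * (shift q t f).coeff m := by
  rw [macOp_apply]
  conv_lhs => rw [(shift q t f).as_sum_range' M hM, map_sum]
  refine Finset.sum_congr rfl fun m _ => ?_
  rw [ctG_monomial, Nat.cast_zero, sub_zero, Gz_natCast, mul_comm]

/-- With `S_m` the coefficient of `z^m` in the translation, the operator is `∑ G_m S_m`, and `S_m`
has adjoint `t^(-m) G_m`. Hence the pairing is `∑ t^m ⟨S_m f, S_m h⟩`, which is symmetric in `f` and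
`h`. -/
theorem macOp_selfAdjoint (ht : ∀ r, r ≠ 0 → t ^ r ≠ 1) (ht0 : t ≠ 0) (f h : MvPolynomial ℕ K) :
    pform q t (macOp q t f) h = pform q t f (macOp q t h) := by
  obtain ⟨M, hM⟩ := exists_gt (max (shift q t f).natDegree (shift q t h).natDegree)
  have key : ∀ f h : MvPolynomial ℕ K, (shift q t f).natDegree < M → pform q t (macOp q t f) h =
      ∑ m ∈ range M, t ^ m * pform q t ((shift q t f).coeff m) ((shift q t h).coeff m) := by
    intro f h hf
    rw [macOp_eq_sum f hf, map_sum, LinearMap.sum_apply]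
    refine Finset.sum_congr rfl fun m _ => ?_
    have h1 := pform_coeff_shift (q := q) ht h ((shift q t f).coeff m) m
    rw [pform_comm _ _ (Gfun t m * _), pform_comm _ _ _ ((shift q t h).coeff m), h1, ← mul_assoc,
      ← mul_pow, mul_inv_cancel₀ ht0, one_pow, one_mul]
  rw [key f h (lt_of_le_of_lt (le_max_left _ _) hM), pform_comm,
    key h f (lt_of_le_of_lt (le_max_right _ _) hM)]
  refine Finset.sum_congr rfl fun m _ => ?_
  rw [pform_comm]

end Vertex

/-! ### Triangularity of the Macdonald operator -/

section Triangular

/-- The partial sums of `μ` exceed those of `l`, up to `j`, and the total sum drops by `j`. -/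
def PrefixLE (j : ℕ) (l : List ℕ) (μ : List ℤ) : Prop :=
  μ.length = l.length ∧ μ.sum + j = l.sum ∧
    ∀ k, ((l.take k).sum : ℤ) ≤ (μ.take k).sum + j

theorem PrefixLE.cons {j j' r : ℕ} {r' : ℤ} {l : List ℕ} {μ : List ℤ} (h : PrefixLE j' l μ)
    (hr : r + j' = r' + j) : PrefixLE j (r :: l) (r' :: μ) := by
  refine ⟨by simp [h.1], ?_, fun k => ?_⟩
  · have := h.2.1
    simp only [List.sum_cons, Nat.cast_add]
    omega
  · cases k with
    | zero => simp
    | succ k =>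
      have := h.2.2 k
      simp only [List.take_succ_cons, List.sum_cons, Nat.cast_add]
      omega

variable {K : Type*} [Field K] [CharZero K]

/-- The span of the products `∏ g_{μ_i}` with `PrefixLE j l μ`. -/
noncomputable def domSpan (q t : K) (j : ℕ) (l : List ℕ) : Submodule K (MvPolynomial ℕ K) :=
  Submodule.span K {f | ∃ μ : List ℤ, PrefixLE j l μ ∧ (μ.map (gz q t)).prod = f}

/-- The span of the products `∏ g_{μ_i}` with `PrefixLE 0 l μ` and `μ ≠ l`. -/
noncomputable def strictDomSpan (q t : K) (l : List ℕ) : Submodule K (MvPolynomial ℕ K) :=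
  Submodule.span K
    {f | ∃ μ : List ℤ, PrefixLE 0 l μ ∧ μ ≠ l.map (↑) ∧ (μ.map (gz q t)).prod = f}

variable {q t : K}

theorem gz_mul_mem_domSpan {j j' r : ℕ} {r' : ℤ} {l : List ℕ} {f : MvPolynomial ℕ K}
    (hf : f ∈ domSpan q t j' l) (hr : r + j' = r' + j) :
    gz q t r' * f ∈ domSpan q t j (r :: l) := by
  have : domSpan q t j' l ≤
      (domSpan q t j (r :: l)).comap (LinearMap.mulLeft K (gz q t r')) := by
    refine Submodule.span_le.2 ?_
    rintro _ ⟨μ, hμ, rfl⟩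
    exact Submodule.subset_span ⟨r' :: μ, hμ.cons hr, by simp⟩
  exact this hf

theorem gz_mul_mem_strictDomSpan {j' r : ℕ} {r' : ℤ} {l : List ℕ} {f : MvPolynomial ℕ K}
    (hf : f ∈ domSpan q t j' l) (hr : r + j' = r') (hne : r' ≠ r) :
    gz q t r' * f ∈ strictDomSpan q t (r :: l) := by
  have : domSpan q t j' l ≤
      (strictDomSpan q t (r :: l)).comap (LinearMap.mulLeft K (gz q t r')) := by
    refine Submodule.span_le.2 ?_
    rintro _ ⟨μ, hμ, rfl⟩
    refine Submodule.subset_span ⟨r' :: μ, hμ.cons (by simpa using hr), ?_, by simp⟩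
    simp [hne]
  exact this hf

theorem gfun_mul_mem_strictDomSpan {r : ℕ} {l : List ℕ} {f : MvPolynomial ℕ K}
    (hf : f ∈ strictDomSpan q t l) : gfun q t r * f ∈ strictDomSpan q t (r :: l) := by
  have : strictDomSpan q t l ≤
      (strictDomSpan q t (r :: l)).comap (LinearMap.mulLeft K (gfun q t r)) := by
    refine Submodule.span_le.2 ?_
    rintro _ ⟨μ, hμ, hne, rfl⟩
    refine Submodule.subset_span ⟨r :: μ, hμ.cons rfl, ?_, by simp [gz_natCast]⟩
    simpa using hne
  exact this hf

omit [CharZero K] in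
theorem C_mul_mem {S : Submodule K (MvPolynomial ℕ K)} (a : K) {f : MvPolynomial ℕ K} (hf : f ∈ S) :
    MvPolynomial.C a * f ∈ S := by
  rw [← MvPolynomial.smul_eq_C_mul]
  exact S.smul_mem a hf

theorem one_mem_domSpan_nil : (1 : MvPolynomial ℕ K) ∈ domSpan q t 0 [] :=
  Submodule.subset_span ⟨[], ⟨rfl, by simp, by simp⟩, by simp⟩

theorem coeff_shift_mem_domSpan (hq : ∀ r, r ≠ 0 → q ^ r ≠ 1) (ht0 : t ≠ 0) (l : List ℕ) (i : ℕ) :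
    (shift q t (l.map (gfun q t)).prod).coeff i ∈ domSpan q t i l := by
  induction l generalizing i with
  | nil =>
    rw [List.map_nil, List.prod_nil, map_one, Polynomial.coeff_one]
    split_ifs with h
    · rw [h]
      exact one_mem_domSpan_nil
    · exact Submodule.zero_mem _
  | cons r l ih =>
    rw [List.map_cons, List.prod_cons, map_mul, shift_gfun hq ht0, add_mul, Polynomial.coeff_add,
      Polynomial.coeff_C_mul, Finset.sum_mul, Polynomial.finsetSum_coeff]
    refine Submodule.add_mem _ ?_ (Submodule.sum_mem _ fun k hk => ?_)
    · rw [← gz_natCast]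
      exact gz_mul_mem_domSpan (ih i) rfl
    · have hk := Finset.mem_range.1 hk
      rw [← Polynomial.C_mul_X_pow_eq_monomial, mul_assoc, Polynomial.coeff_C_mul,
        Polynomial.coeff_X_pow_mul']
      split_ifs with hki
      · rw [mul_assoc, ← gz_natCast]
        exact C_mul_mem _ (gz_mul_mem_domSpan (ih (i - (k + 1))) (by omega))
      · rw [mul_zero]
        exact Submodule.zero_mem _

/-- In every term of `ctG_shift_gfun_mul` the change of the first index balances the change of the
deficit: first indices `r`, `r + m - j`, `r + i + 1` go with tails of deficit `j`, `m`, `j + i + 1`.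
-/
theorem ctG_shift_mem_domSpan (hq : ∀ r, r ≠ 0 → q ^ r ≠ 1) (ht0 : t ≠ 0) (l : List ℕ) (j : ℕ) :
    ctG t j (shift q t (l.map (gfun q t)).prod) ∈ domSpan q t j l := by
  induction l generalizing j with
  | nil =>
    rw [List.map_nil, List.prod_nil, map_one, ← Polynomial.monomial_zero_one, ctG_monomial, one_mul,
      Gz]
    split_ifs with h
    · obtain rfl : j = 0 := by omega
      simpa [Gfun, newton_zero] using one_mem_domSpan_nil
    · exact Submodule.zero_mem _
  | cons r l ih =>
    rw [List.map_cons, List.prod_cons, map_mul, ctG_shift_gfun_mul hq ht0]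
    refine Submodule.add_mem _ (C_mul_mem _ ?_) (C_mul_mem _ (Submodule.sub_mem _
      (Submodule.sum_mem _ fun m _ => C_mul_mem _ ?_) (Submodule.sum_mem _ fun i _ => ?_)))
    · rw [← gz_natCast]
      exact gz_mul_mem_domSpan (ih j) rfl
    · exact gz_mul_mem_domSpan (coeff_shift_mem_domSpan hq ht0 l m) (by omega)
    · exact gz_mul_mem_domSpan (ih (j + (i + 1))) (by push_cast; omega)

/-- The eigenvalue of the Macdonald operator attached to a list of parts. -/
noncomputable def eigval (q t : K) : List ℕ → K
  | [] => 1
  | r :: l => t⁻¹ * eigval q t l + (1 - t⁻¹) * q ^ r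

/-- Take `j = 0` in the recurrence. The term `t⁻¹ g_r E f` is handled by induction, and the term `m
= 0` contributes `(1 - t⁻¹) q^r g_r f`; this is the recursion defining `eigval`. Every other term
begins with an index larger than `r`, hence is strictly higher. -/
theorem macOp_sub_mem_strictDomSpan (hq : ∀ r, r ≠ 0 → q ^ r ≠ 1) (ht0 : t ≠ 0) (l : List ℕ) :
    macOp q t (l.map (gfun q t)).prod - MvPolynomial.C (eigval q t l) * (l.map (gfun q t)).prod ∈
      strictDomSpan q t l := by
  rw [macOp_apply]
  induction l with
  | nil =>
    rw [List.map_nil, List.prod_nil, map_one, ← Polynomial.monomial_zero_one, ctG_monomial, one_mul,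
      Gz]
    simp [Gfun, newton_zero, eigval]
  | cons r l ih =>
    rw [List.map_cons, List.prod_cons, map_mul, ctG_shift_gfun_mul hq ht0, Finset.sum_range_succ',
      eigval]
    -- At `z = 0` the translation is the identity on products of the `g_r`.
    have h0 : (shift q t (l.map (gfun q t)).prod).coeff 0 = (l.map (gfun q t)).prod := by
      clear ih
      induction l with
      | nil => simp
      | cons r l ih =>
        rw [List.map_cons, List.prod_cons, map_mul, Polynomial.mul_coeff_zero, ih, shift_gfun hq ht0]
        simp [Polynomial.coeff_monomial, Polynomial.finsetSum_coeff]
    set F := shift q t (l.map (gfun q t)).prod with hF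
    have e : ((r : ℤ) + (0 : ℕ) - (0 : ℕ)) = r := by simp
    rw [h0, e, Int.toNat_natCast, gz_natCast]
    set f := (l.map (gfun q t)).prod
    have key : ∀ A B : MvPolynomial ℕ K,
        MvPolynomial.C t⁻¹ * (gfun q t r * ctG t 0 F) + MvPolynomial.C (1 - t⁻¹) *
          (A + MvPolynomial.C (q ^ r) * (gfun q t r * f) - B) -
          MvPolynomial.C (t⁻¹ * eigval q t l + (1 - t⁻¹) * q ^ r) * (gfun q t r * f) =
        MvPolynomial.C t⁻¹ * (gfun q t r * (ctG t 0 F - MvPolynomial.C (eigval q t l) * f)) +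
          MvPolynomial.C (1 - t⁻¹) * (A - B) := by
      intro A B
      simp only [map_add, map_mul]
      ring
    rw [key]
    refine Submodule.add_mem _ (C_mul_mem _ (gfun_mul_mem_strictDomSpan ih))
      (C_mul_mem _ (Submodule.sub_mem _ (Submodule.sum_mem _ fun m _ => C_mul_mem _ ?_)
        (Submodule.sum_mem _ fun i _ => ?_)))
    · exact gz_mul_mem_strictDomSpan (coeff_shift_mem_domSpan hq ht0 l (m + 1))
        (by push_cast; omega) (by push_cast; omega)
    · exact gz_mul_mem_strictDomSpan (ctG_shift_mem_domSpan hq ht0 l (0 + (i + 1)))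
        (by push_cast; omega) (by omega)

/-- Subtracting `1` from each power of `q` makes the padding zeros contribute nothing, so lists of
different lengths can be compared with one `N`. -/
theorem eigval_eq (l : List ℕ) {N : ℕ} (hN : l.length ≤ N) :
    eigval q t l = 1 + (1 - t⁻¹) * ∑ i ∈ range N, (q ^ l.getD i 0 - 1) * (t⁻¹) ^ i := by
  induction l generalizing N with
  | nil => simp [eigval]
  | cons r l ih =>
    cases N with
    | zero => simp at hN
    | succ N =>
      rw [eigval, Finset.sum_range_succ', ih (N := N) (by simpa using hN)]
      simp only [List.getD_cons_succ, List.getD_cons_zero, pow_succ, pow_zero, ← mul_assoc,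
        ← Finset.sum_mul]
      ring

end Triangular

/-! ### Distinctness of the eigenvalues -/

theorem eq_of_getD_eq {l l' : List ℕ} (hl : ∀ a ∈ l, 0 < a) (hl' : ∀ a ∈ l', 0 < a)
    (h : ∀ i, l.getD i 0 = l'.getD i 0) : l = l' := by
  have key : ∀ l : List ℕ, (∀ a ∈ l, 0 < a) → ∀ i, i < l.length ↔ l.getD i 0 ≠ 0 := by
    intro l hl i
    constructor
    · intro hi
      rw [List.getD_eq_getElem _ _ hi]
      exact (hl _ (List.getElem_mem hi)).ne'
    · intro hi
      by_contra hn
      exact hi (List.getD_eq_default _ _ (by omega))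
  have hlen : l.length = l'.length := by
    have h1 : ∀ i, i < l.length ↔ i < l'.length := fun i => by rw [key l hl, key l' hl', h]
    have a := h1 l.length
    have b := h1 l'.length
    omega
  refine List.ext_getElem hlen fun i hi hi' => ?_
  rw [← List.getD_eq_getElem _ 0 hi, ← List.getD_eq_getElem _ 0 hi', h]

theorem qvar_pow_ne_one {r : ℕ} (hr : r ≠ 0) : qvar ^ r ≠ 1 := by
  rw [qvar, ← map_pow, ← map_one (algebraMap (MvPolynomial (Fin 2) ℚ) QT)]
  intro h
  have h2 := congrArg (MvPolynomial.aeval (R := ℚ) (S₁ := ℚ) fun _ => 0)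
    (IsFractionRing.injective (MvPolynomial (Fin 2) ℚ) QT h)
  simp [hr] at h2

theorem tvar_pow_ne_one {r : ℕ} (hr : r ≠ 0) : tvar ^ r ≠ 1 := by
  rw [tvar, ← map_pow, ← map_one (algebraMap (MvPolynomial (Fin 2) ℚ) QT)]
  intro h
  have h2 := congrArg (MvPolynomial.aeval (R := ℚ) (S₁ := ℚ) fun _ => 0)
    (IsFractionRing.injective (MvPolynomial (Fin 2) ℚ) QT h)
  simp [hr] at h2

theorem tvar_ne_zero : tvar ≠ 0 := by
  rw [tvar, ← map_zero (algebraMap (MvPolynomial (Fin 2) ℚ) QT)]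
  intro h
  exact MvPolynomial.X_ne_zero _ (IsFractionRing.injective (MvPolynomial (Fin 2) ℚ) QT h)

theorem eigval_injective {l l' : List ℕ} (hl : ∀ a ∈ l, 0 < a) (hl' : ∀ a ∈ l', 0 < a)
    (h : eigval qvar tvar l = eigval qvar tvar l') : l = l' := by
  have key : ∀ N, l.length ≤ N → l'.length ≤ N → ∀ j < N, l.getD j 0 = l'.getD j 0 := by
    intro N h1 h2 j hj
    rw [eigval_eq l h1, eigval_eq l' h2, add_right_inj] at h
    have hu : 1 - tvar⁻¹ ≠ 0 := by
      rw [sub_ne_zero]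
      intro h
      exact tvar_pow_ne_one one_ne_zero (by rw [pow_one, ← inv_inv tvar, ← h, inv_one])
    have h3 := mul_left_cancel₀ hu h
    simp only [sub_mul, one_mul, Finset.sum_sub_distrib, sub_left_inj] at h3
    -- Multiplication by `t^N` clears the negative powers of `t`. The exponent `N - i` of `t` then
    -- identifies the position `i`, and the exponent of `q` is the part found there.
    let Q : List ℕ → MvPolynomial (Fin 2) ℚ := fun l => ∑ i ∈ range N,
      MvPolynomial.monomial (Finsupp.single 0 (l.getD i 0) + Finsupp.single 1 (N - i)) 1
    have h4 : ∀ l : List ℕ, algebraMap (MvPolynomial (Fin 2) ℚ) QT (Q l) =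
        tvar ^ N * ∑ i ∈ range N, qvar ^ l.getD i 0 * tvar⁻¹ ^ i := by
      intro l
      rw [map_sum, Finset.mul_sum]
      refine Finset.sum_congr rfl fun i hi => ?_
      have hi := Finset.mem_range.1 hi
      have e : tvar ^ N = tvar ^ (N - i) * tvar ^ i := by rw [← pow_add]; congr 1; omega
      have e2 : tvar ^ i * tvar⁻¹ ^ i = 1 := by
        rw [← mul_pow, mul_inv_cancel₀ tvar_ne_zero, one_pow]
      rw [← one_mul (1 : ℚ), ← MvPolynomial.monomial_mul, map_mul, ← MvPolynomial.X_pow_eq_monomial,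
        ← MvPolynomial.X_pow_eq_monomial, map_pow, map_pow, e]
      change qvar ^ _ * tvar ^ _ = _
      linear_combination (- qvar ^ l.getD i 0 * tvar ^ (N - i)) * e2
    have h5 : Q l = Q l' := by
      refine IsFractionRing.injective (MvPolynomial (Fin 2) ℚ) QT ?_
      rw [h4, h4, h3]
    have h6 := congrArg (MvPolynomial.coeff
      (Finsupp.single 0 (l.getD j 0) + Finsupp.single 1 (N - j))) h5
    have h7 : ∀ l'' : List ℕ, MvPolynomial.coeff
        (Finsupp.single 0 (l.getD j 0) + Finsupp.single 1 (N - j)) (Q l'') =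
        if l''.getD j 0 = l.getD j 0 then 1 else 0 := by
      intro l''
      rw [MvPolynomial.coeff_sum, Finset.sum_eq_single j]
      · rw [MvPolynomial.coeff_monomial]
        refine if_congr ⟨fun h => ?_, fun h => by rw [h]⟩ rfl rfl
        simpa using DFunLike.congr_fun h 0
      · intro i hi hij
        have hi := Finset.mem_range.1 hi
        rw [MvPolynomial.coeff_monomial, if_neg]
        intro h
        have : N - i = N - j := by simpa using DFunLike.congr_fun h 1
        omega
      · intro h
        exact absurd (Finset.mem_range.2 hj) h
    rw [h7, h7, if_pos rfl] at h6
    by_contra hne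
    rw [if_neg (Ne.symm hne)] at h6
    exact one_ne_zero h6
  exact eq_of_getD_eq hl hl' fun i => key (l.length + l'.length + i + 1) (by omega) (by omega) i
    (by omega)

/-! ### Duality of the functions `g` and the monomials -/

section Duality

variable {K : Type*} [Field K] [CharZero K] {q t : K}

/-- The product of the `g_{α_i}`. -/
noncomputable def gvec (q t : K) (α : ℕ →₀ ℕ) : MvPolynomial ℕ K := α.prod fun _ a => gfun q t a

theorem gvec_eq_prod (α : ℕ →₀ ℕ) {S : Finset ℕ} (hS : α.support ⊆ S) :
    gvec q t α = ∏ i ∈ S, gfun q t (α i) :=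
  Finsupp.prod_of_support_subset _ hS _ fun _ _ => gfun_zero q t

theorem gvec_eq_exponents (α : ℕ →₀ ℕ) :
    gvec q t α = ((exponents α).map (gfun q t)).prod := by
  rw [exponents, Multiset.map_map]
  rfl

/-- The coefficients in `g` are chosen to cancel `κ_r`, so the adjoint of `p_r` just lowers the
index by `r`. -/
theorem kap_mul_pderiv_gfun (hq : ∀ r, r ≠ 0 → q ^ r ≠ 1) (ht : ∀ r, r ≠ 0 → t ^ r ≠ 1) {r : ℕ}
    (hr : r ≠ 0) (m : ℕ) : MvPolynomial.C (kap q t r) * MvPolynomial.pderiv r (gfun q t m) =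
      if r ≤ m then gfun q t (m - r) else 0 := by
  have hd := derivation_newton (MvPolynomial.pderiv (R := K) r)
      (a := fun r => MvPolynomial.C ((1 - t ^ r) / (1 - q ^ r)) * MvPolynomial.X r) hr
      (fun s _ => pderiv_C_mul_X (fun r => (1 - t ^ r) / (1 - q ^ r)) r s) m
  have hq' : 1 - q ^ r ≠ 0 := sub_ne_zero.2 (hq r hr).symm
  have ht' : 1 - t ^ r ≠ 0 := sub_ne_zero.2 (ht r hr).symm
  rw [kap, map_mul, map_natCast, mul_right_comm, gfun, hd]
  split_ifs
  · rw [mul_right_comm, ← map_mul, div_mul_div_cancel₀ hq', div_self ht', map_one, one_mul]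
  · exact zero_mul _

theorem derivation_prod {R A : Type*} [CommRing R] [CommRing A] [Algebra R A]
    (d : Derivation R A A) (S : Finset ℕ) (f : ℕ → A) :
    d (∏ i ∈ S, f i) = ∑ i ∈ S, (∏ j ∈ S.erase i, f j) * d (f i) := by
  classical
  induction S using Finset.induction_on with
  | empty => simp
  | insert a S ha ih =>
    rw [Finset.prod_insert ha, Derivation.leibniz, Finset.sum_insert ha, Finset.erase_insert ha, ih,
      smul_eq_mul, smul_eq_mul, Finset.mul_sum, add_comm]
    congr 1
    refine Finset.sum_congr rfl fun i hi => ?_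
    have hai : a ≠ i := fun h => ha (h ▸ hi)
    rw [Finset.erase_insert_of_ne hai, Finset.prod_insert (fun h => ha (Finset.mem_of_mem_erase h)),
      mul_assoc]

theorem kap_mul_pderiv_gvec (hq : ∀ r, r ≠ 0 → q ^ r ≠ 1) (ht : ∀ r, r ≠ 0 → t ^ r ≠ 1) {r : ℕ}
    (hr : r ≠ 0) (α : ℕ →₀ ℕ) : MvPolynomial.C (kap q t r) * MvPolynomial.pderiv r (gvec q t α) =
      ∑ i ∈ α.support with r ≤ α i, gvec q t (α - Finsupp.single i r) := by
  classical
  rw [gvec_eq_prod α subset_rfl, derivation_prod, Finset.mul_sum, Finset.sum_filter]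
  refine Finset.sum_congr rfl fun i hi => ?_
  rw [mul_left_comm, kap_mul_pderiv_gfun hq ht hr]
  split_ifs
  · rw [gvec_eq_prod (α - Finsupp.single i r) (Finsupp.support_mono tsub_le_self),
      ← Finset.prod_erase_mul _ _ hi]
    congr 1
    · refine Finset.prod_congr rfl fun j hj => ?_
      have : i ≠ j := (Finset.ne_of_mem_erase hj).symm
      simp [this]
    · simp
  · exact mul_zero _

theorem coeff_psum_mul (R : Type*) [CommRing R] {r : ℕ} (hr : r ≠ 0) (F : MvPowerSeries ℕ R)
    (α : ℕ →₀ ℕ) : MvPowerSeries.coeff α (psum R r * F) =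
      ∑ i ∈ α.support with r ≤ α i, MvPowerSeries.coeff (α - Finsupp.single i r) F := by
  classical
  rw [MvPowerSeries.coeff_mul]
  symm
  refine Finset.sum_of_injOn (fun i => (Finsupp.single i r, α - Finsupp.single i r)) ?_ ?_ ?_ ?_
  · intro i _ j _ h
    have h1 : Finsupp.single i r = Finsupp.single j r := (Prod.mk.inj h).1
    exact Finsupp.single_left_injective hr h1
  · intro i hi
    have hi : i ∈ α.support ∧ r ≤ α i := by simpa using hi
    rw [Finset.mem_coe, HasAntidiagonal.mem_antidiagonal]
    exact add_tsub_cancel_of_le (Finsupp.single_le_iff.2 hi.2)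
  · rintro ⟨β, γ⟩ hx hn
    rw [HasAntidiagonal.mem_antidiagonal] at hx
    rw [coeff_psum, if_neg, zero_mul]
    rintro ⟨i, rfl⟩
    apply hn
    have hle : r ≤ α i := by rw [← hx]; simp
    refine ⟨i, ?_, ?_⟩
    · simp only [Finset.coe_filter, Set.mem_ofPred_eq, Finsupp.mem_support_iff]
      exact ⟨by omega, hle⟩
    · rw [← hx]
      simp
  · intro i _
    rw [coeff_psum, if_pos ⟨i, rfl⟩, one_mul]

/-- The products of the `g_r` are dual to the monomials. Multiplying by `p_a` replaces the
coefficient at `α` by the sum of those at `α - a e_i`, and the adjoint `κ_a ∂_a` does the same to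
the product of the `g_(α_i)`. Both sides thus obey one recursion in `s`. -/
theorem coeff_psum_prod_eq_pform (hq : ∀ r, r ≠ 0 → q ^ r ≠ 1) (ht : ∀ r, r ≠ 0 → t ^ r ≠ 1)
    {s : Multiset ℕ} (hs : ∀ a ∈ s, 0 < a) (α : ℕ →₀ ℕ) :
    MvPowerSeries.coeff α ((s.map (psum K)).prod) =
      pform q t ((s.map MvPolynomial.X).prod) (gvec q t α) := by
  classical
  induction s using Multiset.induction_on generalizing α with
  | empty =>
    rw [Multiset.map_zero, Multiset.prod_zero, Multiset.map_zero, Multiset.prod_zero, pform_one,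
      MvPowerSeries.coeff_one, gvec, Finsupp.prod, map_prod]
    have h : ∀ i, MvPolynomial.constantCoeff (gfun q t (α i)) = if α i = 0 then 1 else 0 :=
      fun i => constantCoeff_newton _ _
    simp only [h]
    split_ifs with hα
    · simp [hα]
    · obtain ⟨i, hi⟩ := Finsupp.support_nonempty_iff.2 hα
      rw [Finset.prod_eq_zero hi]
      exact if_neg (Finsupp.mem_support_iff.1 hi)
  | cons a s ih =>
    have ha : a ≠ 0 := (hs a (Multiset.mem_cons_self a s)).ne'
    rw [Multiset.map_cons, Multiset.prod_cons, coeff_psum_mul K ha, Multiset.map_cons,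
      Multiset.prod_cons, pform_X_mul, ← smul_eq_mul, ← map_smul, MvPolynomial.smul_eq_C_mul,
      kap_mul_pderiv_gvec hq ht ha, map_sum]
    exact Finset.sum_congr rfl fun i _ => ih (fun b hb => hs b (Multiset.mem_cons_of_mem hb)) _

/-- The span of the monomials of degree `n` in the power sums of positive index. -/
noncomputable def homSpan (K : Type*) [Field K] (n : ℕ) : Submodule K (MvPolynomial ℕ K) :=
  Submodule.span K {f | ∃ s : Multiset ℕ, (∀ a ∈ s, 0 < a) ∧ s.sum = n ∧
    (s.map MvPolynomial.X).prod = f}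

omit [CharZero K] in
theorem one_mem_homSpan : (1 : MvPolynomial ℕ K) ∈ homSpan K 0 :=
  Submodule.subset_span ⟨0, by simp, by simp, by simp⟩

omit [CharZero K] in
theorem mul_mem_homSpan {m n : ℕ} {f h : MvPolynomial ℕ K} (hf : f ∈ homSpan K m)
    (hh : h ∈ homSpan K n) : f * h ∈ homSpan K (m + n) := by
  have := Submodule.mul_mem_mul hf hh
  rw [homSpan, homSpan, Submodule.span_mul_span] at this
  refine Submodule.span_mono ?_ this
  rintro _ ⟨_, ⟨s, hs, hsum, rfl⟩, _, ⟨s', hs', hsum', rfl⟩, rfl⟩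
  refine ⟨s + s', fun a ha => ?_, by simp [hsum, hsum'], by simp⟩
  rcases Multiset.mem_add.1 ha with h | h
  exacts [hs a h, hs' a h]

theorem gfun_mem_homSpan (m : ℕ) : gfun q t m ∈ homSpan K m := by
  induction m using Nat.strong_induction_on with
  | _ m ih =>
  cases m with
  | zero =>
    rw [gfun_zero]
    exact one_mem_homSpan
  | succ m =>
    have h : ((m + 1 : ℕ) : MvPolynomial ℕ K) * gfun q t (m + 1) ∈ homSpan K (m + 1) := by
      rw [gfun, newton_succ]
      refine Submodule.sum_mem _ fun x hx => ?_
      have hx := HasAntidiagonal.mem_antidiagonal.1 hx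
      rw [mul_assoc]
      refine C_mul_mem _ ?_
      rw [show m + 1 = (x.1 + 1) + x.2 by omega]
      exact mul_mem_homSpan (Submodule.subset_span ⟨{x.1 + 1}, by simp, by simp, by simp⟩)
        (ih x.2 (by omega))
    have h2 := C_mul_mem (((m + 1 : ℕ) : K)⁻¹) h
    rw [← mul_assoc, ← map_natCast (MvPolynomial.C), ← map_mul,
      inv_mul_cancel₀ (Nat.cast_ne_zero.2 (Nat.succ_ne_zero m)), map_one, one_mul] at h2
    exact h2

theorem gvec_mem_homSpan (α : ℕ →₀ ℕ) : gvec q t α ∈ homSpan K α.degree := by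
  have : ∀ S : Finset ℕ, ∏ i ∈ S, gfun q t (α i) ∈ homSpan K (∑ i ∈ S, α i) := by
    classical
    intro S
    induction S using Finset.induction_on with
    | empty => exact one_mem_homSpan
    | insert a S ha ih =>
      rw [Finset.prod_insert ha, Finset.sum_insert ha]
      exact mul_mem_homSpan (gfun_mem_homSpan _) ih
  exact this α.support

omit [CharZero K] in
theorem prod_X_eq_monomial (s : Multiset ℕ) : (s.map MvPolynomial.X).prod =
    (MvPolynomial.monomial (Multiset.toFinsupp s) 1 : MvPolynomial ℕ K) := by
  induction s using Multiset.induction_on with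
  | empty => simp
  | cons a s ih =>
    rw [Multiset.map_cons, Multiset.prod_cons, ih, ← Multiset.singleton_add, Multiset.toFinsupp_add,
      Multiset.toFinsupp_singleton, ← mul_one (1 : K), ← MvPolynomial.monomial_mul, mul_one]
    rfl

end Duality

/-! ### Partitions and products of `g` -/

theorem DomLE.trans {n : ℕ} {a b c : n.Partition} (h : DomLE a b) (h' : DomLE b c) : DomLE a c :=
  fun i => (h i).trans (h' i)

theorem eq_of_take_sum_eq {M : Type*} [AddCommMonoid M] [IsLeftCancelAdd M] {l l' : List M}
    (hlen : l.length = l'.length)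
    (h : ∀ k, (l.take k).sum = (l'.take k).sum) : l = l' := by
  refine List.ext_getElem hlen fun i hi hi' => ?_
  have h1 := h (i + 1)
  rw [List.sum_take_succ l i hi, List.sum_take_succ l' i hi', h i] at h1
  exact add_left_cancel h1

/-- Otherwise a proper prefix of `l'` would already reach the total sum, although the remaining
parts are positive. -/
theorem length_le_of_take_sum_le {l l' : List ℕ} (hl : ∀ a ∈ l', 0 < a)
    (hsum : l.sum = l'.sum) (h : ∀ k, (l.take k).sum ≤ (l'.take k).sum) : l'.length ≤ l.length := by
  by_contra hlt
  have hlt := not_le.1 hlt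
  have h1 := h l.length
  rw [List.take_length] at h1
  have h2 := List.sum_take_add_sum_drop l' l.length
  have h3 : 0 < (l'.drop l.length).sum := by
    refine List.sum_pos _ (fun a ha => hl a (List.mem_of_mem_drop ha)) ?_
    simp only [ne_eq, List.drop_eq_nil_iff]
    omega
  omega

theorem sum_sort {n : ℕ} (μ : n.Partition) : (μ.parts.sort (· ≥ ·)).sum = n := by
  conv_rhs => rw [← μ.parts_sum, ← Multiset.sort_eq μ.parts (· ≥ ·)]
  rfl

theorem pos_of_mem_sort {n : ℕ} (μ : n.Partition) : ∀ a ∈ μ.parts.sort (· ≥ ·), 0 < a :=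
  fun _ ha => μ.parts_pos ((Multiset.mem_sort _).1 ha)

theorem partition_eq_of_sort_eq {n : ℕ} {a b : n.Partition}
    (h : a.parts.sort (· ≥ ·) = b.parts.sort (· ≥ ·)) : a = b := by
  apply Nat.Partition.ext
  rw [← Multiset.sort_eq a.parts (· ≥ ·), h, Multiset.sort_eq]

theorem DomLE.antisymm {n : ℕ} {a b : n.Partition} (h : DomLE a b) (h' : DomLE b a) : a = b := by
  refine partition_eq_of_sort_eq (eq_of_take_sum_eq (le_antisymm ?_ ?_)
    fun k => le_antisymm (h k) (h' k))
  · exact length_le_of_take_sum_le (pos_of_mem_sort a) (by rw [sum_sort, sum_sort]) h'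
  · exact length_le_of_take_sum_le (pos_of_mem_sort b) (by rw [sum_sort, sum_sort]) h

theorem DomLT.trans {n : ℕ} {a b c : n.Partition} (h : DomLT a b) (h' : DomLT b c) :
    DomLT a c := by
  refine ⟨h.1.trans h'.1, ?_⟩
  rintro rfl
  exact h.2 (h.1.antisymm h'.1)

theorem wellFounded_domLT (n : ℕ) : WellFounded (DomLT (n := n)) := by
  have : IsTrans n.Partition DomLT := ⟨fun _ _ _ => DomLT.trans⟩
  have : Std.Irrefl (DomLT (n := n)) := ⟨fun _ h => h.2 rfl⟩
  exact Finite.wellFounded_of_trans_of_irrefl _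

/-- Exchange argument: if `s` misses the head `a` of the decreasing list, any `b ∈ s` may be traded
for `a ≥ b`. -/
theorem multiset_sum_le_take_sum {L : List ℕ} (hL : L.Pairwise (· ≥ ·)) {s : Multiset ℕ} {k : ℕ}
    (hs : s ≤ (L : Multiset ℕ)) (hk : s.card ≤ k) : s.sum ≤ (L.take k).sum := by
  induction L generalizing s k with
  | nil =>
    have : s = 0 := by simpa using hs
    simp [this]
  | cons a L ih =>
    rw [List.pairwise_cons] at hL
    by_cases ha : a ∈ s
    · obtain ⟨s', rfl⟩ := Multiset.exists_cons_of_mem ha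
      rw [Multiset.card_cons] at hk
      obtain ⟨k, rfl⟩ := Nat.exists_eq_add_of_le' (show 1 ≤ k by omega)
      rw [← Multiset.cons_coe, Multiset.cons_le_cons_iff] at hs
      rw [Multiset.sum_cons, List.take_succ_cons, List.sum_cons]
      have := ih hL.2 hs (k := k) (by omega)
      omega
    · rw [← Multiset.cons_coe, Multiset.le_cons_of_notMem ha] at hs
      rcases Multiset.empty_or_exists_mem s with rfl | ⟨b, hb⟩
      · simp
      obtain ⟨s', rfl⟩ := Multiset.exists_cons_of_mem hb
      rw [Multiset.card_cons] at hk
      obtain ⟨k, rfl⟩ := Nat.exists_eq_add_of_le' (show 1 ≤ k by omega)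
      have hba : b ≤ a := hL.1 b (by simpa using Multiset.mem_of_le hs hb)
      rw [Multiset.sum_cons, List.take_succ_cons, List.sum_cons]
      have := ih hL.2 ((Multiset.le_cons_self s' b).trans hs) (k := k) (by omega)
      omega

theorem sum_filter_ne_zero (s : Multiset ℕ) : (s.filter (· ≠ 0)).sum = s.sum := by
  induction s using Multiset.induction_on with
  | empty => rfl
  | cons a s ih =>
    by_cases ha : a = 0
    · have hf : (a ::ₘ s).filter (· ≠ 0) = s.filter (· ≠ 0) :=
        Multiset.filter_cons_of_neg s (not_not.2 ha)
      rw [hf, ih, Multiset.sum_cons, ha, zero_add]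
    · rw [Multiset.filter_cons_of_pos (p := (· ≠ 0)) _ ha, Multiset.sum_cons, Multiset.sum_cons, ih]

theorem take_sum_le_of_coe_filter_eq {l L : List ℕ} (hL : L.Pairwise (· ≥ ·))
    (h : (l : Multiset ℕ).filter (· ≠ 0) = L) (k : ℕ) : (l.take k).sum ≤ (L.take k).sum := by
  have h1 : (((l.take k : List ℕ) : Multiset ℕ).filter (· ≠ 0)).sum = (l.take k).sum :=
    sum_filter_ne_zero _
  rw [← h1]
  refine multiset_sum_le_take_sum hL ?_ ?_
  · rw [← h]
    exact Multiset.filter_le_filter _ (Multiset.coe_le.2 (List.take_sublist k l).subperm)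
  · refine (Multiset.card_le_card (Multiset.filter_le _ _)).trans ?_
    simp

/-! ### Triangular families -/

section Triangular

variable {k V ι : Type*} [Field k] [AddCommGroup V] [Module k V] {lt : ι → ι → Prop}

/-- If `y` is unitriangular with respect to `x`, then `x` is unitriangular with respect to `y`. -/
theorem unitriangular_symm (hwf : WellFounded lt) (htrans : ∀ a b c, lt a b → lt b c → lt a c)
    {x y : ι → V} (h : ∀ i, y i - x i ∈ Submodule.span k (x '' {j | lt j i})) (i : ι) :
    x i - y i ∈ Submodule.span k (y '' {j | lt j i}) := by
  induction i using hwf.induction with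
  | _ i ih =>
  have h1 : Submodule.span k (x '' {j | lt j i}) ≤ Submodule.span k (y '' {j | lt j i}) := by
    refine Submodule.span_le.2 ?_
    rintro _ ⟨j, hj, rfl⟩
    have h2 : Submodule.span k (y '' {l | lt l j}) ≤ Submodule.span k (y '' {l | lt l i}) :=
      Submodule.span_mono (Set.image_mono fun l hl => htrans l j i hl hj)
    have h3 := Submodule.add_mem _ (h2 (ih j hj))
      (Submodule.subset_span (s := y '' {l | lt l i}) ⟨j, hj, rfl⟩)
    rwa [sub_add_cancel] at h3
  rw [← neg_sub]
  exact Submodule.neg_mem _ (h1 (h i))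

/-- On the span of the `x j` with `j` at most `i`, the map `E - c` is triangular with nonzero
diagonal entries `d j - c`, so `x i` has a preimage there. -/
theorem exists_preimage_of_triangular (hwf : WellFounded lt)
    (htrans : ∀ a b c, lt a b → lt b c → lt a c) {x : ι → V} {E : V →ₗ[k] V} {d : ι → k}
    (hE : ∀ i, E (x i) - d i • x i ∈ Submodule.span k (x '' {j | lt j i})) (c : k) (i : ι)
    (hc : d i ≠ c) (hc' : ∀ j, lt j i → d j ≠ c) :
    ∃ w ∈ Submodule.span k (x '' {j | lt j i ∨ j = i}), E w - c • w = x i := by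
  induction i using hwf.induction with
  | _ i ih =>
  have h1 : Submodule.span k (x '' {j | lt j i}) ≤
      (Submodule.span k (x '' {j | lt j i ∨ j = i})).map (E - c • LinearMap.id) := by
    refine Submodule.span_le.2 ?_
    rintro _ ⟨j, hj, rfl⟩
    obtain ⟨w, hw, hw'⟩ := ih j hj (hc' j hj) fun l hl => hc' l (htrans l j i hl hj)
    refine ⟨w, Submodule.span_mono (Set.image_mono ?_) hw, by simpa using hw'⟩
    rintro l (hl | rfl)
    exacts [Or.inl (htrans l j i hl hj), Or.inl hj]
  obtain ⟨w, hw, hw'⟩ := h1 (hE i)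
  have hw' : E w - c • w = E (x i) - d i • x i := by simpa using hw'
  refine ⟨(d i - c)⁻¹ • (x i - w), Submodule.smul_mem _ _ (Submodule.sub_mem _
    (Submodule.subset_span ⟨i, Or.inr rfl, rfl⟩) hw), ?_⟩
  have h2 : E (x i - w) - c • (x i - w) = (d i - c) • x i := by
    rw [map_sub, smul_sub, sub_sub_sub_comm, hw', sub_smul]
    abel
  rw [map_smul, smul_comm c, ← smul_sub, h2, smul_smul, inv_mul_cancel₀ (sub_ne_zero.2 hc), one_smul]

/-- `E - d i` maps the span strictly below `i` onto itself and sends `x i` into it. Subtracting from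
`x i` a lower vector with the same image gives the eigenvector. -/
theorem exists_eigenvector_of_triangular (hwf : WellFounded lt)
    (htrans : ∀ a b c, lt a b → lt b c → lt a c) {x : ι → V} {E : V →ₗ[k] V} {d : ι → k}
    (hE : ∀ i, E (x i) - d i • x i ∈ Submodule.span k (x '' {j | lt j i}))
    (hd : ∀ i j, lt j i → d j ≠ d i) (i : ι) :
    ∃ y, y - x i ∈ Submodule.span k (x '' {j | lt j i}) ∧ E y = d i • y := by
  have h1 : Submodule.span k (x '' {j | lt j i}) ≤
      (Submodule.span k (x '' {j | lt j i})).map (E - d i • LinearMap.id) := by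
    refine Submodule.span_le.2 ?_
    rintro _ ⟨j, hj, rfl⟩
    obtain ⟨w, hw, hw'⟩ := exists_preimage_of_triangular hwf htrans hE (d i) j (hd i j hj)
      fun l hl => hd i l (htrans l j i hl hj)
    refine ⟨w, Submodule.span_mono (Set.image_mono ?_) hw, by simpa using hw'⟩
    rintro l (hl | rfl)
    exacts [htrans l j i hl hj, hj]
  obtain ⟨w, hw, hw'⟩ := h1 (hE i)
  have hw' : E w - d i • w = E (x i) - d i • x i := by simpa using hw'
  refine ⟨x i - w, ?_, ?_⟩
  · rw [sub_sub_cancel_left]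
    exact Submodule.neg_mem _ hw
  · rw [map_sub, smul_sub, ← sub_eq_zero, sub_sub_sub_comm, hw', sub_self]

end Triangular

/-! ### Existence of the Macdonald family -/

theorem mcoord_msymm (R : Type*) [CommRing R] {n : ℕ} (μ ν : n.Partition) :
    mcoord R n (msymm R μ) ν = if ν = μ then 1 else 0 := by
  rw [mcoord_apply]
  change (if exponents (expVec ν) = μ.parts then (1 : R) else 0) = _
  rw [exponents_expVec]
  exact if_congr ⟨fun h => Nat.Partition.ext h, fun h => by rw [h]⟩ rfl rfl

theorem eq_sum_msymm (R : Type*) [CommRing R] {n : ℕ} (f : SymFun R n) :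
    f = ∑ μ, mcoord R n f μ • msymm R μ := by
  apply mcoord_injective R n
  ext ν
  rw [map_sum, Finset.sum_apply]
  simp [mcoord_msymm]

theorem degree_expVec {n : ℕ} (μ : n.Partition) : (expVec μ).degree = n := by
  rw [← sum_exponents, exponents_expVec, μ.parts_sum]

theorem gvec_expVec {K : Type*} [Field K] [CharZero K] (q t : K) {n : ℕ} (μ : n.Partition) :
    gvec q t (expVec μ) = ((μ.parts.sort (· ≥ ·)).map (gfun q t)).prod := by
  rw [gvec_eq_exponents, exponents_expVec]
  conv_lhs => rw [← Multiset.sort_eq μ.parts (· ≥ ·)]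
  rfl

/-- The lift of symmetric functions to polynomials in the power sums. -/
noncomputable def toPoly (n : ℕ) : SymFun QT n →ₗ[QT] MvPolynomial ℕ QT :=
  (psumBasis QT n).constr QT fun μ => (μ.parts.map MvPolynomial.X).prod

theorem toPoly_psumPart {n : ℕ} (μ : n.Partition) :
    toPoly n (psumPart QT μ) = (μ.parts.map MvPolynomial.X).prod := by
  rw [← psumBasis_apply, toPoly, Module.Basis.constr_basis]

/-- The component of degree `n` of a polynomial in the power sums, as a symmetric function. -/
noncomputable def ofPoly (n : ℕ) : MvPolynomial ℕ QT →ₗ[QT] SymFun QT n :=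
  ∑ μ : n.Partition,
    (MvPolynomial.lcoeff QT (Multiset.toFinsupp μ.parts)).smulRight (psumPart QT μ)

theorem ofPoly_apply {n : ℕ} (x : MvPolynomial ℕ QT) : ofPoly n x = ∑ μ : n.Partition,
    MvPolynomial.coeff (Multiset.toFinsupp μ.parts) x • psumPart QT μ := by
  simp [ofPoly, LinearMap.sum_apply]

theorem coeff_prod_X {n : ℕ} (μ ν : n.Partition) :
    MvPolynomial.coeff (Multiset.toFinsupp μ.parts)
      ((ν.parts.map MvPolynomial.X).prod : MvPolynomial ℕ QT) = if μ = ν then 1 else 0 := by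
  rw [prod_X_eq_monomial, MvPolynomial.coeff_monomial]
  refine if_congr ⟨fun h => ?_, fun h => by rw [h]⟩ rfl rfl
  exact (Nat.Partition.ext (Multiset.toFinsupp.injective h)).symm

/-- The restriction to `homSpan` is essential: `ofPoly` forgets all other degrees and every monomial
involving the variable of index `0`. -/
theorem toPoly_ofPoly {n : ℕ} {x : MvPolynomial ℕ QT} (hx : x ∈ homSpan QT n) :
    toPoly n (ofPoly n x) = x := by
  have : homSpan QT n ≤ LinearMap.eqLocus (toPoly n ∘ₗ ofPoly n) LinearMap.id := by
    refine Submodule.span_le.2 ?_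
    rintro _ ⟨s, hs, hsum, rfl⟩
    obtain ⟨ν, rfl⟩ : ∃ ν : n.Partition, ν.parts = s := ⟨⟨s, fun ha => hs _ ha, hsum⟩, rfl⟩
    change toPoly n (ofPoly n _) = _
    rw [ofPoly_apply]
    simp [coeff_prod_X, toPoly_psumPart]
  exact this hx

theorem wt_toFinsupp {n : ℕ} (μ : n.Partition) :
    wt qvar tvar (Multiset.toFinsupp μ.parts) = psumNorm μ := by
  rw [psumNorm, zPart, Finset.prod_multiset_map_count, Nat.cast_prod, ← Finset.prod_mul_distrib]
  refine Finset.prod_congr rfl fun r _ => ?_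
  simp only [Multiset.toFinsupp_apply, kap, mul_pow]
  push_cast
  ring

theorem macdonaldForm_ofPoly {n : ℕ} (x : MvPolynomial ℕ QT) (h : SymFun QT n) :
    macdonaldForm n (ofPoly n x) h = pform qvar tvar x (toPoly n h) := by
  refine LinearMap.congr_fun (f := macdonaldForm n (ofPoly n x))
    (g := pform qvar tvar x ∘ₗ toPoly n) ((psumBasis QT n).ext fun ν => ?_) h
  rw [LinearMap.comp_apply, psumBasis_apply, toPoly_psumPart, prod_X_eq_monomial, pform_comm,
    pform_monomial, ofPoly_apply, map_sum, LinearMap.sum_apply]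
  simp [macdonaldForm_psumPart, wt_toFinsupp, mul_comm]

theorem ofPoly_toPoly {n : ℕ} (f : SymFun QT n) : ofPoly n (toPoly n f) = f := by
  refine LinearMap.congr_fun (f := ofPoly n ∘ₗ toPoly n) (g := LinearMap.id)
    ((psumBasis QT n).ext fun ν => ?_) f
  rw [LinearMap.comp_apply, psumBasis_apply, toPoly_psumPart, ofPoly_apply]
  simp [coeff_prod_X]

theorem macdonaldForm_eq_pform {n : ℕ} (f h : SymFun QT n) :
    macdonaldForm n f h = pform qvar tvar (toPoly n f) (toPoly n h) := by
  rw [← macdonaldForm_ofPoly, ofPoly_toPoly]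

theorem macdonaldForm_comm {n : ℕ} (f h : SymFun QT n) :
    macdonaldForm n f h = macdonaldForm n h f := by
  rw [macdonaldForm_eq_pform, pform_comm, ← macdonaldForm_eq_pform]

theorem coeff_eq_pform {n : ℕ} (f : SymFun QT n) (α : ℕ →₀ ℕ) :
    MvPowerSeries.coeff α (f : MvPowerSeries ℕ QT) =
      pform qvar tvar (toPoly n f) (gvec qvar tvar α) := by
  refine LinearMap.congr_fun (f := MvPowerSeries.coeff α ∘ₗ (SymFun QT n).subtype)
    (g := (pform qvar tvar).flip (gvec qvar tvar α) ∘ₗ toPoly n)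
    ((psumBasis QT n).ext fun ν => ?_) f
  rw [LinearMap.comp_apply, LinearMap.comp_apply, psumBasis_apply, toPoly_psumPart]
  exact coeff_psum_prod_eq_pform (fun _ => qvar_pow_ne_one) (fun _ => tvar_pow_ne_one)
    (fun _ ha => ν.parts_pos ha) α

/-- The Macdonald operator on symmetric functions of degree `n`. -/
noncomputable def symOp (n : ℕ) : SymFun QT n →ₗ[QT] SymFun QT n :=
  ofPoly n ∘ₗ macOp qvar tvar ∘ₗ toPoly n

theorem symOp_selfAdjoint {n : ℕ} (f h : SymFun QT n) :
    macdonaldForm n (symOp n f) h = macdonaldForm n f (symOp n h) := by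
  rw [macdonaldForm_comm f, symOp, LinearMap.comp_apply, LinearMap.comp_apply, LinearMap.comp_apply,
    LinearMap.comp_apply, macdonaldForm_ofPoly, macdonaldForm_ofPoly,
    macOp_selfAdjoint (fun _ => tvar_pow_ne_one) tvar_ne_zero, pform_comm]

/-- Duality and self-adjointness move the operator onto the product of the `g_r`, where its
triangularity is known. -/
theorem coeff_symOp {n : ℕ} (f : SymFun QT n) {α : ℕ →₀ ℕ} (hα : α.degree = n) :
    MvPowerSeries.coeff α (symOp n f : MvPowerSeries ℕ QT) =
      pform qvar tvar (toPoly n f) (macOp qvar tvar (gvec qvar tvar α)) := by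
  have h : toPoly n (ofPoly n (gvec qvar tvar α)) = gvec qvar tvar α :=
    toPoly_ofPoly (by rw [← hα]; exact gvec_mem_homSpan α)
  rw [coeff_eq_pform, ← h, ← macdonaldForm_eq_pform, symOp, LinearMap.comp_apply,
    LinearMap.comp_apply, macdonaldForm_ofPoly, h,
    macOp_selfAdjoint (fun _ => tvar_pow_ne_one) tvar_ne_zero]

/-- By duality the pairing is a coefficient of `m_ρ`, nonzero only if `μ` rearranges to `ρ` after
dropping zeros. In that case the partial sums of `lam` are at most those of `μ`, which are at most
those of `ρ`. Equality `lam = ρ` would force `μ` to be `lam` itself, so `lam < ρ`. -/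
theorem pform_msymm_gz {n : ℕ} {lam ρ : n.Partition} {μ : List ℤ}
    (hμ : PrefixLE 0 (lam.parts.sort (· ≥ ·)) μ)
    (hne : μ ≠ (lam.parts.sort (· ≥ ·)).map (↑)) (hlt : ¬ DomLT lam ρ) :
    pform qvar tvar (toPoly n (msymm QT ρ)) (μ.map (gz qvar tvar)).prod = 0 := by
  -- A negative index makes the product zero; otherwise `μ` is a list of naturals, possibly unsorted
  -- and with zeros.
  by_cases hneg : ∃ a ∈ μ, a < 0
  · obtain ⟨a, ha, ha0⟩ := hneg
    rw [List.prod_eq_zero, map_zero]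
    exact List.mem_map.2 ⟨a, ha, by rw [gz, if_neg (by omega)]⟩
  push Not at hneg
  obtain ⟨ν, rfl⟩ : ∃ ν : List ℕ, ν.map (↑) = μ := by
    refine ⟨μ.map Int.toNat, ?_⟩
    rw [List.map_map]
    conv_rhs => rw [← List.map_id μ]
    exact List.map_congr_left fun a ha => Int.toNat_of_nonneg (hneg a ha)
  obtain ⟨α, hα⟩ := exists_exponents (s := (ν : Multiset ℕ).filter (· ≠ 0)) fun a ha =>
    Nat.pos_of_ne_zero (Multiset.mem_filter.1 ha).2
  have h1 : ((ν.map (fun a : ℕ => (a : ℤ))).map (gz qvar tvar)).prod = gvec qvar tvar α := by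
    rw [gvec_eq_exponents, hα, List.map_map]
    have h2 : ∀ s : Multiset ℕ, ((s.filter (· ≠ 0)).map (gfun qvar tvar)).prod =
        (s.map (gfun qvar tvar)).prod := by
      intro s
      induction s using Multiset.induction_on with
      | empty => rfl
      | cons a s ih =>
        by_cases ha : a = 0
        · have hf : (a ::ₘ s).filter (· ≠ 0) = s.filter (· ≠ 0) :=
            Multiset.filter_cons_of_neg s (not_not.2 ha)
          rw [hf, ih, Multiset.map_cons,
            Multiset.prod_cons, ha, gfun_zero, one_mul]
        · rw [Multiset.filter_cons_of_pos (p := (· ≠ 0)) _ ha, Multiset.map_cons, Multiset.prod_cons,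
            Multiset.map_cons, Multiset.prod_cons, ih]
    rw [h2]
    simp only [Function.comp_def, gz_natCast]
    rfl
  rw [h1, ← coeff_eq_pform]
  refine if_neg fun hρ => hlt ?_
  rw [hα] at hρ
  have hcast : ∀ l : List ℕ, (l.map (fun a : ℕ => (a : ℤ))).sum = ((l.sum : ℕ) : ℤ) := by
    intro l
    induction l with
    | nil => rfl
    | cons a l ih => rw [List.map_cons, List.sum_cons, ih, List.sum_cons, Nat.cast_add]
  have hpre : ∀ k, ((lam.parts.sort (· ≥ ·)).take k).sum ≤ (ν.take k).sum := by
    intro k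
    have := hμ.2.2 k
    rw [← List.map_take, hcast] at this
    omega
  have hsort : ∀ k, (ν.take k).sum ≤ ((ρ.parts.sort (· ≥ ·)).take k).sum :=
    take_sum_le_of_coe_filter_eq (Multiset.pairwise_sort _ _) (by rw [hρ, Multiset.sort_eq])
  refine ⟨fun k => (hpre k).trans (hsort k), ?_⟩
  rintro rfl
  refine hne ?_
  congr 1
  refine eq_of_take_sum_eq (by simpa using hμ.1) fun k => le_antisymm (hsort k) (hpre k)

/-- The triangularity on products of `g_r` is transposed: the coefficient at `lam` is the pairing of
`m_ρ` with the image of `g_lam`. That image is an eigenvalue multiple of `g_lam` plus higher terms,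
and the higher terms pair to zero unless `lam < ρ`. -/
theorem symOp_msymm {n : ℕ} (ρ : n.Partition) :
    symOp n (msymm QT ρ) - eigval qvar tvar (ρ.parts.sort (· ≥ ·)) • msymm QT ρ ∈
      Submodule.span QT (msymm QT '' {lam | DomLT lam ρ}) := by
  rw [eq_sum_msymm QT (symOp n (msymm QT ρ) - _)]
  refine Submodule.sum_mem _ fun lam _ => ?_
  by_cases hlt : DomLT lam ρ
  · exact Submodule.smul_mem _ _ (Submodule.subset_span ⟨lam, hlt, rfl⟩)
  rw [map_sub, Pi.sub_apply, map_smul, Pi.smul_apply, mcoord_msymm, mcoord_apply,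
    coeff_symOp _ (degree_expVec lam)]
  set d := eigval qvar tvar (lam.parts.sort (· ≥ ·))
  have h0 : pform qvar tvar (toPoly n (msymm QT ρ)) (macOp qvar tvar (gvec qvar tvar (expVec lam)) -
      MvPolynomial.C d * gvec qvar tvar (expVec lam)) = 0 := by
    have h := macOp_sub_mem_strictDomSpan (fun _ => qvar_pow_ne_one) tvar_ne_zero
      (lam.parts.sort (· ≥ ·))
    rw [← gvec_expVec] at h
    have hle : strictDomSpan qvar tvar (lam.parts.sort (· ≥ ·)) ≤
        LinearMap.ker (pform qvar tvar (toPoly n (msymm QT ρ))) := by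
      refine Submodule.span_le.2 ?_
      rintro _ ⟨μ, hμ, hne, rfl⟩
      exact pform_msymm_gz hμ hne hlt
    exact hle h
  rw [map_sub, sub_eq_zero, ← MvPolynomial.smul_eq_C_mul, map_smul, ← coeff_eq_pform] at h0
  rw [h0, ← mcoord_apply, mcoord_msymm]
  by_cases hl : lam = ρ
  · subst hl
    simp [d]
  · simp [hl]

/-- Eigenvectors of a self-adjoint operator with distinct eigenvalues are orthogonal. -/
theorem exists_isMacdonaldFamily (n : ℕ) : ∃ M, IsMacdonaldFamily n M := by
  have hinj : ∀ lam μ : n.Partition, lam ≠ μ → eigval qvar tvar (lam.parts.sort (· ≥ ·)) ≠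
      eigval qvar tvar (μ.parts.sort (· ≥ ·)) := fun lam μ hne h =>
    hne (partition_eq_of_sort_eq (eigval_injective (pos_of_mem_sort lam) (pos_of_mem_sort μ) h))
  choose M hM hE using exists_eigenvector_of_triangular (wellFounded_domLT n)
    (fun _ _ _ => DomLT.trans) (fun ρ => symOp_msymm (n := n) ρ) fun lam μ h => hinj μ lam h.2
  refine ⟨M, fun lam => ?_, fun lam μ hne => ?_⟩
  · have h := hM lam
    have hs : {μ | DomLT μ lam} = ((Finset.univ.filter fun μ => DomLT μ lam : Finset _) :
        Set n.Partition) := by ext; simp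
    rw [hs, Submodule.mem_span_image_finset_iff_exists_fun'] at h
    obtain ⟨v, hv⟩ := h
    exact ⟨v, by rw [hv, add_sub_cancel]⟩
  · have h := symOp_selfAdjoint (M lam) (M μ)
    rw [hE, hE, map_smul, LinearMap.smul_apply, map_smul, ← sub_eq_zero, ← sub_smul] at h
    exact (smul_eq_zero.1 h).resolve_left (sub_ne_zero.2 (hinj lam μ hne))

theorem isMacdonaldFamily_macdonald (n : ℕ) : IsMacdonaldFamily n (macdonald (n := n)) :=
  Classical.epsilon_spec (exists_isMacdonaldFamily n)

end SymFn
namespace SymFn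

open Finset Filter Topology

/-! ### Evaluation of rational functions -/

/-- `r` is a fraction `a / b` with `b (q, t) ≠ 0` and `c = a (q, t) / b (q, t)`. -/
def EvalsTo (q t : ℂ) (r : QT) (c : ℂ) : Prop :=
  ∃ a b : MvPolynomial (Fin 2) ℚ, MvPolynomial.aeval ![q, t] b ≠ 0 ∧
    r * algebraMap _ QT b = algebraMap _ QT a ∧
    c * MvPolynomial.aeval ![q, t] b = MvPolynomial.aeval ![q, t] a

section EvalsTo

variable {q t : ℂ} {r s : QT} {c d : ℂ}

/-- The reduced denominator divides every other denominator of `r`, by coprimality in the polynomial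
ring, so it does not vanish where `b` does not. Any admissible fraction may therefore be used to
compute the value. -/
theorem EvalsTo.evalAt_eq (h : EvalsTo q t r c) : evalAt q t r = c := by
  obtain ⟨a, b, hb, hr, hc⟩ := h
  set N := IsFractionRing.num (MvPolynomial (Fin 2) ℚ) r with hN
  set D := IsFractionRing.den (MvPolynomial (Fin 2) ℚ) r with hD
  have hrel : IsRelPrime N D := IsFractionRing.num_den_reduced (MvPolynomial (Fin 2) ℚ) r
  have hD0 : algebraMap _ QT (D : MvPolynomial (Fin 2) ℚ) ≠ 0 :=
    IsFractionRing.to_map_ne_zero_of_mem_nonZeroDivisors D.2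
  have hND : r * algebraMap _ QT (D : MvPolynomial (Fin 2) ℚ) = algebraMap _ QT N := by
    have : algebraMap _ QT N / algebraMap _ QT (D : MvPolynomial (Fin 2) ℚ) = r := by
      rw [← IsFractionRing.mk'_eq_div, IsFractionRing.mk'_num_den]
    rw [← this, div_mul_cancel₀ _ hD0]
  have h1 : N * b = a * D := by
    apply IsFractionRing.injective (MvPolynomial (Fin 2) ℚ) QT
    rw [map_mul, map_mul, ← hND, ← hr]
    ring
  obtain ⟨e, he⟩ : (D : MvPolynomial (Fin 2) ℚ) ∣ b :=
    hrel.symm.dvd_of_dvd_mul_left ⟨a, by rw [h1, mul_comm]⟩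
  have hDv : MvPolynomial.aeval ![q, t] (D : MvPolynomial (Fin 2) ℚ) ≠ 0 := by
    intro h0
    rw [he, map_mul, h0, zero_mul] at hb
    exact hb rfl
  have h2 := congrArg (MvPolynomial.aeval ![q, t]) h1
  rw [map_mul, map_mul, ← hc] at h2
  rw [evalAt, ← hN, ← hD, div_eq_iff hDv]
  apply mul_right_cancel₀ hb
  rw [h2]
  ring

theorem evalsTo_algebraMap (a : MvPolynomial (Fin 2) ℚ) :
    EvalsTo q t (algebraMap _ QT a) (MvPolynomial.aeval ![q, t] a) :=
  ⟨a, 1, by simp, by simp, by simp⟩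

theorem evalsTo_ratCast (a : ℚ) : EvalsTo q t (algebraMap ℚ QT a) (algebraMap ℚ ℂ a) := by
  have h := evalsTo_algebraMap (q := q) (t := t) (algebraMap ℚ (MvPolynomial (Fin 2) ℚ) a)
  rwa [← IsScalarTower.algebraMap_apply, AlgHom.commutes] at h

theorem evalsTo_zero : EvalsTo q t 0 0 := by simpa using evalsTo_ratCast (q := q) (t := t) 0

theorem evalsTo_one : EvalsTo q t 1 1 := by simpa using evalsTo_ratCast (q := q) (t := t) 1

theorem evalsTo_natCast (m : ℕ) : EvalsTo q t m m := by
  simpa using evalsTo_ratCast (q := q) (t := t) m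

theorem evalsTo_qvar : EvalsTo q t qvar q := by
  simpa [qvar] using evalsTo_algebraMap (q := q) (t := t) (MvPolynomial.X 0)

theorem evalsTo_tvar : EvalsTo q t tvar t := by
  simpa [tvar] using evalsTo_algebraMap (q := q) (t := t) (MvPolynomial.X 1)

theorem EvalsTo.mul (h : EvalsTo q t r c) (h' : EvalsTo q t s d) : EvalsTo q t (r * s) (c * d) := by
  obtain ⟨a, b, hb, hr, hc⟩ := h
  obtain ⟨a', b', hb', hr', hc'⟩ := h'
  refine ⟨a * a', b * b', by rw [map_mul]; exact mul_ne_zero hb hb', ?_, ?_⟩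
  · rw [map_mul, map_mul, ← hr, ← hr']
    ring
  · rw [map_mul, map_mul, ← hc, ← hc']
    ring

theorem EvalsTo.add (h : EvalsTo q t r c) (h' : EvalsTo q t s d) : EvalsTo q t (r + s) (c + d) := by
  obtain ⟨a, b, hb, hr, hc⟩ := h
  obtain ⟨a', b', hb', hr', hc'⟩ := h'
  refine ⟨a * b' + a' * b, b * b', by rw [map_mul]; exact mul_ne_zero hb hb', ?_, ?_⟩
  · rw [map_add, map_mul, map_mul, map_mul, ← hr, ← hr']
    ring
  · rw [map_add, map_mul, map_mul, map_mul, ← hc, ← hc']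
    ring

theorem EvalsTo.neg (h : EvalsTo q t r c) : EvalsTo q t (-r) (-c) := by
  simpa using (evalsTo_ratCast (q := q) (t := t) (-1)).mul h

theorem EvalsTo.sub (h : EvalsTo q t r c) (h' : EvalsTo q t s d) : EvalsTo q t (r - s) (c - d) := by
  simpa only [sub_eq_add_neg] using h.add h'.neg

theorem EvalsTo.pow (h : EvalsTo q t r c) (m : ℕ) : EvalsTo q t (r ^ m) (c ^ m) := by
  induction m with
  | zero => simpa using evalsTo_one
  | succ m ih => simpa only [pow_succ] using ih.mul h

theorem EvalsTo.inv (h : EvalsTo q t r c) (hc0 : c ≠ 0) : EvalsTo q t r⁻¹ c⁻¹ := by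
  obtain ⟨a, b, hb, hr, hc⟩ := h
  have ha : MvPolynomial.aeval ![q, t] a ≠ 0 := by
    rw [← hc]
    exact mul_ne_zero hc0 hb
  have hr0 : r ≠ 0 := by
    rintro rfl
    rw [zero_mul] at hr
    apply ha
    rw [IsFractionRing.injective (MvPolynomial (Fin 2) ℚ) QT (hr.symm.trans (map_zero _).symm),
      map_zero]
  refine ⟨b, a, ha, ?_, ?_⟩
  · rw [← hr, inv_mul_cancel_left₀ hr0]
  · rw [← hc, inv_mul_cancel_left₀ hc0]

theorem EvalsTo.div (h : EvalsTo q t r c) (h' : EvalsTo q t s d) (hd : d ≠ 0) :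
    EvalsTo q t (r / s) (c / d) := by
  simpa only [div_eq_mul_inv] using h.mul (h'.inv hd)

theorem EvalsTo.ne_zero (h : EvalsTo q t r c) (hc0 : c ≠ 0) : r ≠ 0 := by
  rintro rfl
  exact hc0 (h.evalAt_eq.symm.trans evalsTo_zero.evalAt_eq)

theorem EvalsTo.sum {ι : Type*} (S : Finset ι) {r : ι → QT} {c : ι → ℂ}
    (h : ∀ i ∈ S, EvalsTo q t (r i) (c i)) : EvalsTo q t (∑ i ∈ S, r i) (∑ i ∈ S, c i) := by
  classical
  induction S using Finset.induction_on with
  | empty => simpa using evalsTo_zero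
  | insert a S ha ih =>
    rw [Finset.sum_insert ha, Finset.sum_insert ha]
    exact (h a (Finset.mem_insert_self a S)).add (ih fun i hi => h i (Finset.mem_insert_of_mem hi))

theorem EvalsTo.prod {ι : Type*} (S : Finset ι) {r : ι → QT} {c : ι → ℂ}
    (h : ∀ i ∈ S, EvalsTo q t (r i) (c i)) : EvalsTo q t (∏ i ∈ S, r i) (∏ i ∈ S, c i) := by
  classical
  induction S using Finset.induction_on with
  | empty => simpa using evalsTo_one
  | insert a S ha ih =>
    rw [Finset.prod_insert ha, Finset.prod_insert ha]
    exact (h a (Finset.mem_insert_self a S)).mul (ih fun i hi => h i (Finset.mem_insert_of_mem hi))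

theorem EvalsTo.multiset_prod {ι : Type*} (S : Multiset ι) {r : ι → QT} {c : ι → ℂ}
    (h : ∀ i ∈ S, EvalsTo q t (r i) (c i)) : EvalsTo q t (S.map r).prod (S.map c).prod := by
  induction S using Multiset.induction_on with
  | empty => simpa using evalsTo_one
  | cons a S ih =>
    rw [Multiset.map_cons, Multiset.map_cons, Multiset.prod_cons, Multiset.prod_cons]
    exact (h a (Multiset.mem_cons_self a S)).mul (ih fun i hi => h i (Multiset.mem_cons_of_mem hi))

theorem EvalsTo.det {ι : Type*} [Fintype ι] [DecidableEq ι] {A : Matrix ι ι QT} {B : Matrix ι ι ℂ}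
    (h : ∀ i j, EvalsTo q t (A i j) (B i j)) : EvalsTo q t A.det B.det := by
  rw [Matrix.det_apply', Matrix.det_apply']
  refine EvalsTo.sum _ fun σ _ => EvalsTo.mul ?_ (EvalsTo.prod _ fun i _ => h _ _)
  simpa using evalsTo_ratCast (q := q) (t := t) ((Equiv.Perm.sign σ : ℤ) : ℚ)

end EvalsTo

/-! ### Gram matrices of the monomial symmetric functions -/

/-- The coefficient of `p_ν` in `m_μ`. -/
noncomputable def mToP {n : ℕ} (μ ν : n.Partition) : ℚ := (psumBasis ℚ n).repr (msymm ℚ μ) ν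

/-- Monomial functions and power sums have natural number coefficients, so the transition
coefficients found over `ℚ` serve over every field of characteristic zero. Gram matrices thus
commute with evaluation. -/
theorem msymm_eq_sum (K : Type*) [Field K] [CharZero K] {n : ℕ} (μ : n.Partition) :
    msymm K μ = ∑ ν, algebraMap ℚ K (mToP μ ν) • psumPart K ν := by
  have hQ : ∀ α, MvPowerSeries.coeff α (msymm ℚ μ : MvPowerSeries ℕ ℚ) =
      ∑ ν : n.Partition,
        mToP μ ν * ((MvPowerSeries.coeff α ((ν.parts.map (psum ℕ)).prod) : ℕ) : ℚ) := by
    intro α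
    conv_lhs => rw [← (psumBasis ℚ n).sum_repr (msymm ℚ μ)]
    rw [Submodule.coe_sum, map_sum]
    refine Finset.sum_congr rfl fun ν _ => ?_
    rw [psumBasis_apply, Submodule.coe_smul, map_smul, smul_eq_mul, ← coeff_psum_prod_cast]
    rfl
  ext α
  have h := congrArg (algebraMap ℚ K) (hQ α)
  rw [map_sum] at h
  rw [Submodule.coe_sum, map_sum]
  have h1 : ∀ ν : n.Partition, MvPowerSeries.coeff α ((algebraMap ℚ K (mToP μ ν) • psumPart K ν :
      SymFun K n) : MvPowerSeries ℕ K) = algebraMap ℚ K (mToP μ ν *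
      ((MvPowerSeries.coeff α ((ν.parts.map (psum ℕ)).prod) : ℕ) : ℚ)) := by
    intro ν
    rw [Submodule.coe_smul, map_smul, smul_eq_mul, map_mul, map_natCast, ← coeff_psum_prod_cast]
    rfl
  rw [Finset.sum_congr rfl fun ν _ => h1 ν, ← h]
  change (if _ then (1 : K) else 0) = algebraMap ℚ K (if _ then 1 else 0)
  split_ifs <;> simp

/-- The Gram matrix of the `m_μ` if the `p_ν` are orthogonal with norms `y ν`. -/
noncomputable def gram {F : Type*} [CommRing F] [Algebra ℚ F] {n : ℕ} (y : n.Partition → F) :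
    Matrix n.Partition n.Partition F :=
  Matrix.of fun μ μ' => ∑ ν, algebraMap ℚ F (mToP μ ν) * algebraMap ℚ F (mToP μ' ν) * y ν

theorem gram_apply {F : Type*} [CommRing F] [Algebra ℚ F] {n : ℕ} (y : n.Partition → F)
    (μ μ' : n.Partition) : gram y μ μ' =
      ∑ ν, algebraMap ℚ F (mToP μ ν) * algebraMap ℚ F (mToP μ' ν) * y ν := rfl

/-- The part of the Gram matrix below `lam`. -/
noncomputable def gramBelow {F : Type*} [CommRing F] [Algebra ℚ F] {n : ℕ} (lam : n.Partition)
    (y : n.Partition → F) : Matrix {μ // DomLT μ lam} {μ // DomLT μ lam} F :=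
  (gram y).submatrix Subtype.val Subtype.val

/-- The numerators in Cramer's rule for the coefficients of the Macdonald function. -/
noncomputable def gramNum {F : Type*} [CommRing F] [Algebra ℚ F] {n : ℕ} (lam : n.Partition)
    (y : n.Partition → F) (i : {μ // DomLT μ lam}) : F :=
  ((gramBelow lam y).updateCol i fun μ => -gram y μ lam).det

theorem macdonaldForm_msymm {n : ℕ} (μ μ' : n.Partition) :
    macdonaldForm n (msymm QT μ) (msymm QT μ') = gram psumNorm μ μ' := by
  rw [msymm_eq_sum QT μ, msymm_eq_sum QT μ', gram_apply]
  simp only [map_sum, LinearMap.sum_apply, map_smul, LinearMap.smul_apply, macdonaldForm_psumPart,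
    smul_eq_mul, mul_ite, mul_zero, Finset.sum_ite_eq', Finset.mem_univ, if_true]
  refine Finset.sum_congr rfl fun ν _ => ?_
  ring

/-- Positive norms make the form positive definite: a kernel vector `c` gives a vanishing sum of
positively weighted squares, hence `∑ c μ • m_μ = 0`, and the `m_μ` are independent. -/
theorem det_gramBelow_ne_zero {n : ℕ} (lam : n.Partition) {y : n.Partition → ℚ}
    (hy : ∀ ν, 0 < y ν) : (gramBelow lam y).det ≠ 0 := by
  intro h
  obtain ⟨c, hc0, hc⟩ := Matrix.exists_mulVec_eq_zero_iff.2 h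
  have h1 : ∑ ν, y ν * (∑ μ : {μ // DomLT μ lam}, c μ * mToP μ.1 ν) ^ 2 = 0 := by
    have h2 : c ⬝ᵥ (gramBelow lam y).mulVec c = 0 := by rw [hc, dotProduct_zero]
    rw [← h2]
    simp only [dotProduct, Matrix.mulVec, gramBelow, gram, Matrix.submatrix_apply, Matrix.of_apply,
      Finset.mul_sum, Finset.sum_mul, sq]
    rw [Finset.sum_comm]
    refine Finset.sum_congr rfl fun μ _ => ?_
    rw [Finset.sum_comm]
    refine Finset.sum_congr rfl fun μ' _ => ?_
    refine Finset.sum_congr rfl fun ν _ => ?_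
    simp only [eq_ratCast, Rat.cast_id]
    ring
  have h3 : ∀ ν, ∑ μ : {μ // DomLT μ lam}, c μ * mToP μ.1 ν = 0 := by
    intro ν
    have := (Finset.sum_eq_zero_iff_of_nonneg
      fun ν _ => mul_nonneg (hy ν).le (sq_nonneg _)).1 h1 ν (Finset.mem_univ ν)
    exact pow_eq_zero_iff two_ne_zero |>.1 ((mul_eq_zero.1 this).resolve_left (hy ν).ne')
  have h4 : ∑ μ : {μ // DomLT μ lam}, c μ • msymm ℚ μ.1 = 0 := by
    simp only [msymm_eq_sum ℚ, Finset.smul_sum, smul_smul]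
    rw [Finset.sum_comm]
    refine Finset.sum_eq_zero fun ν _ => ?_
    rw [← Finset.sum_smul]
    simp only [eq_ratCast, Rat.cast_id]
    rw [h3, zero_smul]
  apply hc0
  ext μ
  have h5 := congrFun (congrArg (mcoord ℚ n) h4) μ.1
  rw [map_sum, Finset.sum_apply, Finset.sum_eq_single μ] at h5
  · simpa [mcoord_msymm] using h5
  · intro μ' _ hne
    rw [map_smul, Pi.smul_apply, mcoord_msymm, if_neg, smul_zero]
    exact fun h => hne (Subtype.ext h.symm)
  · intro h
    exact absurd (Finset.mem_univ μ) h

theorem map_gramBelow {F F' : Type*} [CommRing F] [Algebra ℚ F] [CommRing F'] [Algebra ℚ F']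
    (f : F →ₐ[ℚ] F') {n : ℕ} (lam : n.Partition) (y : n.Partition → F) :
    f (gramBelow lam y).det = (gramBelow lam fun ν => f (y ν)).det := by
  rw [AlgHom.map_det]
  congr 1
  ext i j
  simp [gramBelow, gram]

/-- The coefficients of the Macdonald function solve the Gram system. -/
theorem det_gramBelow_mul_eq {n : ℕ} {lam : n.Partition} {v : n.Partition → QT}
    (hv : macdonald lam = msymm QT lam + ∑ μ with DomLT μ lam, v μ • msymm QT μ)
    (i : {μ // DomLT μ lam}) :
    (gramBelow lam psumNorm).det * v i.1 = gramNum lam psumNorm i := by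
  have hM := isMacdonaldFamily_macdonald n
  have htri : ∀ μ : n.Partition, macdonald μ - msymm QT μ ∈
      Submodule.span QT (msymm QT '' {j | DomLT j μ}) := by
    intro μ
    obtain ⟨w, hw⟩ := hM.triangular μ
    rw [hw, add_sub_cancel_left]
    refine Submodule.sum_mem _ fun j hj => Submodule.smul_mem _ _ (Submodule.subset_span ⟨j, ?_, rfl⟩)
    simpa using hj
  have horth : ∀ μ : n.Partition, DomLT μ lam → macdonaldForm n (msymm QT μ) (macdonald lam) = 0 := by
    intro μ hμ
    -- Inverting the triangular system puts `m_μ` in the span of the `M_j` with `j ≤ μ < lam`, all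
    -- orthogonal to `M_lam`.
    have h1 := unitriangular_symm (wellFounded_domLT n) (fun _ _ _ => DomLT.trans) htri μ
    have hle : Submodule.span QT (macdonald '' {j | DomLT j μ}) ≤
        LinearMap.ker ((macdonaldForm n).flip (macdonald lam)) := by
      refine Submodule.span_le.2 ?_
      rintro _ ⟨j, hj, rfl⟩
      exact hM.orthogonal j lam (DomLT.trans hj hμ).2
    have h2 : macdonaldForm n (msymm QT μ - macdonald μ) (macdonald lam) = 0 := hle h1
    rwa [map_sub, LinearMap.sub_apply, hM.orthogonal μ lam hμ.2, sub_zero] at h2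
  have hsys : (gramBelow lam psumNorm).mulVec (fun μ => v μ.1) =
      fun μ => -gram psumNorm μ.1 lam := by
    ext μ
    have h := horth μ.1 μ.2
    rw [hv, map_add, map_sum, macdonaldForm_msymm,
      Finset.sum_subtype (p := fun μ => DomLT μ lam) _ (by simp)] at h
    simp only [map_smul, macdonaldForm_msymm, smul_eq_mul] at h
    have h2 : (gramBelow lam psumNorm).mulVec (fun μ => v μ.1) μ =
        ∑ j : {μ // DomLT μ lam}, v j.1 * gram psumNorm μ.1 j.1 := by
      rw [Matrix.mulVec, dotProduct]
      exact Finset.sum_congr rfl fun j _ => mul_comm (gram psumNorm μ.1 j.1) (v j.1)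
    rw [h2]
    linear_combination h
  rw [gramNum, ← hsys, ← Matrix.cramer_apply, Matrix.cramer_eq_adjugate_mulVec, Matrix.mulVec_mulVec,
    Matrix.adjugate_mul, Matrix.smul_mulVec, Matrix.one_mulVec, Pi.smul_apply, smul_eq_mul]

/-- The norm of `p_μ` at complex values of the parameters. -/
noncomputable def psumNormAt {n : ℕ} (q t : ℂ) (μ : n.Partition) : ℂ :=
  (zPart μ : ℂ) * (μ.parts.map fun r => (1 - q ^ r) / (1 - t ^ r)).prod

theorem evalsTo_psumNorm {n : ℕ} {q t : ℂ} {μ : n.Partition} (ht : ∀ r ∈ μ.parts, t ^ r ≠ 1) :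
    EvalsTo q t (psumNorm μ) (psumNormAt q t μ) :=
  (evalsTo_natCast _).mul (EvalsTo.multiset_prod _ fun r hr =>
    (evalsTo_one.sub (evalsTo_qvar.pow r)).div (evalsTo_one.sub (evalsTo_tvar.pow r))
      (sub_ne_zero.2 (ht r hr).symm))

theorem evalsTo_gram {n : ℕ} {q t : ℂ} {y : n.Partition → QT} {z : n.Partition → ℂ}
    (h : ∀ ν, EvalsTo q t (y ν) (z ν)) (μ μ' : n.Partition) :
    EvalsTo q t (gram y μ μ') (gram z μ μ') := by
  rw [gram_apply, gram_apply]
  exact EvalsTo.sum _ fun ν _ => ((evalsTo_ratCast _).mul (evalsTo_ratCast _)).mul (h ν)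

theorem evalsTo_gramNum {n : ℕ} {lam : n.Partition} {q t : ℂ} {y : n.Partition → QT}
    {z : n.Partition → ℂ} (h : ∀ ν, EvalsTo q t (y ν) (z ν)) (i : {μ // DomLT μ lam}) :
    EvalsTo q t (gramNum lam y i) (gramNum lam z i) := by
  refine EvalsTo.det fun μ μ' => ?_
  rw [Matrix.updateCol_apply, Matrix.updateCol_apply]
  split_ifs
  · exact (evalsTo_gram h _ _).neg
  · exact evalsTo_gram h _ _

theorem evalsTo_msymm {n : ℕ} {q t : ℂ} (μ : n.Partition) (α : ℕ →₀ ℕ) :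
    EvalsTo q t (MvPowerSeries.coeff α (msymm QT μ : MvPowerSeries ℕ QT))
      (MvPowerSeries.coeff α (msymm ℂ μ : MvPowerSeries ℕ ℂ)) := by
  change EvalsTo q t (if _ then 1 else 0) (if _ then 1 else 0)
  split_ifs
  exacts [evalsTo_one, evalsTo_zero]

/-- Cramer's rule over `ℚ(q, t)` survives evaluation wherever the denominators `1 - t^r` and the
evaluated Gram determinant are nonzero; the latter forces the generic determinant to be nonzero too.
-/
theorem coeff_macdonaldAt {n : ℕ} (lam : n.Partition) {q t : ℂ}
    (ht : ∀ r, r ≠ 0 → r ≤ n → t ^ r ≠ 1) (hdet : (gramBelow lam (psumNormAt q t)).det ≠ 0)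
    (α : ℕ →₀ ℕ) :
    MvPowerSeries.coeff α (macdonaldAt lam q t) =
      MvPowerSeries.coeff α (msymm ℂ lam : MvPowerSeries ℕ ℂ) +
      ∑ μ : {μ // DomLT μ lam}, gramNum lam (psumNormAt q t) μ /
        (gramBelow lam (psumNormAt q t)).det *
        MvPowerSeries.coeff α (msymm ℂ μ.1 : MvPowerSeries ℕ ℂ) := by
  obtain ⟨v, hv⟩ := (isMacdonaldFamily_macdonald n).triangular lam
  have hnorm : ∀ ν : n.Partition, EvalsTo q t (psumNorm ν) (psumNormAt q t ν) := fun ν =>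
    evalsTo_psumNorm fun r hr => ht r (ν.parts_pos hr).ne' (ν.le_of_mem_parts hr)
  have hD : EvalsTo q t (gramBelow lam psumNorm).det (gramBelow lam (psumNormAt q t)).det :=
    EvalsTo.det fun _ _ => evalsTo_gram hnorm _ _
  refine EvalsTo.evalAt_eq ?_
  rw [hv, Submodule.coe_add, Submodule.coe_sum, map_add, map_sum,
    Finset.sum_subtype (p := fun μ => DomLT μ lam) _ (by simp)]
  refine (evalsTo_msymm lam α).add (EvalsTo.sum _ fun μ _ => ?_)
  rw [Submodule.coe_smul, map_smul, smul_eq_mul]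
  refine EvalsTo.mul ?_ (evalsTo_msymm μ.1 α)
  rw [show v μ.1 = gramNum lam psumNorm μ / (gramBelow lam psumNorm).det by
    rw [eq_div_iff (hD.ne_zero hdet), mul_comm, det_gramBelow_mul_eq hv]]
  exact (evalsTo_gramNum hnorm μ).div hD hdet

/-! ### The limit `p → 1` -/

theorem hasDerivAt_cpow_one (β : ℂ) : HasDerivAt (fun p : ℂ => p ^ β) β 1 := by
  simpa using (hasDerivAt_id (1 : ℂ)).cpow_const (c := β) (by simp [Complex.one_mem_slitPlane])

theorem tendsto_cpow_one (β : ℂ) : Tendsto (fun p : ℂ => p ^ β) (𝓝[≠] 1) (𝓝 1) := by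
  have := (hasDerivAt_cpow_one β).continuousAt.tendsto
  rw [Complex.one_cpow] at this
  exact this.mono_left nhdsWithin_le_nhds

/-- If `k ∣ r` then `ω^r = 1`, the quotient is `0/0`, and its limit is the ratio `r / (r β)` of
derivatives at `1`. Otherwise numerator and denominator both tend to `1 - ω^r ≠ 0`. -/
theorem tendsto_norm_factor {k : ℕ} {ω : ℂ} (hω : IsPrimitiveRoot ω k) {β : ℂ} (hβ : β ≠ 0) {r : ℕ}
    (hr : r ≠ 0) :
    (∀ᶠ p in 𝓝[≠] (1 : ℂ), (ω * p ^ β) ^ r ≠ 1) ∧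
    Tendsto (fun p : ℂ => (1 - (ω * p) ^ r) / (1 - (ω * p ^ β) ^ r)) (𝓝[≠] 1)
      (𝓝 (if k ∣ r then β⁻¹ else 1)) := by
  by_cases hk : k ∣ r
  · have hωr : ω ^ r = 1 := (hω.pow_eq_one_iff_dvd r).2 hk
    simp only [mul_pow, hωr, one_mul, if_pos hk]
    have h1 : HasDerivAt (fun p : ℂ => p ^ r) r 1 := by
      simpa using hasDerivAt_pow r (1 : ℂ)
    have h2 : HasDerivAt (fun p : ℂ => (p ^ β) ^ r) (r * β) 1 := by
      simpa using (hasDerivAt_cpow_one β).fun_pow r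
    rw [hasDerivAt_iff_tendsto_slope] at h1 h2
    have hr0 : (r : ℂ) ≠ 0 := Nat.cast_ne_zero.2 hr
    have hne := h2.eventually_ne (mul_ne_zero hr0 hβ)
    -- The slope of `(p^β)^r` at `1` tends to `r β ≠ 0`, so it is nonzero near `1`; a value `1` at
    -- some `p` would make it zero.
    refine ⟨?_, ?_⟩
    · filter_upwards [hne] with p hp h
      apply hp
      simp [slope, h]
    · have h3 := h1.div h2 (mul_ne_zero hr0 hβ)
      have e : (r : ℂ) / (r * β) = β⁻¹ := by field_simp
      rw [e] at h3
      refine h3.congr' ?_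
      filter_upwards [self_mem_nhdsWithin] with p hp
      have hp1 : p - 1 ≠ 0 := sub_ne_zero.2 hp
      simp only [slope_def_field, Pi.div_apply, one_pow, Complex.one_cpow]
      rw [div_div_div_cancel_right₀ hp1, ← neg_sub, ← neg_sub 1 ((p ^ β) ^ r), neg_div_neg_eq]
  · have hωr : ω ^ r ≠ 1 := fun h => hk ((hω.pow_eq_one_iff_dvd r).1 h)
    have h1 : Tendsto (fun p : ℂ => (ω * p ^ β) ^ r) (𝓝[≠] 1) (𝓝 (ω ^ r)) := by
      simpa using ((tendsto_cpow_one β).const_mul ω).pow r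
    have h2 : Tendsto (fun p : ℂ => (ω * p) ^ r) (𝓝[≠] 1) (𝓝 (ω ^ r)) := by
      have : Tendsto (fun p : ℂ => p) (𝓝[≠] 1) (𝓝 1) := tendsto_id.mono_left nhdsWithin_le_nhds
      simpa using (this.const_mul ω).pow r
    refine ⟨h1.eventually_ne hωr, ?_⟩
    rw [if_neg hk]
    have h3 : 1 - ω ^ r ≠ 0 := sub_ne_zero.2 hωr.symm
    have h4 := (h2.const_sub 1).div (h1.const_sub 1) h3
    rwa [div_self h3] at h4

/-- The limit of the norm of `p_μ`, as a function of `x = β⁻¹`. -/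
noncomputable def limNorm {F : Type*} [CommRing F] {n : ℕ} (k : ℕ) (x : F) (μ : n.Partition) : F :=
  (zPart μ : F) * (μ.parts.map fun r => if k ∣ r then x else 1).prod

theorem tendsto_psumNormAt {k : ℕ} {ω : ℂ} (hω : IsPrimitiveRoot ω k) {β : ℂ} (hβ : β ≠ 0) {n : ℕ}
    (μ : n.Partition) :
    Tendsto (fun p : ℂ => psumNormAt (ω * p) (ω * p ^ β) μ) (𝓝[≠] 1) (𝓝 (limNorm k β⁻¹ μ)) := by
  have h : ∀ s : Multiset ℕ, (∀ r ∈ s, r ≠ 0) → Tendsto (fun p : ℂ =>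
      (s.map fun r => (1 - (ω * p) ^ r) / (1 - (ω * p ^ β) ^ r)).prod) (𝓝[≠] 1)
      (𝓝 (s.map fun r => if k ∣ r then β⁻¹ else 1).prod) := by
    intro s hs
    exact tendsto_multiset_prod s fun r hr => (tendsto_norm_factor hω hβ (hs r hr)).2
  exact (h μ.parts fun r hr => (μ.parts_pos hr).ne').const_mul _

theorem continuous_gram {n : ℕ} (μ μ' : n.Partition) :
    Continuous fun y : n.Partition → ℂ => gram y μ μ' := by
  simp only [gram_apply]
  fun_prop

theorem continuous_det_gramBelow {n : ℕ} (lam : n.Partition) :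
    Continuous fun y : n.Partition → ℂ => (gramBelow lam y).det :=
  Continuous.matrix_det (continuous_matrix fun _ _ => continuous_gram _ _)

theorem continuous_gramNum {n : ℕ} (lam : n.Partition) (i : {μ // DomLT μ lam}) :
    Continuous fun y : n.Partition → ℂ => gramNum lam y i :=
  Continuous.matrix_det (Continuous.matrix_updateCol i
    (continuous_matrix fun _ _ => continuous_gram _ _)
    (continuous_pi fun _ => (continuous_gram _ _).neg))

theorem zPart_pos {n : ℕ} (μ : n.Partition) : 0 < zPart μ :=
  Finset.prod_pos fun _ hj => mul_pos (pow_pos (μ.parts_pos (Multiset.mem_toFinset.1 hj)) _)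
    (Nat.factorial_pos _)

/-- The determinant is a polynomial in `x = β⁻¹` with rational coefficients. At `x = 1` the norms
are `z_ν > 0`, so it is not the zero polynomial. Finitely many roots pull back to finitely many `β`,
inversion being injective. -/
theorem eventually_det_limNorm_ne_zero {n : ℕ} (lam : n.Partition) (k : ℕ) :
    ∀ᶠ β : ℂ in cofinite, (gramBelow lam (limNorm k β⁻¹)).det ≠ 0 := by
  let P : Polynomial ℚ := (gramBelow lam (limNorm k Polynomial.X)).det
  have hmap : ∀ (F : Type) [Field F] [Algebra ℚ F] (x : F),
      Polynomial.aeval x P = (gramBelow lam (limNorm k x)).det := by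
    intro F _ _ x
    rw [map_gramBelow]
    congr 2
    ext ν
    simp only [limNorm, map_mul, map_natCast, map_multiset_prod, Multiset.map_map]
    congr 3
    ext r
    simp only [Function.comp_apply]
    split_ifs <;> simp
  have hP : P ≠ 0 := by
    intro h
    have h1 := hmap ℚ 1
    rw [h, map_zero] at h1
    refine det_gramBelow_ne_zero lam (fun ν => ?_) h1.symm
    simpa [limNorm] using zPart_pos ν
  have hfin : {x : ℂ | Polynomial.aeval x P = 0}.Finite := by
    have h0 : P.map (algebraMap ℚ ℂ) ≠ 0 :=
      (Polynomial.map_ne_zero_iff (algebraMap ℚ ℂ).injective).2 hP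
    refine (Polynomial.finite_setOfPred_isRoot h0).subset fun x hx => ?_
    simpa [Polynomial.IsRoot, Polynomial.eval_map_algebraMap] using hx
  have hfin2 := hfin.preimage (f := fun β : ℂ => β⁻¹) inv_injective.injOn
  refine (Set.Finite.subset hfin2 fun β hβ => ?_ : Set.Finite _)
  have : (gramBelow lam (limNorm k β⁻¹)).det = 0 := by simpa using hβ
  simpa [hmap] using this

theorem eventually_tendsto_preUglov {k : ℕ} (hk : 1 ≤ k) {n : ℕ} (lam : n.Partition) :
    ∀ᶠ β : ℂ in cofinite, ∃ w : n.Partition → ℂ, ∀ α : ℕ →₀ ℕ,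
      Tendsto (fun p : ℂ => MvPowerSeries.coeff α (preUglov lam β k p)) (𝓝[≠] 1)
        (𝓝 (MvPowerSeries.coeff α (msymm ℂ lam + ∑ μ with DomLT μ lam, w μ • msymm ℂ μ :
          SymFun ℂ n).1)) := by
  filter_upwards [eventually_det_limNorm_ne_zero lam k,
    (Set.finite_singleton (0 : ℂ)).compl_mem_cofinite]
    with β hdet hβ
  have hβ : β ≠ 0 := hβ
  have hω : IsPrimitiveRoot (Complex.exp (2 * Real.pi * Complex.I / k)) k :=
    Complex.isPrimitiveRoot_exp k (by omega)
  unfold preUglov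
  set ω := Complex.exp (2 * Real.pi * Complex.I / k)
  have hy : Tendsto (fun p : ℂ => psumNormAt (n := n) (ω * p) (ω * p ^ β)) (𝓝[≠] 1)
      (𝓝 (limNorm k β⁻¹)) := tendsto_pi_nhds.2 fun μ => tendsto_psumNormAt hω hβ μ
  have hD := ((continuous_det_gramBelow lam).tendsto _).comp hy
  have hN := fun i => ((continuous_gramNum lam i).tendsto _).comp hy
  refine ⟨fun μ => if h : DomLT μ lam then gramNum lam (limNorm k β⁻¹) ⟨μ, h⟩ /
    (gramBelow lam (limNorm k β⁻¹)).det else 0, fun α => ?_⟩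
  have ht : ∀ᶠ p in 𝓝[≠] (1 : ℂ), ∀ r ∈ Finset.Icc 1 n, (ω * p ^ β) ^ r ≠ 1 := by
    rw [Filter.eventually_all_finset]
    exact fun r hr => (tendsto_norm_factor hω hβ
      (by have := Finset.mem_Icc.1 hr; omega)).1
  have hlim : Tendsto (fun p : ℂ => MvPowerSeries.coeff α (msymm ℂ lam : MvPowerSeries ℕ ℂ) +
      ∑ μ : {μ // DomLT μ lam}, gramNum lam (psumNormAt (ω * p) (ω * p ^ β)) μ /
        (gramBelow lam (psumNormAt (ω * p) (ω * p ^ β))).det *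
        MvPowerSeries.coeff α (msymm ℂ μ.1 : MvPowerSeries ℕ ℂ)) (𝓝[≠] 1)
      (𝓝 (MvPowerSeries.coeff α (msymm ℂ lam : MvPowerSeries ℕ ℂ) +
      ∑ μ : {μ // DomLT μ lam}, gramNum lam (limNorm k β⁻¹) μ /
        (gramBelow lam (limNorm k β⁻¹)).det *
        MvPowerSeries.coeff α (msymm ℂ μ.1 : MvPowerSeries ℕ ℂ))) :=
    Tendsto.const_add _ (tendsto_finsetSum _ fun μ _ => ((hN μ).div hD hdet).mul_const _)
  convert hlim.congr' ?_ using 2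
  · rw [Submodule.coe_add, Submodule.coe_sum, map_add, map_sum,
      Finset.sum_subtype (p := fun μ => DomLT μ lam) _ (by simp)]
    congr 1
    refine Finset.sum_congr rfl fun μ _ => ?_
    rw [Submodule.coe_smul, map_smul, smul_eq_mul]
    congr 1
    exact dif_pos μ.2
  · filter_upwards [ht, hD.eventually_ne hdet] with p hp hdp
    symm
    exact coeff_macdonaldAt lam (fun r hr0 hrn => hp r (Finset.mem_Icc.2 ⟨by omega, hrn⟩)) hdp α

/-! ### The Bender–Knuth involution -/

section BenderKnuth

variable {Y : YoungDiagram}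

/-- The number of entries less than `d` in row `i`. -/
def rowBelow (T : SemistandardYoungTableau Y) (i d : ℕ) : ℕ :=
  ((range (Y.rowLen i)).filter fun j => T i j < d).card

theorem rowBelow_le (T : SemistandardYoungTableau Y) (i d : ℕ) : rowBelow T i d ≤ Y.rowLen i :=
  (Finset.card_filter_le _ _).trans (Finset.card_range _).le

theorem rowBelow_mono (T : SemistandardYoungTableau Y) (i : ℕ) {d e : ℕ} (h : d ≤ e) :
    rowBelow T i d ≤ rowBelow T i e :=
  Finset.card_le_card fun j hj => by
    rw [Finset.mem_filter] at hj ⊢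
    exact ⟨hj.1, by omega⟩

/-- Rows increase weakly, so the entries below `d` fill an initial segment. A tableau is thereby
encoded by its numbers `rowBelow T i d`. -/
theorem lt_iff_lt_rowBelow (T : SemistandardYoungTableau Y) {i j : ℕ} (hj : j < Y.rowLen i)
    (d : ℕ) : T i j < d ↔ j < rowBelow T i d := by
  constructor
  · intro h
    have : range (j + 1) ⊆ (range (Y.rowLen i)).filter fun j => T i j < d := by
      intro l hl
      have hl := Finset.mem_range.1 hl
      rw [Finset.mem_filter, Finset.mem_range]
      exact ⟨by omega, (T.row_weak_of_le (by omega)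
        (YoungDiagram.mem_iff_lt_rowLen.2 hj)).trans_lt h⟩
    have h2 := Finset.card_le_card this
    rw [Finset.card_range] at h2
    exact h2
  · intro h
    by_contra hn
    have : ((range (Y.rowLen i)).filter fun j => T i j < d) ⊆ range j := by
      intro l hl
      rw [Finset.mem_filter, Finset.mem_range] at hl
      rw [Finset.mem_range]
      by_contra hlj
      exact hn ((T.row_weak_of_le (by omega)
        (YoungDiagram.mem_iff_lt_rowLen.2 hl.1)).trans_lt hl.2)
    have h2 := Finset.card_le_card this
    rw [Finset.card_range] at h2
    exact absurd h (not_lt.2 h2)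

theorem rowBelow_eq (T : SemistandardYoungTableau Y) {i d m : ℕ} (hm : m ≤ Y.rowLen i)
    (h : ∀ j < Y.rowLen i, T i j < d ↔ j < m) : rowBelow T i d = m := by
  have : ((range (Y.rowLen i)).filter fun j => T i j < d) = range m := by
    ext j
    rw [Finset.mem_filter, Finset.mem_range, Finset.mem_range]
    constructor
    · rintro ⟨h1, h2⟩
      exact (h j h1).1 h2
    · intro hj
      exact ⟨by omega, (h j (by omega)).2 hj⟩
  rw [rowBelow, this, Finset.card_range]

/-- Columns increase strictly, so above an entry at most `d` stands one less than `d`. These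
interlacing inequalities bound the entries `c` of a row by `bkLo` and `bkHi`. -/
theorem rowBelow_succ_le (T : SemistandardYoungTableau Y) (i d : ℕ) :
    rowBelow T (i + 1) (d + 1) ≤ rowBelow T i d := by
  by_contra h
  have h := not_le.1 h
  have h1 := rowBelow_le T (i + 1) (d + 1)
  have h2 := Y.rowLen_anti i (i + 1) (Nat.le_succ i)
  have h3 := (lt_iff_lt_rowBelow T (i := i + 1) (j := rowBelow T i d) (by omega) (d + 1)).2 h
  have h4 := T.col_strict (show i < i + 1 by omega)
    (YoungDiagram.mem_iff_lt_rowLen.2 (show rowBelow T i d < Y.rowLen (i + 1) by omega))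
  have h5 := (lt_iff_lt_rowBelow T (i := i) (j := rowBelow T i d) (by omega) d).1 (by omega)
  omega

/-- The smallest possible number of entries at most `c` in row `i`, if the other entries are
fixed. -/
def bkLo (T : SemistandardYoungTableau Y) (c i : ℕ) : ℕ :=
  max (rowBelow T i c) (rowBelow T (i + 1) (c + 2))

/-- The largest possible number of entries at most `c` in row `i`, if the other entries are
fixed. -/
def bkHi (T : SemistandardYoungTableau Y) (c : ℕ) : ℕ → ℕ
  | 0 => rowBelow T 0 (c + 2)
  | i + 1 => min (rowBelow T (i + 1) (c + 2)) (rowBelow T i c)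

/-- The number of entries at most `c` in row `i` after the Bender–Knuth involution. -/
def bkMid (T : SemistandardYoungTableau Y) (c i : ℕ) : ℕ :=
  bkLo T c i + bkHi T c i - rowBelow T i (c + 1)

theorem bkLo_le (T : SemistandardYoungTableau Y) (c i : ℕ) :
    bkLo T c i ≤ rowBelow T i (c + 1) :=
  max_le (rowBelow_mono T i (by omega)) (rowBelow_succ_le T i (c + 1))

theorem le_bkHi (T : SemistandardYoungTableau Y) (c i : ℕ) :
    rowBelow T i (c + 1) ≤ bkHi T c i := by
  cases i with
  | zero => exact rowBelow_mono T 0 (by omega)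
  | succ i => exact le_min (rowBelow_mono T _ (by omega)) (rowBelow_succ_le T i c)

theorem bkHi_le (T : SemistandardYoungTableau Y) (c i : ℕ) :
    bkHi T c i ≤ rowBelow T i (c + 2) := by
  cases i with
  | zero => exact le_rfl
  | succ i => exact min_le_left _ _

theorem bkLo_le_bkMid (T : SemistandardYoungTableau Y) (c i : ℕ) : bkLo T c i ≤ bkMid T c i := by
  have := le_bkHi T c i
  unfold bkMid
  omega

theorem bkMid_le_bkHi (T : SemistandardYoungTableau Y) (c i : ℕ) : bkMid T c i ≤ bkHi T c i := by
  have := bkLo_le T c i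
  unfold bkMid
  omega

/-- The entries after the Bender–Knuth involution. -/
def bkEntry (T : SemistandardYoungTableau Y) (c i j : ℕ) : ℕ :=
  if (i, j) ∈ Y ∧ c ≤ T i j ∧ T i j ≤ c + 1 then (if j < bkMid T c i then c else c + 1) else T i j

/-- The bounds are made for this. `bkLo` ensures that an entry at most `c + 1` has above it, after
the change, one at most `c`; `bkHi` ensures that a new `c` has above it an entry less than `c`. -/
theorem bkEntry_lt_succ (T : SemistandardYoungTableau Y) (c : ℕ) {i j : ℕ}
    (h : (i + 1, j) ∈ Y) : bkEntry T c i j < bkEntry T c (i + 1) j := by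
  have hi : (i, j) ∈ Y := Y.up_left_mem (Nat.le_succ i) le_rfl h
  have hlt := T.col_strict (show i < i + 1 by omega) h
  have h1 := lt_iff_lt_rowBelow T (YoungDiagram.mem_iff_lt_rowLen.1 hi) c
  have h2 := lt_iff_lt_rowBelow T (YoungDiagram.mem_iff_lt_rowLen.1 h) (c + 2)
  have h3 : rowBelow T (i + 1) (c + 2) ≤ bkMid T c i :=
    (le_max_right _ _).trans (bkLo_le_bkMid T c i)
  have h4 : bkMid T c (i + 1) ≤ rowBelow T i c := (bkMid_le_bkHi T c (i + 1)).trans (min_le_right _ _)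
  simp only [bkEntry, h, hi, true_and]
  split_ifs <;> omega

/-- The Bender–Knuth involution, exchanging the numbers of entries `c` and `c + 1`. -/
def benderKnuth (c : ℕ) (T : SemistandardYoungTableau Y) : SemistandardYoungTableau Y where
  entry := bkEntry T c
  row_weak' := by
    intro i j1 j2 hj hcell
    have hcell1 : (i, j1) ∈ Y := Y.up_left_mem le_rfl hj.le hcell
    have h := T.row_weak hj hcell
    simp only [bkEntry, hcell, hcell1, true_and]
    split_ifs <;> omega
  col_strict' := by
    intro i1 i2 j hi hcell
    induction i2, hi using Nat.le_induction with
    | base => exact bkEntry_lt_succ T c hcell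
    | succ m hm ih =>
      exact (ih (Y.up_left_mem (Nat.le_succ m) le_rfl hcell)).trans (bkEntry_lt_succ T c hcell)
  zeros' := by
    intro i j h
    simp [bkEntry, h, T.zeros h]

theorem benderKnuth_apply (c : ℕ) (T : SemistandardYoungTableau Y) (i j : ℕ) :
    benderKnuth c T i j = bkEntry T c i j := rfl

theorem rowBelow_benderKnuth_of_ne {c d : ℕ} (hd : d ≠ c + 1) (T : SemistandardYoungTableau Y)
    (i : ℕ) : rowBelow (benderKnuth c T) i d = rowBelow T i d := by
  refine congrArg Finset.card (Finset.filter_congr fun j _ => ?_)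
  rw [benderKnuth_apply, bkEntry]
  split_ifs <;> omega

theorem rowBelow_benderKnuth (c : ℕ) (T : SemistandardYoungTableau Y) (i : ℕ) :
    rowBelow (benderKnuth c T) i (c + 1) = bkMid T c i := by
  have hhi := (bkMid_le_bkHi T c i).trans (bkHi_le T c i)
  refine rowBelow_eq _ (hhi.trans (rowBelow_le T i _)) fun j hj => ?_
  have h1 := lt_iff_lt_rowBelow T hj c
  have h2 := lt_iff_lt_rowBelow T hj (c + 2)
  have h3 : rowBelow T i c ≤ bkMid T c i := (le_max_left _ _).trans (bkLo_le_bkMid T c i)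
  simp only [benderKnuth_apply, bkEntry, YoungDiagram.mem_iff_lt_rowLen.2 hj, true_and]
  split_ifs <;> omega

/-- In each row the involution reflects `rowBelow T i (c + 1)` in the interval from `bkLo` to
`bkHi`. The endpoints involve only the thresholds `c` and `c + 2`, which do not change. -/
theorem benderKnuth_involutive (c : ℕ) :
    Function.Involutive (benderKnuth (Y := Y) c) := by
  intro T
  have hlo : ∀ i, bkLo (benderKnuth c T) c i = bkLo T c i := fun i => by
    simp only [bkLo, rowBelow_benderKnuth_of_ne (show c ≠ c + 1 by omega),
      rowBelow_benderKnuth_of_ne (show c + 2 ≠ c + 1 by omega)]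
  have hhi : ∀ i, bkHi (benderKnuth c T) c i = bkHi T c i := by
    rintro (_ | i) <;> simp only [bkHi, rowBelow_benderKnuth_of_ne (show c ≠ c + 1 by omega),
      rowBelow_benderKnuth_of_ne (show c + 2 ≠ c + 1 by omega)]
  have hmid : ∀ i, bkMid (benderKnuth c T) c i = rowBelow T i (c + 1) := fun i => by
    have h1 := bkLo_le T c i
    have h2 := le_bkHi T c i
    rw [bkMid, hlo, hhi, rowBelow_benderKnuth, bkMid]
    omega
  ext i j
  by_cases hcell : (i, j) ∈ Y
  · have h1 := lt_iff_lt_rowBelow T (YoungDiagram.mem_iff_lt_rowLen.1 hcell) (c + 1)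
    rw [benderKnuth_apply, bkEntry, hmid]
    simp only [benderKnuth_apply, bkEntry, hcell, true_and]
    split_ifs <;> omega
  · rw [SemistandardYoungTableau.zeros _ hcell, SemistandardYoungTableau.zeros _ hcell]

/-- The number of entries `v`. -/
def content (T : SemistandardYoungTableau Y) (v : ℕ) : ℕ :=
  (Y.cells.filter fun x => T x.1 x.2 = v).card

theorem card_filter_cells (p : ℕ → ℕ → Prop) [∀ i j, Decidable (p i j)] {R : ℕ}
    (hR : Y.colLen 0 ≤ R) : (Y.cells.filter fun x => p x.1 x.2).card =
      ∑ i ∈ range R, ((range (Y.rowLen i)).filter fun j => p i j).card := by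
  rw [Finset.card_eq_sum_card_fiberwise (f := Prod.fst) (t := range R)]
  · refine Finset.sum_congr rfl fun i _ => ?_
    symm
    refine Finset.card_bij (fun j _ => (i, j)) ?_ ?_ ?_
    · intro j hj
      rw [Finset.mem_filter, Finset.mem_range, ← YoungDiagram.mem_iff_lt_rowLen] at hj
      simpa using hj
    · intro j _ j' _ h
      exact (Prod.mk.inj h).2
    · rintro ⟨i', j⟩ hx
      simp only [Finset.mem_filter, YoungDiagram.mem_cells] at hx
      obtain ⟨⟨h1, h2⟩, rfl⟩ := hx
      exact ⟨j, by simpa [YoungDiagram.mem_iff_lt_rowLen.1 h1] using h2, rfl⟩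
  · rintro ⟨i, j⟩ hx
    have hx : (i, j) ∈ Y := (Finset.mem_filter.1 hx).1
    have := YoungDiagram.mem_iff_lt_colLen.1 (Y.up_left_mem le_rfl (Nat.zero_le j) hx)
    exact Finset.mem_coe.2 (Finset.mem_range.2 (by omega))

theorem rowBelow_succ (T : SemistandardYoungTableau Y) (i v : ℕ) : rowBelow T i (v + 1) =
    rowBelow T i v + ((range (Y.rowLen i)).filter fun j => T i j = v).card := by
  rw [rowBelow, rowBelow, ← Finset.card_union_of_disjoint]
  · congr 1
    ext j
    simp only [Finset.mem_filter, Finset.mem_union]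
    constructor
    · rintro ⟨h1, h2⟩
      rcases Nat.lt_succ_iff_lt_or_eq.1 h2 with h | h
      exacts [Or.inl ⟨h1, h⟩, Or.inr ⟨h1, h⟩]
    · rintro (⟨h1, h2⟩ | ⟨h1, h2⟩)
      exacts [⟨h1, by omega⟩, ⟨h1, by omega⟩]
  · rw [Finset.disjoint_filter]
    intro j _ h1 h2
    omega

theorem content_add_sum_rowBelow (T : SemistandardYoungTableau Y) (v : ℕ) {R : ℕ}
    (hR : Y.colLen 0 ≤ R) : content T v + ∑ i ∈ range R, rowBelow T i v =
      ∑ i ∈ range R, rowBelow T i (v + 1) := by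
  rw [content, card_filter_cells (fun i j => T i j = v) hR, ← Finset.sum_add_distrib]
  exact Finset.sum_congr rfl fun i _ => by rw [rowBelow_succ, add_comm]

/-- `bkLo` of row `R` and `bkHi` of row `R + 1` are the maximum and minimum of the same two numbers,
so their sum is the sum of these numbers. -/
theorem sum_bkLo_add_sum_bkHi (T : SemistandardYoungTableau Y) (c R : ℕ) :
    ∑ i ∈ range R, bkLo T c i + ∑ i ∈ range (R + 1), bkHi T c i =
      ∑ i ∈ range R, rowBelow T i c + ∑ i ∈ range (R + 1), rowBelow T i (c + 2) := by
  induction R with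
  | zero => simp [bkHi]
  | succ R ih =>
    rw [Finset.sum_range_succ (bkLo T c), Finset.sum_range_succ (bkHi T c),
      Finset.sum_range_succ (fun i => rowBelow T i c),
      Finset.sum_range_succ (fun i => rowBelow T i (c + 2))]
    have h : bkLo T c R + bkHi T c (R + 1) = rowBelow T R c + rowBelow T (R + 1) (c + 2) := by
      rw [bkLo, bkHi, min_comm, max_add_min]
    omega

/-- Summing the reflection over rows, the total of `rowBelow` at `c + 1` becomes its total at `c`
plus that at `c + 2` minus the old one. Differences of consecutive totals are the contents, so these
are exchanged. -/
theorem content_benderKnuth (c : ℕ) (T : SemistandardYoungTableau Y) :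
    content (benderKnuth c T) c = content T (c + 1) := by
  set R := Y.colLen 0 with hR
  have h1 := content_add_sum_rowBelow (benderKnuth c T) c hR.ge
  have h2 : content T (c + 1) + ∑ i ∈ range R, rowBelow T i (c + 1) =
      ∑ i ∈ range R, rowBelow T i (c + 2) := content_add_sum_rowBelow T (c + 1) hR.ge
  simp only [rowBelow_benderKnuth_of_ne (show c ≠ c + 1 by omega), rowBelow_benderKnuth] at h1
  have h3 := sum_bkLo_add_sum_bkHi T c R
  -- Row `R` is empty, so the extra last terms in `h3` vanish.
  have h0 : Y.rowLen R = 0 := by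
    by_contra h
    have := YoungDiagram.mem_iff_lt_colLen.1
      (YoungDiagram.mem_iff_lt_rowLen.2 (Nat.pos_of_ne_zero h))
    omega
  have h4 : rowBelow T R (c + 2) = 0 := by
    have := rowBelow_le T R (c + 2)
    omega
  have h5 : bkHi T c R = 0 := by
    have := bkHi_le T c R
    omega
  rw [Finset.sum_range_succ, Finset.sum_range_succ, h4, h5] at h3
  have h6 : ∑ i ∈ range R, bkMid T c i + ∑ i ∈ range R, rowBelow T i (c + 1) =
      ∑ i ∈ range R, bkLo T c i + ∑ i ∈ range R, bkHi T c i := by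
    rw [← Finset.sum_add_distrib, ← Finset.sum_add_distrib]
    refine Finset.sum_congr rfl fun i _ => ?_
    have := le_bkHi T c i
    unfold bkMid
    omega
  omega

theorem content_benderKnuth_swap (c : ℕ) (T : SemistandardYoungTableau Y) (v : ℕ) :
    content (benderKnuth c T) v = content T (Equiv.swap c (c + 1) v) := by
  by_cases h1 : v = c
  · rw [h1, Equiv.swap_apply_left, content_benderKnuth]
  by_cases h2 : v = c + 1
  · rw [h2, Equiv.swap_apply_right, ← content_benderKnuth, benderKnuth_involutive]
  rw [Equiv.swap_apply_of_ne_of_ne h1 h2]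
  refine congrArg Finset.card (Finset.filter_congr fun x _ => ?_)
  rw [benderKnuth_apply, bkEntry]
  split_ifs <;> omega

/-- The number of semistandard tableaux of shape `Y` and content `f`. -/
noncomputable def kostka (Y : YoungDiagram) (f : ℕ → ℕ) : ℕ :=
  {T : SemistandardYoungTableau Y | ∀ i, content T i = f i}.ncard

theorem kostka_swap (f : ℕ → ℕ) (c : ℕ) :
    kostka Y (f ∘ Equiv.swap c (c + 1)) = kostka Y f := by
  rw [kostka, kostka, ← Set.ncard_image_of_injective _ (benderKnuth_involutive c).injective]
  congr 1
  ext T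
  constructor
  · rintro ⟨T', hT', rfl⟩ i
    have := hT' (Equiv.swap c (c + 1) i)
    rw [content_benderKnuth_swap, this, Function.comp_apply, Equiv.swap_apply_self]
  · intro hT
    refine ⟨benderKnuth c T, fun i => ?_, benderKnuth_involutive c T⟩
    rw [content_benderKnuth_swap, hT, Function.comp_apply]

end BenderKnuth

/-! ### Sorting exponent vectors -/

theorem sum_take_eq_sum_getD (l : List ℕ) (k : ℕ) :
    (l.take k).sum = ∑ i ∈ range k, l.getD i 0 := by
  induction l generalizing k with
  | nil => simp
  | cons a l ih =>
    cases k with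
    | zero => simp
    | succ k =>
      rw [List.take_succ_cons, List.sum_cons, ih, Finset.sum_range_succ']
      simp only [List.getD_cons_succ, List.getD_cons_zero]
      omega

theorem eq_getD_sort_of_antitone {γ : ℕ →₀ ℕ} (hγ : Antitone γ) (i : ℕ) :
    γ i = ((exponents γ).sort (· ≥ ·)).getD i 0 := by
  obtain ⟨m, hm⟩ : ∃ m, γ.support = range m := by
    refine ⟨γ.support.card, ?_⟩
    symm
    refine Finset.eq_of_superset_of_card_ge (fun a ha => ?_) (by simp)
    have hsub : range (a + 1) ⊆ γ.support := by
      intro b hb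
      have hb := Finset.mem_range.1 hb
      rw [Finsupp.mem_support_iff] at ha ⊢
      have := hγ (show b ≤ a by omega)
      omega
    have := Finset.card_le_card hsub
    rw [Finset.card_range] at this
    exact Finset.mem_range.2 (by omega)
  have hl : (exponents γ).sort (· ≥ ·) = (List.range m).map γ := by
    refine List.Perm.eq_of_pairwise' (r := (· ≥ ·)) (Multiset.pairwise_sort _ _) ?_ ?_
    · rw [List.pairwise_map]
      exact List.pairwise_lt_range.imp fun h => hγ h.le
    · rw [← Multiset.coe_eq_coe, Multiset.sort_eq, exponents, hm]
      rfl
  rw [hl]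
  by_cases hi : i < m
  · rw [List.getD_eq_getElem _ _ (by simpa using hi)]
    simp
  · rw [List.getD_eq_default _ _ (by simpa using hi)]
    have : i ∉ γ.support := by rw [hm]; simpa using hi
    simpa using this

/-- A quantity invariant under adjacent transpositions of the variables takes the same value on the
sorted exponent vector. -/
theorem exists_antitone_of_swap_invariant {X : Type*} {F : (ℕ → ℕ) → X}
    (hF : ∀ f c, F (f ∘ Equiv.swap c (c + 1)) = F f) (α : ℕ →₀ ℕ) :
    ∃ γ : ℕ →₀ ℕ, Antitone γ ∧ exponents γ = exponents α ∧ F γ = F α := by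
  -- Bubble sort: exchanging an ascent `α c < α (c + 1)` strictly lowers `∑ i * α i`.
  obtain ⟨N, hN⟩ : ∃ N, ∑ i ∈ α.support, i * α i = N := ⟨_, rfl⟩
  induction N using Nat.strong_induction_on generalizing α with
  | _ N ih =>
  by_cases hα : Antitone α
  · exact ⟨α, hα, rfl, rfl⟩
  obtain ⟨c, hc⟩ : ∃ c, α c < α (c + 1) := by
    by_contra h
    push Not at h
    exact hα (antitone_nat_of_succ_le h)
  let β : ℕ →₀ ℕ := α.embDomain (Equiv.swap c (c + 1)).toEmbedding
  have hβ : ∀ i, β i = α (Equiv.swap c (c + 1) i) := by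
    intro i
    have h := Finsupp.embDomain_apply_self (Equiv.swap c (c + 1)).toEmbedding α
      (Equiv.swap c (c + 1) i)
    rwa [Equiv.coe_toEmbedding, Equiv.swap_apply_self] at h
  have hcs : c + 1 ∈ α.support := by
    rw [Finsupp.mem_support_iff]
    omega
  have hlt : ∑ i ∈ β.support, i * β i < N := by
    let S := α.support ∪ β.support ∪ {c, c + 1}
    have h1 : ∀ δ : ℕ →₀ ℕ, δ.support ⊆ S → ∑ i ∈ δ.support, i * δ i = ∑ i ∈ S, i * δ i := by
      intro δ hδ
      refine Finset.sum_subset hδ fun i _ hi => ?_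
      rw [Finsupp.notMem_support_iff.1 hi, mul_zero]
    rw [← hN, h1 β (fun i hi => by simp only [S, Finset.mem_union]; tauto),
      h1 α (fun i hi => by simp only [S, Finset.mem_union]; tauto)]
    have hcS : c ∈ S := by simp [S]
    have hcS1 : c + 1 ∈ S.erase c := by simp [S]
    rw [← Finset.add_sum_erase _ _ hcS, ← Finset.add_sum_erase _ _ hcS1,
      ← Finset.add_sum_erase S _ hcS, ← Finset.add_sum_erase (S.erase c) _ hcS1]
    have h2 : ∑ i ∈ (S.erase c).erase (c + 1), i * β i =
        ∑ i ∈ (S.erase c).erase (c + 1), i * α i := by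
      refine Finset.sum_congr rfl fun i hi => ?_
      rw [hβ, Equiv.swap_apply_of_ne_of_ne (Finset.ne_of_mem_erase (Finset.mem_of_mem_erase hi))
        (Finset.ne_of_mem_erase hi)]
    rw [h2, hβ, hβ, Equiv.swap_apply_left, Equiv.swap_apply_right]
    nlinarith
  obtain ⟨γ, h1, h2, h3⟩ := ih _ hlt β rfl
  refine ⟨γ, h1, h2.trans (exponents_embDomain _ α), h3.trans ?_⟩
  rw [← hF α c]
  congr 1
  exact funext hβ

/-! ### Schur functions in terms of monomial symmetric functions -/

section Schur

variable {Y : YoungDiagram}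

theorem le_entry (T : SemistandardYoungTableau Y) {i j : ℕ} (h : (i, j) ∈ Y) : i ≤ T i j := by
  induction i with
  | zero => exact Nat.zero_le _
  | succ i ih =>
    have h1 := ih (Y.up_left_mem (Nat.le_succ i) le_rfl h)
    have h2 := T.col_strict (show i < i + 1 by omega) h
    omega

theorem card_entry_lt (T : SemistandardYoungTableau Y) (k : ℕ) :
    (Y.cells.filter fun x => T x.1 x.2 < k).card = ∑ v ∈ range k, content T v := by
  rw [Finset.card_eq_sum_card_fiberwise (f := fun x : ℕ × ℕ => T x.1 x.2) (t := range k)]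
  · refine Finset.sum_congr rfl fun v hv => ?_
    have hv := Finset.mem_range.1 hv
    rw [content, Finset.filter_filter]
    refine congrArg Finset.card (Finset.filter_congr fun x _ => ?_)
    constructor
    · exact fun h => h.2
    · exact fun h => ⟨by omega, h⟩
  · intro x hx
    exact Finset.mem_coe.2 (Finset.mem_range.2 (Finset.mem_filter.1 hx).2)

theorem content_highestWeight (v : ℕ) :
    content (SemistandardYoungTableau.highestWeight Y) v = Y.rowLen v := by
  rw [YoungDiagram.rowLen_eq_card, content, YoungDiagram.row]
  refine congrArg Finset.card (Finset.filter_congr fun x hx => ?_)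
  rw [SemistandardYoungTableau.highestWeight_apply, if_pos (by simpa using hx)]

theorem card_row_lt (k : ℕ) :
    (Y.cells.filter fun x => x.1 < k).card = ∑ v ∈ range k, Y.rowLen v := by
  have h := card_entry_lt (SemistandardYoungTableau.highestWeight Y) k
  simp only [content_highestWeight] at h
  rw [← h]
  refine congrArg Finset.card (Finset.filter_congr fun x hx => ?_)
  rw [SemistandardYoungTableau.highestWeight_apply, if_pos (by simpa using hx)]

theorem filter_entry_lt_subset (T : SemistandardYoungTableau Y) (k : ℕ) :
    (Y.cells.filter fun x => T x.1 x.2 < k) ⊆ Y.cells.filter fun x => x.1 < k := by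
  intro x hx
  rw [Finset.mem_filter] at hx ⊢
  exact ⟨hx.1, (le_entry T (by simpa using hx.1)).trans_lt hx.2⟩

/-- Entries are at least their row index, so those less than `k` lie in the first `k` rows. -/
theorem sum_content_le (T : SemistandardYoungTableau Y) (k : ℕ) :
    ∑ v ∈ range k, content T v ≤ ∑ v ∈ range k, Y.rowLen v := by
  rw [← card_entry_lt, ← card_row_lt]
  exact Finset.card_le_card (filter_entry_lt_subset T k)

/-- For this content the inclusion behind `sum_content_le` is an equality for every `k`: the first
`i + 1` rows hold exactly the entries at most `i`, so row `i` is constantly `i`. -/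
theorem kostka_rowLen : kostka Y Y.rowLen = 1 := by
  rw [kostka, Set.ncard_eq_one]
  refine ⟨SemistandardYoungTableau.highestWeight Y, Set.eq_singleton_iff_unique_mem.2
    ⟨content_highestWeight, fun T hT => ?_⟩⟩
  ext i j
  by_cases h : (i, j) ∈ Y
  · rw [SemistandardYoungTableau.highestWeight_apply, if_pos h]
    have h1 : (Y.cells.filter fun x => T x.1 x.2 < i + 1) = Y.cells.filter fun x => x.1 < i + 1 := by
      refine Finset.eq_of_subset_of_card_le (filter_entry_lt_subset T _) ?_
      rw [card_entry_lt, card_row_lt]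
      exact (Finset.sum_congr rfl fun v _ => (hT v).symm).le
    have h2 : (i, j) ∈ Y.cells.filter fun x => x.1 < i + 1 := by simpa using h
    rw [← h1, Finset.mem_filter] at h2
    have := le_entry T h
    have h3 : T i j < i + 1 := h2.2
    omega
  · rw [SemistandardYoungTableau.zeros _ h, SemistandardYoungTableau.zeros _ h]

theorem degree_eq_card_of_content_eq (T : SemistandardYoungTableau Y) {α : ℕ →₀ ℕ}
    (h : ∀ i, content T i = α i) : α.degree = Y.card := by
  have h1 : Y.cells.card = ∑ v ∈ α.support, content T v := by
    refine Finset.card_eq_sum_card_fiberwise fun x hx => ?_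
    rw [Finset.mem_coe, Finsupp.mem_support_iff, ← h, content]
    refine (Finset.card_pos.2 ⟨x, ?_⟩).ne'
    exact Finset.mem_filter.2 ⟨hx, rfl⟩
  rw [YoungDiagram.card, h1, Finsupp.degree]
  exact Finset.sum_congr rfl fun v _ => (h v).symm

end Schur

theorem rowLen_diagram {n : ℕ} (lam : n.Partition) (i : ℕ) :
    (diagram lam).rowLen i = (lam.parts.sort (· ≥ ·)).getD i 0 := by
  set l := lam.parts.sort (· ≥ ·) with hl
  by_cases hi : i < l.length
  · rw [List.getD_eq_getElem _ _ hi]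
    exact YoungDiagram.rowLen_ofRowLens ⟨i, hi⟩
  · rw [List.getD_eq_default _ _ (by omega)]
    by_contra h
    have := YoungDiagram.mem_iff_lt_rowLen.2 (Nat.pos_of_ne_zero h)
    obtain ⟨h1, -⟩ := YoungDiagram.mem_ofRowLens.1 this
    exact hi h1

theorem card_diagram {n : ℕ} (lam : n.Partition) : (diagram lam).card = n := by
  set l := lam.parts.sort (· ≥ ·) with hl
  have h := card_row_lt (Y := diagram lam) l.length
  rw [Finset.filter_true_of_mem] at h
  · rw [YoungDiagram.card, h]
    simp only [rowLen_diagram]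
    rw [← sum_take_eq_sum_getD, ← hl, List.take_length, sum_sort]
  · intro x hx
    obtain ⟨h1, -⟩ := YoungDiagram.mem_ofRowLens.1 ((YoungDiagram.mem_cells _).1 hx)
    exact h1

/-- The number of semistandard tableaux of shape `lam` and content `μ`. -/
noncomputable def kostkaNumber {n : ℕ} (lam μ : n.Partition) : ℕ :=
  kostka (diagram lam) fun i => (μ.parts.sort (· ≥ ·)).getD i 0

theorem kostkaNumber_self {n : ℕ} (lam : n.Partition) : kostkaNumber lam lam = 1 := by
  rw [kostkaNumber, ← kostka_rowLen (Y := diagram lam)]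
  congr 1
  funext i
  rw [rowLen_diagram]

theorem domLE_of_kostkaNumber_ne_zero {n : ℕ} {lam μ : n.Partition} (h : kostkaNumber lam μ ≠ 0) :
    DomLE μ lam := by
  obtain ⟨T, hT⟩ := Set.nonempty_of_ncard_ne_zero h
  intro k
  rw [sum_take_eq_sum_getD, sum_take_eq_sum_getD]
  have := sum_content_le T k
  simpa only [rowLen_diagram, show ∀ i, content T i = _ from hT] using this

theorem coeff_schur {n : ℕ} (R : Type*) [CommRing R] (lam : n.Partition) (α : ℕ →₀ ℕ) :
    MvPowerSeries.coeff α (schur R lam) = (kostka (diagram lam) α : R) := rfl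

/-- This is the symmetry of the Schur function: adjacent swaps do not change the number of tableaux,
so the exponent vector may be sorted. -/
theorem coeff_schur_of_exponents_eq {n : ℕ} (R : Type*) [CommRing R] {lam μ : n.Partition}
    {α : ℕ →₀ ℕ} (h : exponents α = μ.parts) :
    MvPowerSeries.coeff α (schur R lam) = (kostkaNumber lam μ : R) := by
  obtain ⟨γ, h1, h2, h3⟩ := exists_antitone_of_swap_invariant (F := kostka (diagram lam))
    kostka_swap α
  rw [coeff_schur, ← h3, kostkaNumber, ← h, ← h2]
  congr 2
  exact funext (eq_getD_sort_of_antitone h1)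

theorem coeff_msymm {n : ℕ} (R : Type*) [CommRing R] (μ : n.Partition) (α : ℕ →₀ ℕ) :
    MvPowerSeries.coeff α (msymm R μ : MvPowerSeries ℕ R) =
      if exponents α = μ.parts then 1 else 0 := rfl

theorem schur_eq_sum_msymm {n : ℕ} (R : Type*) [CommRing R] (lam : n.Partition) :
    schur R lam = ∑ μ, (kostkaNumber lam μ : R) • (msymm R μ : MvPowerSeries ℕ R) := by
  ext α
  rw [map_sum]
  simp only [map_smul, smul_eq_mul, coeff_msymm, mul_ite, mul_one, mul_zero]
  by_cases hα : α.degree = n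
  · obtain ⟨μ, hμ⟩ : ∃ μ : n.Partition, exponents α = μ.parts := by
      refine ⟨⟨exponents α, fun {i} hi => ?_, by rw [sum_exponents, hα]⟩, rfl⟩
      simp only [exponents, Multiset.mem_map, Finset.mem_val, Finsupp.mem_support_iff] at hi
      obtain ⟨j, hj, rfl⟩ := hi
      exact Nat.pos_of_ne_zero hj
    rw [coeff_schur_of_exponents_eq R hμ, Finset.sum_eq_single μ, if_pos hμ]
    · intro ν _ hν
      exact if_neg fun h => hν (Nat.Partition.ext (h.symm.trans hμ))
    · intro h
      exact absurd (Finset.mem_univ μ) h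
  · rw [Finset.sum_eq_zero, coeff_schur]
    · have : kostka (diagram lam) α = 0 := by
        by_contra h
        obtain ⟨T, hT⟩ := Set.nonempty_of_ncard_ne_zero h
        exact hα ((degree_eq_card_of_content_eq T hT).trans (card_diagram lam))
      rw [this, Nat.cast_zero]
    · intro μ _
      exact if_neg fun h => hα (by rw [← sum_exponents, h, μ.parts_sum])

theorem schur_sub_msymm_mem {n : ℕ} (K : Type*) [Field K] (lam : n.Partition) :
    schur K lam - (msymm K lam : MvPowerSeries ℕ K) ∈
      Submodule.span K ((fun μ : n.Partition => (msymm K μ : MvPowerSeries ℕ K)) ''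
        {μ | DomLT μ lam}) := by
  classical
  rw [schur_eq_sum_msymm, ← Finset.add_sum_erase _ _ (Finset.mem_univ lam), kostkaNumber_self,
    Nat.cast_one, one_smul, add_sub_cancel_left]
  refine Submodule.sum_mem _ fun μ hμ => ?_
  by_cases h : kostkaNumber lam μ = 0
  · rw [h, Nat.cast_zero, zero_smul]
    exact Submodule.zero_mem _
  · exact Submodule.smul_mem _ _ (Submodule.subset_span
      ⟨μ, ⟨domLE_of_kostkaNumber_ne_zero h, Finset.ne_of_mem_erase hμ⟩, rfl⟩)

end SymFn

/-! ### The limit in the Schur basis -/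

theorem mainTheorem5 (k : ℕ) (hk : 1 ≤ k) (n : ℕ) (lam : n.Partition) :
    ∀ᶠ β : ℂ in Filter.cofinite,
      (∀ α : ℕ →₀ ℕ,
        Filter.Tendsto (fun p : ℂ => MvPowerSeries.coeff α (SymFn.preUglov lam β k p))
          (nhdsWithin (1 : ℂ) {1}ᶜ)
          (nhds (MvPowerSeries.coeff α (SymFn.uglov lam β k)))) ∧
      ∃ u : n.Partition → ℂ,
        SymFn.uglov lam β k =
          SymFn.schur ℂ lam + ∑ μ with SymFn.DomLT μ lam, u μ • SymFn.schur ℂ μ := by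
  filter_upwards [SymFn.eventually_tendsto_preUglov hk lam] with β hβ
  obtain ⟨w, hw⟩ := hβ
  set f : SymFn.SymFun ℂ n := SymFn.msymm ℂ lam +
    ∑ μ with SymFn.DomLT μ lam, w μ • SymFn.msymm ℂ μ with hf
  have hU : SymFn.uglov lam β k = (f : MvPowerSeries ℕ ℂ) := by
    ext α
    exact (hw α).limUnder_eq
  refine ⟨fun α => by rw [hU]; exact hw α, ?_⟩
  let m : n.Partition → MvPowerSeries ℕ ℂ := fun μ => SymFn.msymm ℂ μ
  -- Schur functions are unitriangular in the `m_μ`, so the `m_μ` are unitriangular in the Schur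
  -- functions.
  have htri := SymFn.unitriangular_symm (SymFn.wellFounded_domLT n) (fun _ _ _ => SymFn.DomLT.trans)
    (x := m) (y := SymFn.schur ℂ) (SymFn.schur_sub_msymm_mem ℂ)
  have hmem : (f : MvPowerSeries ℕ ℂ) - SymFn.schur ℂ lam ∈
      Submodule.span ℂ (SymFn.schur ℂ '' {μ | SymFn.DomLT μ lam}) := by
    have h1 : (f : MvPowerSeries ℕ ℂ) - SymFn.schur ℂ lam =
        (m lam - SymFn.schur ℂ lam) + ∑ μ with SymFn.DomLT μ lam, w μ • m μ := by
      rw [hf, Submodule.coe_add, Submodule.coe_sum]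
      simp only [Submodule.coe_smul, m]
      abel
    rw [h1]
    refine Submodule.add_mem _ (htri lam) (Submodule.sum_mem _ fun μ hμ => Submodule.smul_mem _ _ ?_)
    have hμ : SymFn.DomLT μ lam := (Finset.mem_filter.1 hμ).2
    -- Each lower `m_μ` is `s_μ` plus Schur functions below `μ`, hence below `lam` by transitivity.
    rw [← sub_add_cancel (m μ) (SymFn.schur ℂ μ)]
    exact Submodule.add_mem _ (Submodule.span_mono
      (Set.image_mono fun ν hν => SymFn.DomLT.trans hν hμ) (htri μ))
      (Submodule.subset_span ⟨μ, hμ, rfl⟩)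
  have hs : {μ | SymFn.DomLT μ lam} = ((Finset.univ.filter fun μ => SymFn.DomLT μ lam : Finset _) :
      Set n.Partition) := by ext; simp
  rw [hs, Submodule.mem_span_image_finset_iff_exists_fun'] at hmem
  obtain ⟨u, hu⟩ := hmem
  exact ⟨u, by rw [hU, hu, add_sub_cancel]⟩
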